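/- A parameterized problem $(L,\kappa)$, with $L\subseteq\{0,1\}^*$ and $\kappa:\{0,1\}^*\to\mathbb{N}$, is in $\mathrm{EPNL}$ if there are a polynomial $p:\mathbb{N}\to\mathbb{N}$ and a polynomial-time deterministic Turing machine $M:\{0,1\}^*\times\{0,1\}^*\to\{0,1\}$ with four tapes, namely a read-only input tape (holding $x$), a read-only read-once certificate tape (holding $y$), and two binary read/write working tapes called the $k$-bit tape and the logspace tape (all of whose cells initially hold $0$), such that - for every $x\in\{0,1\}^*$: $x\in L$ if and only if there is $y\in\{0,1\}^{p(|x|)}$ with $M(x,y)=1$; - for all $x\in\{0,1\}^*$ and $y\in\{0,1\}^{p(|x|)}$, the machine $M$ on $(x,y)$ uses at most $\kappa(x)$ cells of the $k$-bit tape and $O(\log|x|)$ cells of the logspace tape. Consider the following decision problems. - Directed Hamiltonicity: given a directed graph $G=(V,E)$ (here and below $E\subseteq V\times V$, loops allowed), is there a directed cycle that passes each vertex exactly once? - Optimal Linear Arrangement: given a simple undirected graph $G=(V,E)$ and $b\in\mathbb{N}$, is there a bijection $\pi:V\to\{1,\dots,|V|\}$ with $\sum_{\{u,v\}\in E}|\pi(u)-\pi(v)|\le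 b$? - Directed Feedback Arc Set: given a directed graph $G=(V,E)$ and $b\in\mathbb{N}$, is there a set $F\subseteq E$ with $|F|\le b$ such that $(V,E\setminus F)$ has no directed cycle? - Set Cover: given a finite universe $U$, a finite family $S_1,\dots,S_m\subseteq U$ and $b\in\mathbb{N}$, are there at most $b$ of the sets whose union is $U$? Instances are encoded as binary words in a standard way: the size $|V|$ (respectively $|U|$ and $m$) in unary, then the adjacency matrix (respectively the incidence matrix of the family), then $b$, if there is one, in binary. Words that encode no instance are not in the language and have parameter $0$. **Lemma.** Directed Hamiltonicity, Optimal Linear Arrangement and Directed Feedback Arc Set, each parameterized by the number $|V|$ of vertices of the input graph, and Set Cover, parameterized by the number $|U|$ of elements, are in $\mathrm{EPNL}$. -/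

import Mathlib

namespace EPNL

/-! ### The verifier model -/

/-- A head movement on a two-way tape. -/
inductive Move where
  | left
  | stay
  | right

/-- The new position of a head on a one-way infinite tape (moving left at cell `0` has no effect). -/
def Move.apply : Move → ℕ → ℕ
  | .left, i => i - 1
  | .stay, i => i
  | .right, i => i + 1

/-- A read/write working tape: cells `0, 1, 2, …`, each holding one bit, and a head. -/
structure WorkTape where
  cells : ℕ → Bool
  head : ℕ

/-- The initial working tape: all cells hold `0` and the head is at cell `0`. -/
def WorkTape.blank : WorkTape := ⟨fun _ => false, 0⟩

/-- The bit under the head. -/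
def WorkTape.read (T : WorkTape) : Bool := T.cells T.head

/-- Write the bit `b` in the cell under the head, then move the head. -/
def WorkTape.update (T : WorkTape) (b : Bool) (d : Move) : WorkTape :=
  ⟨Function.update T.cells T.head b, d.apply T.head⟩

/-- The tape currently respects the space bound `s`: the head is at one of the cells `0, …, s - 1`.
A tape that is in its initial situation uses no cell, so it respects every bound, also `s = 0`. -/
def WorkTape.Within (T : WorkTape) (s : ℕ) : Prop :=
  T.head < s ∨ T = WorkTape.blank

/-- What a verifier does in one step: its next state, the bits written on the two working tapes,
the moves of the input head and the two working heads, and whether the certificate head advances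
by one cell (it never moves back: the certificate is read once). -/
structure Action (Q : Type) where
  next : Q
  writeK : Bool
  writeL : Bool
  moveInput : Move
  moveK : Move
  moveL : Move
  advanceCert : Bool

/-- A deterministic Turing machine with a read-only input tape, a read-only read-once certificate
tape, and two binary read/write working tapes, the `k`-bit tape and the logspace tape.
A state `q` with `output q = some b` is a halting state with output `b`.
The read-only tapes hold binary words, and a head behind the last bit of the word reads `none`. -/
structure Verifier where
  State : Type
  finite_state : Finite State
  start : State
  output : State → Option Bool
  /-- State, input symbol, `k`-bit tape symbol, logspace tape symbol, certificate symbol. -/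
  trans : State → Option Bool → Bool → Bool → Option Bool → Action State

/-- A configuration (on a fixed input): state, position of the input head, the unread part of the
certificate, and the two working tapes. -/
structure Config (M : Verifier) where
  state : M.State
  inputHead : ℕ
  cert : List Bool
  kTape : WorkTape
  lTape : WorkTape

namespace Verifier

variable (M : Verifier)

/-- The initial configuration with certificate `y`. -/
def init (y : List Bool) : Config M :=
  ⟨M.start, 0, y, WorkTape.blank, WorkTape.blank⟩

/-- One step on input `x`; halting configurations do not change. The input head stays within the
input and the one cell behind it. -/
def step (x : List Bool) (c : Config M) : Config M :=
  match M.output c.state with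
  | some _ => c
  | none =>
    let a := M.trans c.state x[c.inputHead]? c.kTape.read c.lTape.read c.cert.head?
    { state := a.next
      inputHead := min (a.moveInput.apply c.inputHead) x.length
      cert := if a.advanceCert then c.cert.tail else c.cert
      kTape := c.kTape.update a.writeK a.moveK
      lTape := c.lTape.update a.writeL a.moveL }

/-- The configuration after `t` steps on input `x` and certificate `y`. -/
def run (x y : List Bool) (t : ℕ) : Config M :=
  (M.step x)^[t] (M.init y)

/-- `M(x, y) = 1`: the machine halts with output `1`. -/
def Accepts (x y : List Bool) : Prop :=
  ∃ t, M.output (M.run x y t).state = some true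

/-- The machine halts on every pair of words, within a number of steps that is polynomial in the
total length of the pair. -/
def PolyTime : Prop :=
  ∃ q : Polynomial ℕ, ∀ x y : List Bool,
    (M.output (M.run x y (q.eval (x.length + y.length))).state).isSome

end Verifier

/-! ### Parameterized problems and the class EPNL -/

/-- A parameterized problem `(L, κ)` over the binary alphabet. -/
structure ParamProblem where
  lang : Language Bool
  param : List Bool → ℕ

/-- Membership in EPNL. The bound `c * (log₂ |x| + 1)` is `O(log |x|)`; the summand `1` only
matters for the finitely many inputs with `|x| ≤ 1`. -/
def InEPNL (A : ParamProblem) : Prop :=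
  ∃ (p : Polynomial ℕ) (M : Verifier), M.PolyTime ∧
    (∀ x : List Bool, x ∈ A.lang ↔
      ∃ y : List Bool, y.length = p.eval x.length ∧ M.Accepts x y) ∧
    ∃ c : ℕ, ∀ x y : List Bool, y.length = p.eval x.length → ∀ t : ℕ,
      (M.run x y t).kTape.Within (A.param x) ∧
      (M.run x y t).lTape.Within (c * (Nat.log 2 x.length + 1))

/-- The parameterized problem given by an injective binary encoding of instances, the set of
yes-instances and the parameter of an instance. Words that encode no instance are not in the
language and have parameter `0`. -/
noncomputable def ParamProblem.ofEncoding {ι : Type} (enc : ι ↪ List Bool) (yes : ι → Prop)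
    (size : ι → ℕ) : ParamProblem where
  lang := {x | ∃ I, enc I = x ∧ yes I}
  param := Function.extend enc size (fun _ => 0)

theorem ParamProblem.ofEncoding_param {ι : Type} (enc : ι ↪ List Bool) (yes : ι → Prop)
    (size : ι → ℕ) (I : ι) : (ParamProblem.ofEncoding enc yes size).param (enc I) = size I :=
  enc.injective.extend_apply size (fun _ => 0) I

/-! ### Binary encodings -/

/-- The word `1ⁿ 0` followed by `w`. -/
def unaryThen (n : ℕ) (w : List Bool) : List Bool :=
  List.replicate n true ++ false :: w

theorem unaryThen_inj {n m : ℕ} {v w : List Bool} (h : unaryThen n v = unaryThen m w) :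
    n = m ∧ v = w := by
  induction n generalizing m with
  | zero =>
    cases m with
    | zero => simpa [unaryThen] using h
    | succ m => simp [unaryThen, List.replicate_succ] at h
  | succ n ih =>
    cases m with
    | zero => simp [unaryThen, List.replicate_succ] at h
    | succ m =>
      have h' : unaryThen n v = unaryThen m w := by
        simpa [unaryThen, List.replicate_succ] using h
      obtain ⟨h1, h2⟩ := ih h'
      exact ⟨by rw [h1], h2⟩

open Classical in
/-- The 0/1-matrix of a relation, row by row: the entry in row `i` and column `j` is the bit at
position `n * i + j`. -/
noncomputable def matrixBits {m n : ℕ} (r : Fin m → Fin n → Prop) : List Bool :=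
  List.ofFn fun p : Fin (m * n) => decide (r p.divNat p.modNat)

theorem matrixBits_length {m n : ℕ} (r : Fin m → Fin n → Prop) :
    (matrixBits r).length = m * n := by
  simp [matrixBits]

theorem matrixBits_injective {m n : ℕ} :
    Function.Injective (matrixBits : (Fin m → Fin n → Prop) → List Bool) := by
  intro r s h
  have h' := List.ofFn_injective h
  funext i j
  have h2 := congrFun h' (finProdFinEquiv (i, j))
  have e : finProdFinEquiv.symm (finProdFinEquiv (i, j)) = (i, j) :=
    finProdFinEquiv.symm_apply_apply (i, j)
  have e1 : (finProdFinEquiv (i, j)).divNat = i := congrArg Prod.fst e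
  have e2 : (finProdFinEquiv (i, j)).modNat = j := congrArg Prod.snd e
  have h3 : r (finProdFinEquiv (i, j)).divNat (finProdFinEquiv (i, j)).modNat ↔
      s (finProdFinEquiv (i, j)).divNat (finProdFinEquiv (i, j)).modNat := decide_eq_decide.mp h2
  rw [e1, e2] at h3
  exact propext h3

theorem natBits_injective : Function.Injective Nat.bits := by
  intro a b h
  apply Nat.digits.injective 2
  rw [Nat.digits_two_eq_bits, Nat.digits_two_eq_bits, h]

/-! ### Directed Hamiltonicity -/

/-- A directed graph on the vertices `0, …, n - 1`. -/
structure DigraphInstance where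
  n : ℕ
  graph : Digraph (Fin n)

/-- The word `1ⁿ 0` followed by the adjacency matrix. -/
noncomputable def DigraphInstance.encode : DigraphInstance ↪ List Bool where
  toFun I := unaryThen I.n (matrixBits I.graph.Adj)
  inj' := by
    rintro ⟨n, G⟩ ⟨m, H⟩ h
    obtain ⟨h1, h2⟩ := unaryThen_inj h
    dsimp only at h1
    subst h1
    congr
    exact Digraph.ext (matrixBits_injective h2)

/-- There is a directed cycle that passes each vertex exactly once. -/
def DigraphInstance.Hamiltonian (I : DigraphInstance) : Prop :=
  ∃ c : Cycle (Fin I.n), c ≠ Cycle.nil ∧ c.Nodup ∧ (∀ v, v ∈ c) ∧ c.Chain I.graph.Adj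

/-- Directed Hamiltonicity parameterized by the number of vertices. -/
noncomputable def directedHamiltonicity : ParamProblem :=
  .ofEncoding DigraphInstance.encode DigraphInstance.Hamiltonian (fun I => I.n)

/-! ### Directed Feedback Arc Set -/

/-- A directed graph on the vertices `0, …, n - 1` and a bound. -/
structure FeedbackInstance where
  n : ℕ
  graph : Digraph (Fin n)
  bound : ℕ

/-- The word `1ⁿ 0`, then the adjacency matrix, then the bound in binary (least significant bit
first, without superfluous zeros). -/
noncomputable def FeedbackInstance.encode : FeedbackInstance ↪ List Bool where
  toFun I := unaryThen I.n (matrixBits I.graph.Adj ++ Nat.bits I.bound)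
  inj' := by
    rintro ⟨n, G, k⟩ ⟨m, H, l⟩ h
    obtain ⟨h1, h2⟩ := unaryThen_inj h
    dsimp only at h1
    subst h1
    obtain ⟨h3, h4⟩ := List.append_inj h2 (by simp only [matrixBits_length])
    congr
    · exact Digraph.ext (matrixBits_injective h3)
    · exact natBits_injective h4

/-- Some set of at most `bound` arcs meets every directed cycle, that is, its removal leaves a
graph without directed cycles. -/
def FeedbackInstance.Solvable (I : FeedbackInstance) : Prop :=
  ∃ F : Finset (Fin I.n × Fin I.n), (∀ e ∈ F, I.graph.Adj e.1 e.2) ∧ F.card ≤ I.bound ∧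
    ∀ v, ¬ Relation.TransGen (fun a b => I.graph.Adj a b ∧ (a, b) ∉ F) v v

/-- Directed Feedback Arc Set parameterized by the number of vertices. -/
noncomputable def directedFeedbackArcSet : ParamProblem :=
  .ofEncoding FeedbackInstance.encode FeedbackInstance.Solvable (fun I => I.n)

/-! ### Optimal Linear Arrangement -/

/-- A simple undirected graph on the vertices `0, …, n - 1` and a bound. -/
structure ArrangementInstance where
  n : ℕ
  graph : SimpleGraph (Fin n)
  bound : ℕ

/-- The word `1ⁿ 0`, then the (symmetric) adjacency matrix, then the bound in binary (least
significant bit first, without superfluous zeros). -/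
noncomputable def ArrangementInstance.encode : ArrangementInstance ↪ List Bool where
  toFun I := unaryThen I.n (matrixBits I.graph.Adj ++ Nat.bits I.bound)
  inj' := by
    rintro ⟨n, G, k⟩ ⟨m, H, l⟩ h
    obtain ⟨h1, h2⟩ := unaryThen_inj h
    dsimp only at h1
    subst h1
    obtain ⟨h3, h4⟩ := List.append_inj h2 (by simp only [matrixBits_length])
    congr
    · exact SimpleGraph.ext (matrixBits_injective h3)
    · exact natBits_injective h4

open Classical in
/-- The cost of a linear arrangement `π`: the sum of `|π u - π v|` over all edges `{u, v}`, each
edge being counted once, with `u < v`. -/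
noncomputable def arrangementCost {n : ℕ} (G : SimpleGraph (Fin n)) (π : Fin n ≃ Fin n) : ℕ :=
  ∑ u : Fin n, ∑ v : Fin n,
    if u < v ∧ G.Adj u v then (((π u : ℕ) : ℤ) - ((π v : ℕ) : ℤ)).natAbs else 0

/-- Some linear arrangement of the vertices has cost at most `bound`. -/
def ArrangementInstance.Solvable (I : ArrangementInstance) : Prop :=
  ∃ π : Fin I.n ≃ Fin I.n, arrangementCost I.graph π ≤ I.bound

/-- Optimal Linear Arrangement parameterized by the number of vertices. -/
noncomputable def optimalLinearArrangement : ParamProblem :=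
  .ofEncoding ArrangementInstance.encode ArrangementInstance.Solvable (fun I => I.n)

/-! ### Set Cover -/

/-- A family of `m` subsets of the universe `{0, …, n - 1}` and a bound. -/
structure SetCoverInstance where
  n : ℕ
  m : ℕ
  sets : Fin m → Finset (Fin n)
  bound : ℕ

/-- The word `1ⁿ 0 1ᵐ 0`, then the incidence matrix (one row for each set), then the bound in
binary (least significant bit first, without superfluous zeros). -/
noncomputable def SetCoverInstance.encode : SetCoverInstance ↪ List Bool where
  toFun I := unaryThen I.n (unaryThen I.m
    (matrixBits (fun i e => e ∈ I.sets i) ++ Nat.bits I.bound))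
  inj' := by
    rintro ⟨n, m, S, k⟩ ⟨n', m', S', k'⟩ h
    obtain ⟨h1, h⟩ := unaryThen_inj h
    dsimp only at h1
    subst h1
    obtain ⟨h1, h⟩ := unaryThen_inj h
    dsimp only at h1
    subst h1
    obtain ⟨h3, h4⟩ := List.append_inj h (by simp only [matrixBits_length])
    congr
    · funext i
      ext e
      exact iff_of_eq (congrFun (congrFun (matrixBits_injective h3) i) e)
    · exact natBits_injective h4

/-- Some at most `bound` of the sets cover the universe. -/
def SetCoverInstance.Solvable (I : SetCoverInstance) : Prop :=
  ∃ C : Finset (Fin I.m), C.card ≤ I.bound ∧ ∀ e : Fin I.n, ∃ i ∈ C, e ∈ I.sets i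

/-- Set Cover parameterized by the number of elements of the universe. -/
noncomputable def setCover : ParamProblem :=
  .ofEncoding SetCoverInstance.encode SetCoverInstance.Solvable (fun I => I.n)

end EPNL

/-! Each of the four problems has witnesses that can be checked in one pass while remembering only a
subset of `{0, …, n - 1}`, where `n` is the parameter, and boundedly many counters of polynomial
size. The subset goes on the `k`-bit tape and the counters go on the logspace tape.

For the three graph problems the witness is an ordering of the vertices, and the subset records the
vertices already seen. The certificate gives the ordering by `n` rounds of `n` bits, bit `u` of a
round proposing the vertex `u`. Proposals of seen vertices are ignored. Hence every certificate
yields a list without repetitions (`visit_props`), and every ordering arises (`exists_visit_eq`).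
The adjacency matrix is part of the input, so `n * n ≤ |x|` and certificates of length `|x|` are
long enough. For Hamiltonicity it suffices to remember also the first and the last vertex of the
path. For linear arrangements, an edge `{u, v}` leaves exactly `|π u - π v|` prefixes of the
ordering, so the cost is the sum of the cuts of all prefixes (`prefixSum_cutArcs`), and a cut
depends only on the set of seen vertices. For feedback arc sets, a digraph is acyclic iff it has a
topological ordering, so the least size of a solution is the least number of backward arcs of an
ordering, loops included. The backward arcs with a given tail are counted when this tail is appended
(`prefixSum_backArcs`). For Set Cover the certificate has one bit for each set, and the subset
records the covered elements.

The machines are compiled from a small language of loops over registers. Fragments of machines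
compose sequentially and by iteration, with bounds on time and space for the whole run. Registers
are stored in binary and bit-interleaved on the logspace tape. Loops run at most `|x|` times, so one
polynomial bounds both the running time and all register values (`Cmd.denote_reg_le`,
`Cmd.runs_compile`), and registers of polynomial size have `O(log |x|)` digits
(`exists_size_eval_le`). A syntactic check ensures that the `k`-bit tape is accessed only at
positions below the parameter. On words that encode no instance the parameter is `0`, so a first
program that never touches the `k`-bit tape decides whether the input is an instance, and only then
does the second program start (`inEPNL_of_program`). -/

namespace EPNL

/-! ### Machine fragments -/

/-- The data of a configuration: everything except the state. -/
structure Data where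
  inputHead : ℕ
  cert : List Bool
  kTape : WorkTape
  lTape : WorkTape

/-- Relabel the next state of an action. -/
def Action.map {Q R : Type} (f : Q → R) (a : Action Q) : Action R :=
  ⟨f a.next, a.writeK, a.writeL, a.moveInput, a.moveK, a.moveL, a.advanceCert⟩

/-- The effect of an action on the data. -/
def Action.perform {Q : Type} (a : Action Q) (x : List Bool) (d : Data) : Data where
  inputHead := min (a.moveInput.apply d.inputHead) x.length
  cert := if a.advanceCert then d.cert.tail else d.cert
  kTape := d.kTape.update a.writeK a.moveK
  lTape := d.lTape.update a.writeL a.moveL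

@[simp] theorem Action.map_next {Q R : Type} (f : Q → R) (a : Action Q) :
    (a.map f).next = f a.next := rfl

/-- A finite-state machine fragment, which exits with a value in `α`. -/
structure Frag (α : Type) where
  State : Type
  finite_state : Finite State
  start : State
  trans : State → Option Bool → Bool → Bool → Option Bool → Action (State ⊕ α)

/-- An input word together with bounds for the two working tapes. -/
structure Env where
  x : List Bool
  kBound : ℕ
  lBound : ℕ

/-- The data respect the space bounds, and the input head is on the input or behind it. -/
structure Env.Safe (E : Env) (d : Data) : Prop where
  input : d.inputHead ≤ E.x.length
  kTape : d.kTape.Within E.kBound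
  lTape : d.lTape.head < E.lBound

namespace Frag

variable {α β ρ : Type} {E : Env}

/-- The action of a fragment in a given state on given data. -/
def actionAt (F : Frag α) (x : List Bool) (s : F.State) (d : Data) : Action (F.State ⊕ α) :=
  F.trans s x[d.inputHead]? d.kTape.read d.lTape.read d.cert.head?

/-- `F.Steps E s d t a d'`: started in state `s` with data `d`, the fragment exits after `t` steps
with the value `a` and the data `d'`, and all data on the way are safe. -/
inductive Steps (E : Env) (F : Frag α) : F.State → Data → ℕ → α → Data → Prop
  | exit {s d a} (h : (F.actionAt E.x s d).next = .inr a)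
      (hs : E.Safe ((F.actionAt E.x s d).perform E.x d)) :
      Steps E F s d 1 a ((F.actionAt E.x s d).perform E.x d)
  | next {s d s' t a d'} (h : (F.actionAt E.x s d).next = .inl s')
      (hs : E.Safe ((F.actionAt E.x s d).perform E.x d))
      (hr : Steps E F s' ((F.actionAt E.x s d).perform E.x d) t a d') :
      Steps E F s d (t + 1) a d'

/-- Started with data `d`, the fragment exits within `T` steps with value `a` and data `d'`, and
all data on the way are safe. -/
def Runs (E : Env) (F : Frag α) (d : Data) (T : ℕ) (a : α) (d' : Data) : Prop :=
  ∃ t ≤ T, Steps E F F.start d t a d'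

theorem Runs.mono {F : Frag α} {d d' : Data} {T T' : ℕ} {a : α} (h : Runs E F d T a d')
    (hT : T ≤ T') : Runs E F d T' a d' := by
  obtain ⟨t, ht, hs⟩ := h
  exact ⟨t, ht.trans hT, hs⟩

theorem Steps.safe {F : Frag α} {s : F.State} {d d' : Data} {t : ℕ} {a : α}
    (h : Steps E F s d t a d') : E.Safe d' := by
  induction h with
  | exit h hs => exact hs
  | next h hs hr ih => exact ih

theorem Runs.safe {F : Frag α} {d d' : Data} {T : ℕ} {a : α}
    (h : Runs E F d T a d') : E.Safe d' := by
  obtain ⟨t, -, hs⟩ := h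
  exact hs.safe

/-- A single step. -/
def act (f : Option Bool → Bool → Bool → Option Bool → Action α) : Frag α where
  State := Unit
  finite_state := inferInstance
  start := ()
  trans _ i k l c := (f i k l c).map .inr

theorem runs_act {f : Option Bool → Bool → Bool → Option Bool → Action α} {d : Data}
    {a : Action α} (ha : f E.x[d.inputHead]? d.kTape.read d.lTape.read d.cert.head? = a)
    (hs : E.Safe (a.perform E.x d)) : Runs E (act f) d 1 a.next (a.perform E.x d) := by
  subst ha
  exact ⟨1, le_rfl, Steps.exit (F := act f) (s := ()) rfl hs⟩

/-- Sequential composition. -/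
def bind [Finite α] (F : Frag α) (G : α → Frag β) : Frag β where
  State := F.State ⊕ Σ a, (G a).State
  finite_state := by
    have := F.finite_state
    have := fun a => (G a).finite_state
    infer_instance
  start := .inl F.start
  trans s i k l c := match s with
    | .inl s => (F.trans s i k l c).map
        (Sum.elim (fun s' => .inl (.inl s')) (fun a => .inl (.inr ⟨a, (G a).start⟩)))
    | .inr s => ((G s.1).trans s.2 i k l c).map
        (Sum.elim (fun s' => .inl (.inr ⟨s.1, s'⟩)) .inr)

theorem Steps.bind_right [Finite α] {F : Frag α} {G : α → Frag β} {a : α} {s : (G a).State}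
    {d d' : Data} {t : ℕ} {b : β} (h : Steps E (G a) s d t b d') :
    Steps E (F.bind G) (.inr ⟨a, s⟩) d t b d' := by
  induction h with
  | @exit s d b h hs =>
    exact Steps.exit (F := F.bind G) (s := .inr ⟨a, s⟩)
      (by simp only [actionAt, bind, Action.map_next] at h ⊢; rw [h]; rfl) hs
  | @next s d s' t b d' h hs hr ih =>
    exact Steps.next (F := F.bind G) (s := .inr ⟨a, s⟩)
      (by simp only [actionAt, bind, Action.map_next] at h ⊢; rw [h]; rfl) hs ih

/-- The exiting step of `F` is redirected to the start of `G a`, so the transfer of control costs no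
step and the times add up exactly. -/
theorem Steps.bind_left [Finite α] {F : Frag α} {G : α → Frag β} {a : α} {s : F.State}
    {d d₁ d' : Data} {t t' : ℕ} {b : β} (h : Steps E F s d t a d₁)
    (h' : Steps E (G a) (G a).start d₁ t' b d') :
    Steps E (F.bind G) (.inl s) d (t + t') b d' := by
  induction h with
  | @exit s d a h hs =>
    rw [Nat.add_comm]
    exact Steps.next (F := F.bind G) (s := .inl s) (s' := .inr ⟨a, (G a).start⟩)
      (by simp only [actionAt, bind, Action.map_next] at h ⊢; rw [h]; rfl) hs h'.bind_right
  | @next s d s' t a d' h hs hr ih =>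
    rw [Nat.add_right_comm]
    exact Steps.next (F := F.bind G) (s := .inl s) (s' := .inl s')
      (by simp only [actionAt, bind, Action.map_next] at h ⊢; rw [h]; rfl) hs (ih h')

theorem Runs.bind [Finite α] {F : Frag α} {G : α → Frag β} {a : α}
    {d d₁ d' : Data} {T T' : ℕ} {b : β} (h : Runs E F d T a d₁) (h' : Runs E (G a) d₁ T' b d') :
    Runs E (F.bind G) d (T + T') b d' := by
  obtain ⟨t, ht, hs⟩ := h
  obtain ⟨t', ht', hs'⟩ := h'
  exact ⟨t + t', Nat.add_le_add ht ht', hs.bind_left hs'⟩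

/-- Iteration with a control state in `ρ`: the body either continues with a new control state or
exits. -/
def iter [Finite ρ] (f : ρ → Frag (ρ ⊕ α)) (r : ρ) : Frag α where
  State := Σ r, (f r).State
  finite_state := by
    have := fun r => (f r).finite_state
    infer_instance
  start := ⟨r, (f r).start⟩
  trans s i k l c := ((f s.1).trans s.2 i k l c).map
    (Sum.elim (fun s' => .inl ⟨s.1, s'⟩)
      (Sum.elim (fun r' => .inl ⟨r', (f r').start⟩) .inr))

theorem Steps.iter_exit [Finite ρ] {f : ρ → Frag (ρ ⊕ α)} {r₀ r : ρ} {s : (f r).State}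
    {d d' : Data} {t : ℕ} {o : ρ ⊕ α} (h : Steps E (f r) s d t o d') {a : α} (ho : o = .inr a) :
    Steps E (iter f r₀) ⟨r, s⟩ d t a d' := by
  induction h with
  | @exit s d b h hs =>
    subst ho
    exact Steps.exit (F := iter f r₀) (s := ⟨r, s⟩)
      (by simp only [actionAt, iter, Action.map_next] at h ⊢; rw [h]; rfl) hs
  | @next s d s' t b d' h hs hr ih =>
    exact Steps.next (F := iter f r₀) (s := ⟨r, s⟩) (s' := ⟨r, s'⟩)
      (by simp only [actionAt, iter, Action.map_next] at h ⊢; rw [h]; rfl) hs (ih ho)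

theorem Steps.iter_next [Finite ρ] {f : ρ → Frag (ρ ⊕ α)} {r₀ r r' : ρ} {s : (f r).State}
    {d d₁ d' : Data} {t t' : ℕ} {o : ρ ⊕ α} {a : α} (h : Steps E (f r) s d t o d₁)
    (ho : o = .inl r') (h' : Steps E (iter f r₀) ⟨r', (f r').start⟩ d₁ t' a d') :
    Steps E (iter f r₀) ⟨r, s⟩ d (t + t') a d' := by
  induction h with
  | @exit s d b h hs =>
    subst ho
    rw [Nat.add_comm]
    exact Steps.next (F := iter f r₀) (s := ⟨r, s⟩) (s' := ⟨r', (f r').start⟩)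
      (by simp only [actionAt, iter, Action.map_next] at h ⊢; rw [h]; rfl) hs h'
  | @next s d s' t b d' h hs hr ih =>
    rw [Nat.add_right_comm]
    exact Steps.next (F := iter f r₀) (s := ⟨r, s⟩) (s' := ⟨r, s'⟩)
      (by simp only [actionAt, iter, Action.map_next] at h ⊢; rw [h]; rfl) hs (ih ho h')

/-- The initial control state enters only the field `start` of `iter`. The states and the
transitions are the same for all initial control states. -/
theorem Steps.iter_congr [Finite ρ] {f : ρ → Frag (ρ ⊕ α)} {r₀ r₁ : ρ}
    {s : (iter f r₀).State} {d d' : Data} {t : ℕ} {a : α} (h : Steps E (iter f r₀) s d t a d') :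
    Steps E (iter f r₁) s d t a d' := by
  induction h with
  | exit h hs => exact Steps.exit (F := iter f r₁) h hs
  | next h hs hr ih => exact Steps.next (F := iter f r₁) h hs ih

theorem Runs.iter_exit [Finite ρ] {f : ρ → Frag (ρ ⊕ α)} {r : ρ} {d d' : Data} {T : ℕ} {a : α}
    (h : Runs E (f r) d T (.inr a) d') : Runs E (iter f r) d T a d' := by
  obtain ⟨t, ht, hs⟩ := h
  exact ⟨t, ht, hs.iter_exit rfl⟩

theorem Runs.iter_next [Finite ρ] {f : ρ → Frag (ρ ⊕ α)} {r r' : ρ} {d d₁ d' : Data} {T T' : ℕ}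
    {a : α} (h : Runs E (f r) d T (.inl r') d₁) (h' : Runs E (iter f r') d₁ T' a d') :
    Runs E (iter f r) d (T + T') a d' := by
  obtain ⟨t, ht, hs⟩ := h
  obtain ⟨t', ht', hs'⟩ := h'
  exact ⟨t + t', Nat.add_le_add ht ht', hs.iter_next rfl (Steps.iter_congr hs')⟩

/-- Exit at once (in one idle step). -/
def pure (a : α) : Frag α :=
  act fun _ k l _ => ⟨a, k, l, .stay, .stay, .stay, false⟩

theorem _root_.EPNL.WorkTape.update_read_stay (T : WorkTape) : T.update T.read .stay = T := by
  simp [WorkTape.update, WorkTape.read, Move.apply]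

theorem runs_pure {d : Data} (hd : E.Safe d) (a : α) : Runs E (pure a) d 1 a d := by
  have h : Action.perform ⟨a, d.kTape.read, d.lTape.read, .stay, .stay, .stay, false⟩ E.x d = d := by
    simp [Action.perform, WorkTape.update_read_stay, Move.apply, hd.input]
  have := runs_act (E := E) (d := d)
    (f := fun _ k l _ => (⟨a, k, l, .stay, .stay, .stay, false⟩ : Action α)) rfl (by rw [h]; exact hd)
  rwa [h] at this

/-! ### From fragments to verifiers -/

/-- The verifier that runs a fragment and outputs its exit value. -/
def toVerifier (F : Frag Bool) : Verifier where
  State := F.State ⊕ Bool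
  finite_state := by
    have := F.finite_state
    infer_instance
  start := .inl F.start
  output := Sum.elim (fun _ => none) some
  trans s i k l c := match s with
    | .inl s => F.trans s i k l c
    | .inr b => ⟨.inr b, k, l, .stay, .stay, .stay, false⟩

/-- The data of a configuration. -/
def _root_.EPNL.Config.data {M : Verifier} (c : Config M) : Data :=
  ⟨c.inputHead, c.cert, c.kTape, c.lTape⟩

/-- The configuration of the verifier with given state and data. -/
def config (F : Frag Bool) (s : F.State ⊕ Bool) (d : Data) : Config F.toVerifier :=
  ⟨s, d.inputHead, d.cert, d.kTape, d.lTape⟩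

theorem step_config_inl (F : Frag Bool) (x : List Bool) (s : F.State) (d : Data) :
    F.toVerifier.step x (F.config (.inl s) d) =
      F.config (F.actionAt x s d).next ((F.actionAt x s d).perform x d) := rfl

theorem step_config_inr (F : Frag Bool) (x : List Bool) (b : Bool) (d : Data) :
    F.toVerifier.step x (F.config (.inr b) d) = F.config (.inr b) d := rfl

theorem iterate_step_config_inr (F : Frag Bool) (x : List Bool) (b : Bool) (d : Data) (t : ℕ) :
    (F.toVerifier.step x)^[t] (F.config (.inr b) d) = F.config (.inr b) d := by
  induction t with
  | zero => rfl
  | succ t ih => rw [Function.iterate_succ_apply, step_config_inr, ih]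

theorem Steps.iterate {F : Frag Bool} {s : F.State} {d d' : Data} {t : ℕ} {b : Bool}
    (h : Steps E F s d t b d') :
    (F.toVerifier.step E.x)^[t] (F.config (.inl s) d) = F.config (.inr b) d' := by
  induction h with
  | @exit s d b h hs => simp [step_config_inl, h]
  | @next s d s' t b d' h hs hr ih =>
    rw [Function.iterate_succ_apply, step_config_inl, h, ih]

/-- Membership in the class bounds the space at all times. Up to the exit the bound is part of
`Steps`, and afterwards the configuration is constant. -/
theorem Steps.iterate_safe {F : Frag Bool} {s : F.State} {d d' : Data} {t : ℕ} {b : Bool}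
    (h : Steps E F s d t b d') (hd : E.Safe d) (n : ℕ) :
    E.Safe ((F.toVerifier.step E.x)^[n] (F.config (.inl s) d)).data := by
  induction h generalizing n with
  | @exit s d b h hs =>
    cases n with
    | zero => exact hd
    | succ n =>
      rw [Function.iterate_succ_apply, step_config_inl, h, iterate_step_config_inr]
      exact hs
  | @next s d s' t b d' h hs hr ih =>
    cases n with
    | zero => exact hd
    | succ n =>
      rw [Function.iterate_succ_apply, step_config_inl, h]
      exact ih hs n

/-- The data at the beginning of a computation. -/
def _root_.EPNL.Data.initial (y : List Bool) : Data := ⟨0, y, .blank, .blank⟩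

theorem Runs.output_run {F : Frag Bool} {y : List Bool} {d' : Data} {T : ℕ} {b : Bool}
    (h : Runs E F (.initial y) T b d') {n : ℕ} (hn : T ≤ n) :
    F.toVerifier.output (F.toVerifier.run E.x y n).state = some b := by
  obtain ⟨t, ht, hs⟩ := h
  have e : (F.toVerifier.run E.x y n) = F.config (.inr b) d' := by
    obtain ⟨m, rfl⟩ := Nat.exists_eq_add_of_le (ht.trans hn)
    rw [Nat.add_comm]
    change (F.toVerifier.step E.x)^[m + t] (F.config (.inl F.start) (.initial y)) = _
    rw [Function.iterate_add_apply, hs.iterate, iterate_step_config_inr]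
  rw [e]
  rfl

theorem Runs.safe_run {F : Frag Bool} {y : List Bool} {d' : Data} {T : ℕ} {b : Bool}
    (h : Runs E F (.initial y) T b d') (h0 : E.Safe (.initial y)) (n : ℕ) :
    E.Safe (F.toVerifier.run E.x y n).data := by
  obtain ⟨t, ht, hs⟩ := h
  exact hs.iterate_safe h0 n

theorem run_output_mono (M : Verifier) (x y : List Bool) {t n : ℕ} (h : t ≤ n) {b : Bool}
    (hb : M.output (M.run x y t).state = some b) : M.output (M.run x y n).state = some b := by
  induction n, h using Nat.le_induction with
  | base => exact hb
  | succ n hn ih =>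
    have : M.run x y (n + 1) = M.step x (M.run x y n) := Function.iterate_succ_apply' _ _ _
    rw [this, Verifier.step, ih]
    exact ih

/-- `Accepts` allows any time of halting. Since outputs persist, an accepting time and the time
bound `T` can be compared at their maximum. -/
theorem Runs.accepts_iff {F : Frag Bool} {y : List Bool} {d' : Data} {T : ℕ} {b : Bool}
    (h : Runs E F (.initial y) T b d') : F.toVerifier.Accepts E.x y ↔ b = true := by
  constructor
  · rintro ⟨t, ht⟩
    have h1 := run_output_mono _ _ _ (le_max_left t T) ht
    rw [h.output_run (le_max_right t T)] at h1
    exact Option.some_inj.1 h1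
  · rintro rfl
    exact ⟨T, h.output_run le_rfl⟩

end Frag

end EPNL

namespace EPNL

/-! ### Comparing binary words -/

/-- Compare two words as binary numbers without superfluous zeros, least significant bit first;
`le` is the result for equal words. -/
def cmpBits : Bool → List Bool → List Bool → Bool
  | le, [], [] => le
  | _, [], _ :: _ => true
  | _, _ :: _, [] => false
  | le, p :: l, q :: m => cmpBits (if p = q then le else q) l m

/-- Scanning from the least significant digit, the last difference decides, so the accumulator `le`
always holds the verdict on the digits read so far. A longer word denotes a larger number because
there are no superfluous zeros. This is the side condition supplied by `Nat.binaryRec'`. -/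
theorem cmpBits_bits (le : Bool) (a b : ℕ) :
    cmpBits le a.bits b.bits = if a = b then le else decide (a < b) := by
  induction a using Nat.binaryRec' generalizing b le with
  | zero =>
    cases b using Nat.binaryRec' with
    | zero => simp [cmpBits]
    | bit q b hb =>
      have : Nat.bit q b ≠ 0 := by
        cases q <;> simp_all [Nat.bit]
      rw [Nat.bits_append_bit _ _ hb]
      simp [cmpBits, this.symm, Nat.pos_of_ne_zero this]
  | bit p a ha ih =>
    have h0 : Nat.bit p a ≠ 0 := by
      cases p <;> simp_all [Nat.bit]
    rw [Nat.bits_append_bit _ _ ha]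
    cases b using Nat.binaryRec' with
    | zero => simp [cmpBits, h0]
    | bit q b hb =>
      rw [Nat.bits_append_bit _ _ hb, cmpBits, ih]
      cases p <;> cases q <;> simp only [Nat.bit, cond_true, cond_false] <;>
        by_cases h : a = b <;> simp [h] <;> grind

/-- The successor on binary words, least significant bit first. -/
theorem bits_succ (n : ℕ) : ∃ m : ℕ, (∀ j < m, n.bits[j]? = some true) ∧ n.bits[m]? ≠ some true ∧
    ∀ j, (n + 1).bits[j]? =
      if j < m then some false else if j = m then some true else n.bits[j]? := by
  induction n using Nat.binaryRec' with
  | zero =>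
    refine ⟨0, by simp, by simp, fun j => ?_⟩
    cases j <;> simp
  | bit p n hp ih =>
    cases p with
    | false =>
      have hn : n ≠ 0 := fun h => by simpa using hp h
      have e : Nat.bit false n + 1 = Nat.bit true n := rfl
      refine ⟨0, by simp, ?_, fun j => ?_⟩
      · rw [Nat.bits_append_bit _ _ hp]; simp
      · rw [e, Nat.bits_append_bit _ _ hp, Nat.bits_append_bit _ _ (fun _ => rfl)]
        cases j <;> simp
    | true =>
      obtain ⟨m, h1, h2, h3⟩ := ih
      have e : Nat.bit true n + 1 = Nat.bit false (n + 1) := by simp [Nat.bit]; ring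
      refine ⟨m + 1, fun j hj => ?_, ?_, fun j => ?_⟩
      · rw [Nat.bits_append_bit _ _ hp]
        cases j with
        | zero => simp
        | succ j => simpa using h1 j (by omega)
      · rw [Nat.bits_append_bit _ _ hp]; simpa using h2
      · rw [e, Nat.bits_append_bit _ _ hp, Nat.bits_append_bit _ _ (by simp)]
        cases j with
        | zero => simp
        | succ j => simp [h3 j]

/-! ### The layout of the logspace tape -/

/-- Names of registers. -/
abbrev Reg := Fin 32

/-- The contents of a tape that is divided into blocks of 65 cells: a cell that marks block `0`,
then for each register `i` the cells with the bits `V i k` and `D i k` of block `k`. -/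
def cells (V D : Reg → ℕ → Bool) (p : ℕ) : Bool :=
  if p % 65 = 0 then decide (p = 0)
  else if p % 65 % 2 = 1 then V (Fin.ofNat 32 ((p % 65 - 1) / 2)) (p / 65)
  else D (Fin.ofNat 32 ((p % 65 - 1) / 2)) (p / 65)

theorem cells_marker (V D : Reg → ℕ → Bool) (k : ℕ) : cells V D (65 * k) = decide (k = 0) := by
  simp [cells]

theorem cells_left (V D : Reg → ℕ → Bool) (k : ℕ) (i : Reg) :
    cells V D (65 * k + (2 * i + 1)) = V i k := by
  have hi := i.isLt
  have h1 : (65 * k + (2 * (i : ℕ) + 1)) % 65 = 2 * i + 1 := by omega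
  have h2 : (65 * k + (2 * (i : ℕ) + 1)) / 65 = k := by omega
  rw [cells, h1, h2, if_neg (by omega), if_pos (by omega)]
  have h3 : (2 * (i : ℕ) + 1 - 1) / 2 = i := by omega
  rw [h3, Fin.ofNat_val_eq_self]

theorem cells_right (V D : Reg → ℕ → Bool) (k : ℕ) (i : Reg) :
    cells V D (65 * k + (2 * i + 2)) = D i k := by
  have hi := i.isLt
  have h1 : (65 * k + (2 * (i : ℕ) + 2)) % 65 = 2 * i + 2 := by omega
  have h2 : (65 * k + (2 * (i : ℕ) + 2)) / 65 = k := by omega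
  rw [cells, h1, h2, if_neg (by omega), if_neg (by omega)]
  have h3 : (2 * (i : ℕ) + 2 - 1) / 2 = i := by omega
  rw [h3, Fin.ofNat_val_eq_self]

/-- Tape contents are compared cell by cell with this case distinction: marker, mark of a digit,
digit. -/
theorem cell_cases (p : ℕ) : (∃ k, p = 65 * k) ∨ (∃ k, ∃ i : Reg, p = 65 * k + (2 * i + 1)) ∨
    ∃ k, ∃ i : Reg, p = 65 * k + (2 * i + 2) := by
  by_cases h0 : p % 65 = 0
  · exact .inl ⟨p / 65, by omega⟩
  by_cases h1 : p % 65 % 2 = 1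
  · exact .inr (.inl ⟨p / 65, ⟨(p % 65 - 1) / 2, by omega⟩, by dsimp only; omega⟩)
  · exact .inr (.inr ⟨p / 65, ⟨(p % 65 - 1) / 2, by omega⟩, by dsimp only; omega⟩)

/-- Change one bit of an array. -/
def setBit (V : Reg → ℕ → Bool) (i : Reg) (k : ℕ) (b : Bool) : Reg → ℕ → Bool :=
  fun i' k' => if i' = i ∧ k' = k then b else V i' k'

theorem update_cells_left (V D : Reg → ℕ → Bool) (k : ℕ) (i : Reg) (b : Bool) :
    Function.update (cells V D) (65 * k + (2 * i + 1)) b = cells (setBit V i k b) D := by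
  have hi := i.isLt
  funext p
  rcases cell_cases p with ⟨k', rfl⟩ | ⟨k', i', rfl⟩ | ⟨k', i', rfl⟩
  · rw [Function.update_of_ne (by omega), cells_marker, cells_marker]
  · have hi' := i'.isLt
    rw [cells_left, Function.update_apply, cells_left, setBit]
    refine if_congr ?_ rfl rfl
    rw [Fin.ext_iff]
    omega
  · have hi' := i'.isLt
    rw [Function.update_of_ne (by omega), cells_right, cells_right]

theorem update_cells_right (V D : Reg → ℕ → Bool) (k : ℕ) (i : Reg) (b : Bool) :
    Function.update (cells V D) (65 * k + (2 * i + 2)) b = cells V (setBit D i k b) := by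
  have hi := i.isLt
  funext p
  rcases cell_cases p with ⟨k', rfl⟩ | ⟨k', i', rfl⟩ | ⟨k', i', rfl⟩
  · rw [Function.update_of_ne (by omega), cells_marker, cells_marker]
  · have hi' := i'.isLt
    rw [Function.update_of_ne (by omega), cells_left, cells_left]
  · have hi' := i'.isLt
    rw [cells_right, Function.update_apply, cells_right, setBit]
    refine if_congr ?_ rfl rfl
    rw [Fin.ext_iff]
    omega

/-- The tape contents that represent given register values: `V` marks the blocks that hold a
digit, `D` holds the digits. -/
def regCells (reg : Reg → ℕ) : ℕ → Bool :=
  cells (fun i k => (reg i).bits[k]?.isSome) (fun i k => (reg i).bits[k]? == some true)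

/-! ### Basic motions on the logspace tape -/

/-- Replace the logspace tape. -/
def Data.withL (d : Data) (c : ℕ → Bool) (h : ℕ) : Data := { d with lTape := ⟨c, h⟩ }

/-- The data are safe, apart from the logspace tape. -/
structure Env.Fits (E : Env) (d : Data) : Prop where
  input : d.inputHead ≤ E.x.length
  kTape : d.kTape.Within E.kBound

theorem Env.Fits.safe {E : Env} {d : Data} (hd : E.Fits d) {c : ℕ → Bool} {h : ℕ}
    (hh : h < E.lBound) : E.Safe (d.withL c h) := ⟨hd.1, hd.2, hh⟩

namespace Frag

variable {α : Type} {E : Env} {d : Data} {c : ℕ → Bool} {h : ℕ}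

/-- A step on the logspace tape only. -/
def lAct (f : Bool → Bool × Move × α) : Frag α :=
  act fun _ k l _ => ⟨(f l).2.2, k, (f l).1, .stay, .stay, (f l).2.1, false⟩

theorem runs_lAct {f : Bool → Bool × Move × α} {w : Bool} {m : Move} {a : α}
    (hf : f (c h) = (w, m, a)) (hd : E.Fits d) (hm : m.apply h < E.lBound) :
    Runs E (lAct f) (d.withL c h) 1 a (d.withL (Function.update c h w) (m.apply h)) := by
  have e : (⟨a, d.kTape.read, w, .stay, .stay, m, false⟩ : Action α).perform E.x (d.withL c h) =
      d.withL (Function.update c h w) (m.apply h) := by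
    simp only [Action.perform, Data.withL, WorkTape.update_read_stay]
    simp [Move.apply, hd.input, WorkTape.update]
  have := runs_act (E := E) (d := d.withL c h)
    (f := fun _ k l _ => (⟨(f l).2.2, k, (f l).1, .stay, .stay, (f l).2.1, false⟩ : Action α))
    (a := ⟨a, d.kTape.read, w, .stay, .stay, m, false⟩)
    (by simp [Data.withL, WorkTape.read, hf]) (by rw [e]; exact hd.safe hm)
  rwa [e] at this

theorem runs_lAct_keep {f : Bool → Bool × Move × α} {m : Move} {a : α}
    (hf : f (c h) = (c h, m, a)) (hd : E.Fits d) (hm : m.apply h < E.lBound) :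
    Runs E (lAct f) (d.withL c h) 1 a (d.withL c (m.apply h)) := by
  have := runs_lAct hf hd hm
  rwa [Function.update_eq_self] at this

/-- Move right `n` times on the logspace tape. -/
def goR : ℕ → α → Frag α
  | 0, a => pure a
  | n + 1, a => (lAct fun l => (l, .right, ())).bind fun _ => goR n a

/-- Move left `n` times on the logspace tape. -/
def goL : ℕ → α → Frag α
  | 0, a => pure a
  | n + 1, a => (lAct fun l => (l, .left, ())).bind fun _ => goL n a

theorem runs_goR (n : ℕ) (a : α) (hd : E.Fits d) {h' : ℕ} (e : h' = h + n) (hb : h' < E.lBound) :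
    Runs E (goR n a) (d.withL c h) (n + 1) a (d.withL c h') := by
  subst e
  induction n generalizing h with
  | zero => exact runs_pure (hd.safe hb) a
  | succ n ih =>
    have h1 := runs_lAct_keep (f := fun l => (l, .right, ())) (c := c) (h := h) rfl hd
      (by simp only [Move.apply]; omega)
    have h2 := h1.bind (G := fun _ => goR n a) (ih (h := h + 1) (by omega))
    rw [show h + (n + 1) = h + 1 + n by omega]
    exact h2.mono (by omega)

theorem runs_goL (n : ℕ) (a : α) (hd : E.Fits d) {h' : ℕ} (e : h' = h + n) (hb : h' < E.lBound) :
    Runs E (goL n a) (d.withL c h') (n + 1) a (d.withL c h) := by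
  subst e
  induction n with
  | zero => exact runs_pure (hd.safe hb) a
  | succ n ih =>
    have h1 := runs_lAct_keep (f := fun l => (l, .left, ())) (c := c) (h := h + (n + 1)) rfl hd
      (by simp only [Move.apply]; omega)
    have h2 := h1.bind (G := fun _ => goL n a) (ih (by omega))
    exact h2.mono (by omega)

/-- From the beginning of a block, go back to cell `0`, running `back` for each block. -/
def home (back : Frag Unit) (a : α) : Frag α :=
  iter (fun _ : Unit => (lAct fun l => (l, .stay, l)).bind fun b =>
    if b then pure (.inr a) else (goL 65 ()).bind fun _ => back.bind fun _ => pure (.inl ())) ()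

/-- Only the marker of block `0` is a one, so the head recognizes its destination without a counter.
The data `d k` belong to the moment when the head is at block `k`. They vary with `k` since `back`
may move the input head in parallel. -/
theorem runs_home {V D : Reg → ℕ → Bool} {back : Frag Unit} (a : α) {T : ℕ} (d : ℕ → Data) (n : ℕ)
    (hd : ∀ k ≤ n, E.Fits (d k)) (hn : 65 * n < E.lBound)
    (hback : ∀ k < n, Runs E back ((d (k + 1)).withL (cells V D) (65 * k)) T ()
      ((d k).withL (cells V D) (65 * k))) :
    Runs E (home back a) ((d n).withL (cells V D) (65 * n)) ((n + 1) * (T + 70)) a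
      ((d 0).withL (cells V D) 0) := by
  induction n with
  | zero =>
    have h1 := runs_lAct_keep (f := fun l => (l, .stay, l)) (c := cells V D) (h := 65 * 0)
      (E := E) (d := d 0) (a := true) (m := .stay)
      (by rw [cells_marker]; rfl) (hd 0 le_rfl) hn
    have h2 := runs_pure (E := E) ((hd 0 le_rfl).safe (c := cells V D) hn) (Sum.inr a : Unit ⊕ α)
    exact (Runs.iter_exit (r := ()) (h1.bind h2)).mono (by omega)
  | succ n ih =>
    have h1 := runs_lAct_keep (f := fun l => (l, .stay, l)) (c := cells V D) (h := 65 * (n + 1))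
      (E := E) (d := d (n + 1)) (a := false) (m := .stay)
      (by simp [cells_marker]) (hd _ le_rfl) hn
    have h2 := runs_goL (c := cells V D) (h := 65 * n) 65 () (hd _ le_rfl) (h' := 65 * (n + 1))
      (by omega) hn
    have h3 := hback n (by omega)
    have h4 := runs_pure (E := E) ((hd n (by omega)).safe (c := cells V D) (h := 65 * n) (by omega))
      (Sum.inl () : Unit ⊕ α)
    have h5 := ih (fun k hk => hd k (by omega)) (by omega) (fun k hk => hback k (by omega))
    refine Runs.mono (Runs.iter_next (r' := ()) (h1.bind (h2.bind (h3.bind h4))) h5) ?_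
    ring_nf
    omega

/-! ### Registers -/

/-- Read the digit of register `i` in the current block. -/
def digit (i : Reg) : Frag (Option Bool) :=
  (goR (2 * i + 1) ()).bind fun _ => (lAct fun l => (l, .right, l)).bind fun v =>
    (lAct fun l => (l, .stay, if v then some l else none)).bind fun o => goL (2 * i + 2) o

theorem runs_digit (reg : Reg → ℕ) (i : Reg) (k : ℕ) (hd : E.Fits d)
    (hk : 65 * (k + 1) ≤ E.lBound) :
    Runs E (digit i) (d.withL (regCells reg) (65 * k)) 200 (reg i).bits[k]?
      (d.withL (regCells reg) (65 * k)) := by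
  have hi := i.isLt
  have h1 := runs_goR (c := regCells reg) (h := 65 * k) (2 * i + 1) () hd rfl
    (by omega)
  have h2 := runs_lAct_keep (f := fun l => (l, .right, l)) (c := regCells reg)
    (h := 65 * k + (2 * i + 1)) (a := (reg i).bits[k]?.isSome) (m := .right)
    (by rw [regCells, cells_left]) hd (by simp only [Move.apply]; omega)
  have h3 := runs_lAct_keep (f := fun l => (l, .stay,
      if (reg i).bits[k]?.isSome then some l else none)) (c := regCells reg)
    (h := 65 * k + (2 * i + 1) + 1) (a := (reg i).bits[k]?) (m := .stay)
    (by
      rw [regCells, Nat.add_assoc, cells_right]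
      cases (reg i).bits[k]? with
      | none => rfl
      | some b => cases b <;> rfl) hd (by simp only [Move.apply]; omega)
  have h4 := runs_goL (c := regCells reg) (h := 65 * k) (2 * i + 2) ((reg i).bits[k]?) hd
    (h' := 65 * k + (2 * i + 1) + 1) (by omega) (by omega)
  exact (h1.bind (h2.bind (h3.bind h4))).mono (by omega)

/-- Compare register `i` with the digits that `src` delivers block by block. -/
def sweep (src : Frag (Option Bool)) (adv : Frag Unit) (i : Reg) : Bool → Frag Bool :=
  iter fun le => (digit i).bind fun p => src.bind fun q =>
    match p, q with
    | none, none => pure (.inr le)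
    | none, some _ => pure (.inr true)
    | some _, none => pure (.inr false)
    | some p, some q => (goR 65 ()).bind fun _ => adv.bind fun _ =>
        pure (.inl (if p = q then le else q))

/-- Both digit sequences are read in lockstep, and the sweep ends in the block `n` where one of them
stops. That `n` does not exceed `M.length` matters for the way back: an input head that had been
stopped by the end of the input could not retrace its moves. -/
theorem runs_sweep {reg : Reg → ℕ} {src : Frag (Option Bool)} {adv : Frag Unit} {i : Reg}
    {d : ℕ → Data} {M : List Bool} {T : ℕ}
    (hb : 65 * ((reg i).bits.length + 1) ≤ E.lBound)
    (hd : ∀ k, E.Fits (d k))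
    (hsrc : ∀ k ≤ (reg i).bits.length, Runs E src ((d k).withL (regCells reg) (65 * k)) T M[k]?
      ((d k).withL (regCells reg) (65 * k)))
    (hadv : ∀ k < (reg i).bits.length, Runs E adv ((d k).withL (regCells reg) (65 * (k + 1)))
      T () ((d (k + 1)).withL (regCells reg) (65 * (k + 1)))) (le : Bool) (k : ℕ)
    (hk : k ≤ (reg i).bits.length) (hM : k ≤ M.length) :
    ∃ n ≤ (reg i).bits.length, n ≤ M.length ∧
      Runs E (sweep src adv i le) ((d k).withL (regCells reg) (65 * k))
        (((reg i).bits.length + 1 - k) * (2 * T + 300))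
        (cmpBits le ((reg i).bits.drop k) (M.drop k)) ((d n).withL (regCells reg) (65 * n)) := by
  -- Induction on the number of digits of register `i` that are still unread.
  generalize hm : (reg i).bits.length - k = m
  induction m generalizing k le with
  | zero =>
    have e : k = (reg i).bits.length := by omega
    refine ⟨k, hk, hM, ?_⟩
    have h1 := runs_digit reg i k (hd k) (by omega)
    have h2 := hsrc k hk
    have h3 := fun b : Bool => runs_pure (E := E)
      ((hd k).safe (c := regCells reg) (h := 65 * k) (by omega)) (Sum.inr b : Bool ⊕ Bool)
    rw [show (reg i).bits.length + 1 - k = 1 by omega]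
    have e1 : (reg i).bits[k]? = none := by simp [e]
    have e2 : (reg i).bits.drop k = [] := by simp [e]
    rw [e1] at h1
    rw [e2]
    cases hq : M[k]? with
    | none =>
      rw [hq] at h2
      have e3 : M.drop k = [] := by simpa using hq
      rw [e3]
      exact (Runs.iter_exit (h1.bind (h2.bind (h3 le)))).mono (by omega)
    | some q =>
      rw [hq] at h2
      have hkl : k < M.length := (List.getElem?_eq_some_iff.1 hq).1
      rw [List.drop_eq_getElem_cons hkl]
      exact (Runs.iter_exit (h1.bind (h2.bind (h3 true)))).mono (by omega)
  | succ m ih =>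
    have hkr : k < (reg i).bits.length := by omega
    have h1 := runs_digit reg i k (hd k) (by omega)
    have h2 := hsrc k hk
    rw [List.drop_eq_getElem_cons hkr]
    rw [List.getElem?_eq_getElem hkr] at h1
    cases hq : M[k]? with
    | none =>
      rw [hq] at h2
      refine ⟨k, hk, hM, ?_⟩
      have h3 := fun b : Bool => runs_pure (E := E)
        ((hd k).safe (c := regCells reg) (h := 65 * k) (by omega)) (Sum.inr b : Bool ⊕ Bool)
      have e3 : M.drop k = [] := by simpa using hq
      rw [e3]
      refine (Runs.iter_exit (h1.bind (h2.bind (h3 false)))).mono ?_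
      have : 2 * T + 300 ≤ ((reg i).bits.length + 1 - k) * (2 * T + 300) :=
        Nat.le_mul_of_pos_left _ (by omega)
      omega
    | some q =>
      rw [hq] at h2
      obtain ⟨hkl, rfl⟩ := List.getElem?_eq_some_iff.1 hq
      rw [List.drop_eq_getElem_cons hkl]
      obtain ⟨n, hn, hnM, hr⟩ := ih (if (reg i).bits[k] = M[k] then le else M[k]) (k + 1)
        (by omega) (by omega) (by omega)
      refine ⟨n, hn, hnM, ?_⟩
      have h3 := runs_goR (c := regCells reg) (h := 65 * k) 65 () (hd k) (h' := 65 * (k + 1))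
        (by omega) (by omega)
      have h4 := hadv k hkr
      have h5 := runs_pure (E := E) ((hd (k + 1)).safe (c := regCells reg) (h := 65 * (k + 1))
        (by omega)) (Sum.inl (if (reg i).bits[k] = M[k] then le else M[k]) : Bool ⊕ Bool)
      refine (Runs.iter_next (h1.bind (h2.bind (h3.bind (h4.bind h5)))) hr).mono ?_
      obtain ⟨z, hz⟩ : ∃ z, (reg i).bits.length + 1 - k = z + 1 := ⟨_, (by omega : _ = ((reg i).bits.length - k) + 1)⟩
      rw [show (reg i).bits.length + 1 - (k + 1) = z by omega, hz]
      ring_nf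
      omega

/-- Compare register `i` with the digits from `src` and return to cell `0`. -/
def compare (src : Frag (Option Bool)) (adv back : Frag Unit) (i : Reg) : Frag Bool :=
  (sweep src adv i true).bind fun b => home back b

theorem runs_compare {reg : Reg → ℕ} {src : Frag (Option Bool)} {adv back : Frag Unit} {i : Reg}
    {d : ℕ → Data} {M : List Bool} {T : ℕ}
    (hb : 65 * ((reg i).bits.length + 1) ≤ E.lBound)
    (hd : ∀ k, E.Fits (d k))
    (hsrc : ∀ k ≤ (reg i).bits.length, Runs E src ((d k).withL (regCells reg) (65 * k)) T M[k]?
      ((d k).withL (regCells reg) (65 * k)))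
    (hadv : ∀ k < (reg i).bits.length, Runs E adv ((d k).withL (regCells reg) (65 * (k + 1)))
      T () ((d (k + 1)).withL (regCells reg) (65 * (k + 1))))
    (hback : ∀ k < M.length, k < (reg i).bits.length →
      Runs E back ((d (k + 1)).withL (regCells reg) (65 * k)) T ()
        ((d k).withL (regCells reg) (65 * k))) :
    Runs E (compare src adv back i) ((d 0).withL (regCells reg) 0)
        (((reg i).bits.length + 1) * (3 * T + 370))
        (cmpBits true (reg i).bits M) ((d 0).withL (regCells reg) 0) := by
  obtain ⟨n, hn, hnM, hr⟩ := runs_sweep hb hd hsrc hadv true 0 (Nat.zero_le _) (Nat.zero_le _)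
  have h2 := runs_home (E := E) (cmpBits true (reg i).bits M) d n (fun k _ => hd k) (by omega)
    (fun k hk => hback k (by omega) (by omega))
  refine (hr.bind h2).mono ?_
  have : (n + 1) * (T + 70) ≤ ((reg i).bits.length + 1) * (T + 70) :=
    Nat.mul_le_mul_right _ (by omega)
  simp only [Nat.sub_zero]
  refine (Nat.add_le_add_left this _).trans (le_of_eq ?_)
  ring

/-- Test whether register `i` is at most register `j`. -/
def leReg (i j : Reg) : Frag Bool := compare (digit j) (pure ()) (pure ()) i

/-- Registers of this value fit on the logspace tape. -/
def _root_.EPNL.Env.Small (E : Env) (n : ℕ) : Prop := 65 * (n.bits.length + 1) ≤ E.lBound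

/-- The data with the given register values on the logspace tape. -/
def _root_.EPNL.Data.store (d : Data) (reg : Reg → ℕ) : Data := d.withL (regCells reg) 0

/-- The sweep ends no later than the digits of register `i`, so only this register has to fit on the
tape. A block costs `3 * 200 + 370 = 970` steps, which is less than `20 * 65`. -/
theorem runs_leReg (reg : Reg → ℕ) (i j : Reg) (hd : E.Fits d) (hi : E.Small (reg i)) :
    Runs E (leReg i j) (d.store reg) (20 * E.lBound) (decide (reg i ≤ reg j)) (d.store reg) := by
  have h := runs_compare (E := E) (reg := reg) (src := digit j) (adv := pure ()) (back := pure ())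
    (i := i) (d := fun _ => d) (M := (reg j).bits) (T := 200) hi (fun _ => hd)
    (fun k hk => runs_digit reg j k hd (by unfold Env.Small at hi; omega))
    (fun k hk => (runs_pure (hd.safe (by unfold Env.Small at hi; omega)) ()).mono (by omega))
    (fun k hk hk' => (runs_pure (hd.safe (by unfold Env.Small at hi; omega)) ()).mono (by omega))
  rw [cmpBits_bits] at h
  have e : (if reg i = reg j then true else decide (reg i < reg j)) = decide (reg i ≤ reg j) := by
    split_ifs with h
    · simp [h]
    · exact decide_eq_decide.2 ⟨le_of_lt, fun h' => lt_of_le_of_ne h' h⟩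
  rw [e] at h
  refine h.mono ?_
  unfold Env.Small at hi
  omega

/-- Increment register `i`. -/
def inc (i : Reg) : Frag Unit :=
  (goR (2 * i + 2) ()).bind fun _ =>
  (iter (fun _ : Unit => (lAct fun l => if l then (false, .stay, true) else (true, .left, false)).bind
    fun b => if b then goR 65 (.inl ()) else pure (.inr ())) ()).bind fun _ =>
  (lAct fun _ => (true, .stay, ())).bind fun _ =>
  (goL (2 * i + 1) ()).bind fun _ => home (pure ()) ()

/-- The carry turns ones into zeros until it meets a zero, which becomes a one. The arrays `V` and
`D` are arbitrary, since the contents during the carry need not be those of any register values. The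
final move to the left puts the head on the cell that marks block `k + m` as occupied. -/
theorem runs_carry {V : Reg → ℕ → Bool} (i : Reg) (hd : E.Fits d) (m : ℕ) (D : Reg → ℕ → Bool)
    (k : ℕ) (hb : 65 * (k + m + 1) ≤ E.lBound) (h1 : ∀ j < m, D i (k + j) = true)
    (h2 : D i (k + m) = false) :
    Runs E (iter (fun _ : Unit =>
      (lAct fun l => if l then (false, .stay, true) else (true, .left, false)).bind
        fun b => if b then goR 65 (.inl ()) else pure (.inr ())) ())
      (d.withL (cells V D) (65 * k + (2 * i + 2))) (70 * (m + 1)) ()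
      (d.withL (cells V fun i' j => if i' = i then
          (if k ≤ j ∧ j < k + m then false else if j = k + m then true else D i j) else D i' j)
        (65 * (k + m) + (2 * i + 1))) := by
  have hi := i.isLt
  induction m generalizing k D with
  | zero =>
    have s1 := runs_lAct (f := fun l => if l then (false, .stay, true) else (true, .left, false))
      (c := cells V D) (h := 65 * k + (2 * i + 2)) (E := E) (d := d) (w := true) (m := .left)
      (a := false) (by rw [cells_right]; rw [Nat.add_zero] at h2; rw [h2]; rfl) hd
      (by simp only [Move.apply]; omega)
    rw [update_cells_right] at s1
    have s2 := runs_pure (E := E) s1.safe (Sum.inr () : Unit ⊕ Unit)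
    have s3 := Runs.iter_exit (r := ()) (f := fun _ : Unit =>
      (lAct fun l => if l then (false, .stay, true) else (true, .left, false)).bind
        fun b => if b then goR 65 (.inl ()) else pure (.inr ())) (s1.bind s2)
    refine Runs.mono ?_ (show 1 + 1 ≤ _ by omega)
    convert s3 using 2
    · congr 1
      funext i' j
      simp only [setBit]
      by_cases hi' : i' = i <;> by_cases hj : j = k <;> simp [hi', hj]
      omega
    · simp only [Move.apply]
      omega
  | succ m ih =>
    have s1 := runs_lAct (f := fun l => if l then (false, .stay, true) else (true, .left, false))
      (c := cells V D) (h := 65 * k + (2 * i + 2)) (E := E) (d := d) (w := false) (m := .stay)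
      (a := true) (by rw [cells_right]; have := h1 0 (by omega); rw [Nat.add_zero] at this; rw [this]; rfl) hd
      (by simp only [Move.apply]; omega)
    rw [update_cells_right] at s1
    have s2 := runs_goR (E := E) (d := d) (c := cells V (setBit D i k false))
      (h := 65 * k + (2 * i + 2)) 65 (Sum.inl () : Unit ⊕ Unit) hd
      (h' := 65 * (k + 1) + (2 * i + 2)) (by omega) (by omega)
    have s3 := ih (setBit D i k false) (k + 1) (by omega)
      (fun j hj => by
        rw [setBit, if_neg (by omega)]
        have := h1 (j + 1) (by omega)
        rwa [show k + 1 + j = k + (j + 1) by omega])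
      (by rw [setBit, if_neg (by omega), ← h2]; congr 1; omega)
    have s4 := Runs.iter_next (r := ()) (r' := ()) (f := fun _ : Unit =>
      (lAct fun l => if l then (false, .stay, true) else (true, .left, false)).bind
        fun b => if b then goR 65 (.inl ()) else pure (.inr ())) (s1.bind s2) s3
    refine Runs.mono ?_ (show 1 + (65 + 1) + 70 * (m + 1) ≤ _ by omega)
    convert s4 using 2
    · congr 1
      funext i' j
      simp only [setBit]
      by_cases hi' : i' = i
      · simp only [hi', true_and, if_true]
        split_ifs <;> first | rfl | omega
      · simp [hi']
    · omega

theorem runs_inc (reg : Reg → ℕ) (i : Reg) (hd : E.Fits d) (hi : E.Small (reg i + 1)) :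
    Runs E (inc i) (d.store reg) (20 * E.lBound) ()
      (d.store (Function.update reg i (reg i + 1))) := by
  have hlt := i.isLt
  obtain ⟨m, h1, h2, h3⟩ := bits_succ (reg i)
  have hm : m < (reg i + 1).bits.length := by
    have := h3 m
    simp only [lt_irrefl, if_false, if_true] at this
    exact (List.getElem?_eq_some_iff.1 this).1
  unfold Env.Small at hi
  have s1 := runs_goR (E := E) (c := regCells reg) (h := 0) (2 * i + 2) () hd
    (h' := 65 * 0 + (2 * i + 2)) (by omega) (by omega)
  have s2 := runs_carry (E := E) (V := fun i k => (reg i).bits[k]?.isSome) i hd m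
    (fun i k => (reg i).bits[k]? == some true) 0 (by omega)
    (fun j hj => by rw [Nat.zero_add]; simp [h1 j hj]) (by rw [Nat.zero_add]; simpa using h2)
  simp only [Nat.zero_add, Nat.zero_le, true_and] at s2
  have s3 := runs_lAct (E := E) (d := d) (f := fun _ => (true, .stay, ()))
    (c := cells (fun i k => (reg i).bits[k]?.isSome) fun i' j => if i' = i then
          (if j < m then false else if j = m then true else (reg i).bits[j]? == some true)
          else (reg i').bits[j]? == some true)
    (h := 65 * m + (2 * i + 1)) rfl hd (by simp only [Move.apply]; omega)
  rw [update_cells_left] at s3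
  -- Only the mark of block `m` can change: the blocks below `m` held ones and were marked before,
  -- and the blocks above `m` are untouched.
  have e : cells (setBit (fun i k => (reg i).bits[k]?.isSome) i m true)
      (fun i' j => if i' = i then
          (if j < m then false else if j = m then true else (reg i).bits[j]? == some true)
          else (reg i').bits[j]? == some true) =
      regCells (Function.update reg i (reg i + 1)) := by
    rw [regCells]
    congr 1
    · funext i' j
      by_cases hi' : i' = i
      · subst hi'
        simp only [setBit, true_and, Function.update_self, h3]
        rcases lt_trichotomy j m with c | c | c
        · simp [c, c.ne, h1 j c]
        · simp [c]
        · simp [c.ne', c.not_gt]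
      · simp [setBit, hi']
    · funext i' j
      by_cases hi' : i' = i
      · subst hi'
        simp only [if_true, Function.update_self, h3]
        split_ifs <;> simp
      · simp [hi']
  rw [e] at s3
  have s4 := runs_goL (E := E) (d := d) (c := regCells (Function.update reg i (reg i + 1)))
    (h := 65 * m) (2 * i + 1) () hd (h' := 65 * m + (2 * i + 1)) rfl (by omega)
  have s5 := runs_home (E := E) (V := fun i' k => (Function.update reg i (reg i + 1) i').bits[k]?.isSome)
    (D := fun i' k => (Function.update reg i (reg i + 1) i').bits[k]? == some true)
    (back := pure ()) () (T := 1) (fun _ => d) m (fun _ _ => hd) (by omega)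
    (fun k hk => runs_pure (hd.safe (by omega)) ())
  refine (s1.bind (s2.bind (s3.bind (s4.bind s5)))).mono ?_
  omega

/-- Clear register `i`. -/
def clr (i : Reg) : Frag Unit :=
  (goR (2 * i + 1) ()).bind fun _ =>
  (iter (fun _ : Unit => (lAct fun l => if l then (false, .right, true) else (false, .stay, false)).bind
    fun b => if b then (lAct fun _ => (false, .stay, ())).bind fun _ => goR 64 (.inl ())
      else pure (.inr ())) ()).bind fun _ =>
  (goL (2 * i + 1) ()).bind fun _ => home (pure ()) ()

/-- As for the carry, the arrays are arbitrary because a half-erased register represents no number.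
The first unmarked block ends the loop. -/
theorem runs_erase (i : Reg) (hd : E.Fits d) (m : ℕ) (V D : Reg → ℕ → Bool)
    (k : ℕ) (hb : 65 * (k + m + 1) ≤ E.lBound) (h1 : ∀ j < m, V i (k + j) = true)
    (h2 : V i (k + m) = false) :
    Runs E (iter (fun _ : Unit => (lAct fun l => if l then (false, .right, true) else (false, .stay, false)).bind
        fun b => if b then (lAct fun _ => (false, .stay, ())).bind fun _ => goR 64 (.inl ())
          else pure (.inr ())) ())
      (d.withL (cells V D) (65 * k + (2 * i + 1))) (70 * (m + 1)) ()
      (d.withL (cells (fun i' j => if i' = i ∧ k ≤ j ∧ j < k + m then false else V i' j)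
          (fun i' j => if i' = i ∧ k ≤ j ∧ j < k + m then false else D i' j))
        (65 * (k + m) + (2 * i + 1))) := by
  have hi := i.isLt
  induction m generalizing k V D with
  | zero =>
    rw [Nat.add_zero] at h2
    have s1 := runs_lAct_keep (f := fun l => if l then (false, .right, true) else (false, .stay, false))
      (c := cells V D) (h := 65 * k + (2 * i + 1)) (E := E) (d := d) (m := .stay)
      (a := false) (by rw [cells_left, h2]; rfl) hd
      (by simp only [Move.apply]; omega)
    have s2 := runs_pure (E := E) s1.safe (Sum.inr () : Unit ⊕ Unit)
    have s3 := Runs.iter_exit (r := ()) (f := fun _ : Unit =>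
      (lAct fun l => if l then (false, .right, true) else (false, .stay, false)).bind
        fun b => if b then (lAct fun _ => (false, .stay, ())).bind fun _ => goR 64 (.inl ())
          else pure (.inr ())) (s1.bind s2)
    refine Runs.mono ?_ (show 1 + 1 ≤ _ by omega)
    convert s3 using 2
    · congr 1 <;> funext i' j <;> rw [if_neg (by omega)]
    · rfl
  | succ m ih =>
    have h10 := h1 0 (by omega)
    rw [Nat.add_zero] at h10
    have s1 := runs_lAct (f := fun l => if l then (false, .right, true) else (false, .stay, false))
      (c := cells V D) (h := 65 * k + (2 * i + 1)) (E := E) (d := d) (w := false) (m := .right)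
      (a := true) (by rw [cells_left, h10]; rfl) hd
      (by simp only [Move.apply]; omega)
    rw [update_cells_left] at s1
    have s1' := runs_lAct (f := fun _ => (false, .stay, ()))
      (c := cells (setBit V i k false) D) (h := 65 * k + (2 * i + 2)) (E := E) (d := d) rfl hd
      (by simp only [Move.apply]; omega)
    rw [update_cells_right] at s1'
    have s2 := runs_goR (E := E) (d := d) (c := cells (setBit V i k false) (setBit D i k false))
      (h := 65 * k + (2 * i + 2)) 64 (Sum.inl () : Unit ⊕ Unit) hd
      (h' := 65 * (k + 1) + (2 * i + 1)) (by omega) (by omega)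
    have s3 := ih (setBit V i k false) (setBit D i k false) (k + 1) (by omega)
      (fun j hj => by
        rw [setBit, if_neg (by omega)]
        have := h1 (j + 1) (by omega)
        rwa [show k + 1 + j = k + (j + 1) by omega])
      (by rw [setBit, if_neg (by omega), ← h2]; congr 1; omega)
    have s4 := Runs.iter_next (r := ()) (r' := ()) (f := fun _ : Unit =>
      (lAct fun l => if l then (false, .right, true) else (false, .stay, false)).bind
        fun b => if b then (lAct fun _ => (false, .stay, ())).bind fun _ => goR 64 (.inl ())
          else pure (.inr ())) (s1.bind (s1'.bind s2)) s3
    refine Runs.mono ?_ (show 1 + (1 + (64 + 1)) + 70 * (m + 1) ≤ _ by omega)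
    convert s4 using 2
    · congr 1 <;> funext i' j <;> simp only [setBit]
      all_goals
        by_cases hi' : i' = i
        · simp only [hi', true_and]
          split_ifs <;> first | rfl | omega
        · simp [hi']
    · omega

theorem runs_clr (reg : Reg → ℕ) (i : Reg) (hd : E.Fits d) (hi : E.Small (reg i)) :
    Runs E (clr i) (d.store reg) (20 * E.lBound) () (d.store (Function.update reg i 0)) := by
  have hlt := i.isLt
  unfold Env.Small at hi
  have s1 := runs_goR (E := E) (c := regCells reg) (h := 0) (2 * i + 1) () hd
    (h' := 65 * 0 + (2 * i + 1)) (by omega) (by omega)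
  have s2 := runs_erase (E := E) i hd (reg i).bits.length (fun i k => (reg i).bits[k]?.isSome)
    (fun i k => (reg i).bits[k]? == some true) 0 (by omega)
    (fun j hj => by rw [Nat.zero_add]; simp [hj]) (by rw [Nat.zero_add]; simp)
  simp only [Nat.zero_add, Nat.zero_le, true_and] at s2
  have e : cells (fun i' j => if i' = i ∧ j < (reg i).bits.length then false
        else (reg i').bits[j]?.isSome)
      (fun i' j => if i' = i ∧ j < (reg i).bits.length then false
        else (reg i').bits[j]? == some true) =
      regCells (Function.update reg i 0) := by
    rw [regCells]
    congr 1 <;> funext i' j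
    all_goals
      by_cases hi' : i' = i
      · subst hi'
        by_cases hj : j < (reg i').bits.length <;> simp [hj]
      · simp [hi']
  rw [e] at s2
  have s4 := runs_goL (E := E) (d := d) (c := regCells (Function.update reg i 0))
    (h := 65 * (reg i).bits.length) (2 * i + 1) () hd
    (h' := 65 * (reg i).bits.length + (2 * i + 1)) rfl (by omega)
  have s5 := runs_home (E := E) (V := fun i' k => (Function.update reg i 0 i').bits[k]?.isSome)
    (D := fun i' k => (Function.update reg i 0 i').bits[k]? == some true)
    (back := pure ()) () (T := 1) (fun _ => d) (reg i).bits.length (fun _ _ => hd) (by omega)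
    (fun k hk => runs_pure (hd.safe (by omega)) ())
  refine (s1.bind (s2.bind (s4.bind s5))).mono ?_
  omega

end Frag

end EPNL

/-! ### Access to the tapes at positions held in registers -/

namespace EPNL

theorem Env.Small.mono {E : Env} {m n : ℕ} (h : E.Small n) (hmn : m ≤ n) : E.Small m := by
  unfold Env.Small at *
  rw [Nat.size_eq_bits_len] at *
  have := Nat.size_le_size hmn
  omega

/-- Data with an empty logspace tape. -/
def Data.base (ip : ℕ) (cert : List Bool) (kt : WorkTape) : Data := ⟨ip, cert, kt, .blank⟩

/-- The register for the internal use of walks. -/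
abbrev aux : Reg := 31

/-- The register that holds the length of the input. -/
abbrev len : Reg := 30

/-- The register that holds zero. -/
abbrev zero : Reg := 29

namespace Frag

variable {α : Type} {E : Env} {ip : ℕ} {cert : List Bool} {kt : WorkTape} {c : ℕ → Bool} {h : ℕ}

/-- Move the input head. -/
def inMove (m : Move) : Frag Unit :=
  act fun _ k l _ => ⟨(), k, l, m, .stay, .stay, false⟩

/-- Move the head of the `k`-bit tape. -/
def kMove (m : Move) : Frag Unit :=
  act fun _ k l _ => ⟨(), k, l, .stay, m, .stay, false⟩

/-- The symbol under the input head. -/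
def readIn : Frag (Option Bool) :=
  act fun i k l _ => ⟨i, k, l, .stay, .stay, .stay, false⟩

/-- The bit under the head of the `k`-bit tape. -/
def kRead : Frag Bool :=
  act fun _ k l _ => ⟨k, k, l, .stay, .stay, .stay, false⟩

/-- Write a one on the `k`-bit tape. -/
def kWrite : Frag Unit :=
  act fun _ _ l _ => ⟨(), true, l, .stay, .stay, .stay, false⟩

/-- Read the next bit of the certificate. -/
def pop : Frag Bool :=
  act fun _ k l y => ⟨y == some true, k, l, .stay, .stay, .stay, true⟩

theorem runs_inMove (m : Move) (hd : E.Fits (.base ip cert kt)) (hh : h < E.lBound) :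
    Runs E (inMove m) ((Data.base ip cert kt).withL c h) 1 ()
      ((Data.base (min (m.apply ip) E.x.length) cert kt).withL c h) := by
  have e : (⟨(), kt.read, c h, m, .stay, .stay, false⟩ : Action Unit).perform E.x
      ((Data.base ip cert kt).withL c h) =
      (Data.base (min (m.apply ip) E.x.length) cert kt).withL c h := by
    simp [Action.perform, Data.withL, Data.base, WorkTape.read, WorkTape.update,
      Move.apply]
  have := runs_act (E := E) (d := (Data.base ip cert kt).withL c h)
    (f := fun _ k l _ => (⟨(), k, l, m, .stay, .stay, false⟩ : Action Unit)) rfl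
    (by
      refine Eq.mpr (congrArg E.Safe e) (Env.Fits.safe
        (d := Data.base (min (m.apply ip) E.x.length) cert kt) ⟨?_, hd.2⟩ hh)
      exact min_le_right _ _)
  exact Eq.mp (congrArg (Runs E (inMove m) _ 1 ()) e) this

theorem runs_kMove (m : Move) (hd : E.Fits (.base ip cert kt))
    (hk : (kt.update kt.read m).Within E.kBound) (hh : h < E.lBound) :
    Runs E (kMove m) ((Data.base ip cert kt).withL c h) 1 ()
      ((Data.base ip cert (kt.update kt.read m)).withL c h) := by
  have e : (⟨(), kt.read, c h, .stay, m, .stay, false⟩ : Action Unit).perform E.x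
      ((Data.base ip cert kt).withL c h) =
      (Data.base ip cert (kt.update kt.read m)).withL c h := by
    have := hd.1
    simp only [Data.base] at this
    simp [Action.perform, Data.withL, Data.base, WorkTape.update,
      Move.apply, this]
  have := runs_act (E := E) (d := (Data.base ip cert kt).withL c h)
    (f := fun _ k l _ => (⟨(), k, l, .stay, m, .stay, false⟩ : Action Unit)) rfl
    (by
      refine Eq.mpr (congrArg E.Safe e) (Env.Fits.safe
        (d := Data.base ip cert (kt.update kt.read m)) ⟨hd.1, hk⟩ hh))
  exact Eq.mp (congrArg (Runs E (kMove m) _ 1 ()) e) this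

theorem runs_idle {f : Option Bool → Bool → Bool → Option Bool → α} {d : Data} (hd : E.Safe d) :
    Runs E (act fun i k l y => ⟨f i k l y, k, l, .stay, .stay, .stay, false⟩) d 1
      (f E.x[d.inputHead]? d.kTape.read d.lTape.read d.cert.head?) d := by
  have e : Action.perform ⟨f E.x[d.inputHead]? d.kTape.read d.lTape.read d.cert.head?,
      d.kTape.read, d.lTape.read, .stay, .stay, .stay, false⟩ E.x d = d := by
    simp [Action.perform, WorkTape.update_read_stay, Move.apply, hd.input]
  have := runs_act (E := E) (d := d)
    (f := fun i k l y => (⟨f i k l y, k, l, .stay, .stay, .stay, false⟩ : Action α)) rfl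
    (by rw [e]; exact hd)
  rwa [e] at this

theorem runs_readIn (hd : E.Fits (.base ip cert kt)) (hh : h < E.lBound) :
    Runs E readIn ((Data.base ip cert kt).withL c h) 1 E.x[ip]?
      ((Data.base ip cert kt).withL c h) :=
  runs_idle (f := fun i _ _ _ => i) (hd.safe hh)

theorem runs_kRead (hd : E.Fits (.base ip cert kt)) (hh : h < E.lBound) :
    Runs E kRead ((Data.base ip cert kt).withL c h) 1 kt.read
      ((Data.base ip cert kt).withL c h) :=
  runs_idle (f := fun _ k _ _ => k) (hd.safe hh)

theorem runs_kWrite (hd : E.Fits (.base ip cert kt))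
    (hk : (kt.update true .stay).Within E.kBound) (hh : h < E.lBound) :
    Runs E kWrite ((Data.base ip cert kt).withL c h) 1 ()
      ((Data.base ip cert (kt.update true .stay)).withL c h) := by
  have e : (⟨(), true, c h, .stay, .stay, .stay, false⟩ : Action Unit).perform E.x
      ((Data.base ip cert kt).withL c h) =
      (Data.base ip cert (kt.update true .stay)).withL c h := by
    have := hd.1
    simp only [Data.base] at this
    simp [Action.perform, Data.withL, Data.base, WorkTape.update,
      Move.apply, this]
  have := runs_act (E := E) (d := (Data.base ip cert kt).withL c h)
    (f := fun _ _ l _ => (⟨(), true, l, .stay, .stay, .stay, false⟩ : Action Unit)) rfl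
    (by
      refine Eq.mpr (congrArg E.Safe e) (Env.Fits.safe
        (d := Data.base ip cert (kt.update true .stay)) ⟨hd.1, hk⟩ hh))
  exact Eq.mp (congrArg (Runs E kWrite _ 1 ()) e) this

theorem runs_pop (hd : E.Fits (.base ip cert kt)) (hh : h < E.lBound) :
    Runs E pop ((Data.base ip cert kt).withL c h) 1 (cert.head? == some true)
      ((Data.base ip cert.tail kt).withL c h) := by
  have e : (⟨cert.head? == some true, kt.read, c h, .stay, .stay, .stay, true⟩ :
      Action Bool).perform E.x ((Data.base ip cert kt).withL c h) =
      (Data.base ip cert.tail kt).withL c h := by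
    have := hd.1
    simp only [Data.base] at this
    simp [Action.perform, Data.withL, Data.base, WorkTape.read, WorkTape.update,
      Move.apply, this]
  have := runs_act (E := E) (d := (Data.base ip cert kt).withL c h)
    (f := fun _ k l y => (⟨y == some true, k, l, .stay, .stay, .stay, true⟩ : Action Bool)) rfl
    (by
      refine Eq.mpr (congrArg E.Safe e) (Env.Fits.safe
        (d := Data.base ip cert.tail kt) ⟨hd.1, hd.2⟩ hh))
  exact Eq.mp (congrArg (Runs E pop _ 1 _) e) this

/-- Repeat a motion as often as register `i` says. -/
def walk (mv : Frag Unit) (i : Reg) : Frag Unit :=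
  (iter (fun _ : Unit => (leReg i aux).bind fun b => if b then pure (.inr ()) else
    mv.bind fun _ => (inc aux).bind fun _ => pure (.inl ())) ()).bind fun _ => clr aux

/-- The register `aux` counts the moves and is cleared at the end, so the registers are unchanged as
a whole. The motion is required to work for every content `c` of the logspace tape, since this
content changes with the counter. -/
theorem runs_walk {mv : Frag Unit} {i : Reg} (D : ℕ → Data) {reg : Reg → ℕ}
    (hi : i ≠ aux) (haux : reg aux = 0) (hs : E.Small (reg i)) (hD : ∀ k ≤ reg i, E.Fits (D k))
    (hmv : ∀ k < reg i, ∀ c, Runs E mv ((D k).withL c 0) 1 () ((D (k + 1)).withL c 0)) :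
    Runs E (walk mv i) ((D 0).store reg) ((reg i + 2) * (45 * E.lBound)) ()
      ((D (reg i)).store reg) := by
  have hl : 65 ≤ E.lBound := by unfold Env.Small at hs; omega
  -- With `n` moves to go, `aux` holds the number `k` of moves made so far.
  have key : ∀ n, ∀ k, k + n = reg i →
      Runs E (iter (fun _ : Unit => (leReg i aux).bind fun b => if b then pure (.inr ()) else
        mv.bind fun _ => (inc aux).bind fun _ => pure (.inl ())) ())
        ((D k).store (Function.update reg aux k)) ((n + 1) * (45 * E.lBound)) ()
        ((D (reg i)).store (Function.update reg aux (reg i))) := by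
    intro n
    induction n with
    | zero =>
      rintro k hk
      obtain rfl : k = reg i := hk
      have h1 := runs_leReg (E := E) (Function.update reg aux (reg i)) i aux (hD _ le_rfl)
        (by simpa [hi] using hs)
      have e : decide (Function.update reg aux (reg i) i ≤
        Function.update reg aux (reg i) aux) = true := by simp [hi]
      rw [e] at h1
      have h2 := runs_pure (E := E) h1.safe (Sum.inr () : Unit ⊕ Unit)
      refine (Runs.iter_exit (r := ()) (h1.bind h2)).mono ?_
      omega
    | succ n ih =>
      intro k hk
      have h1 := runs_leReg (E := E) (Function.update reg aux k) i aux (hD k (by omega))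
        (by simpa [hi] using hs)
      have e : decide (Function.update reg aux k i ≤
        Function.update reg aux k aux) = false := by simp [hi]; omega
      rw [e] at h1
      have h2 := hmv k (by omega) (regCells (Function.update reg aux k))
      have h3 := runs_inc (E := E) (d := D (k + 1)) (Function.update reg aux k) aux
        (hD _ (by omega)) (by simpa using hs.mono (show k + 1 ≤ _ by omega))
      rw [Function.update_self, Function.update_idem] at h3
      have h4 := runs_pure (E := E) h3.safe (Sum.inl () : Unit ⊕ Unit)
      refine (Runs.iter_next (r := ()) (h1.bind (h2.bind (h3.bind h4)))
        (ih (k + 1) (by omega))).mono ?_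
      rw [show n + 1 + 1 = 1 + (n + 1) by omega, Nat.add_mul 1]
      omega
  have h1 := key (reg i) 0 (Nat.zero_add _)
  have h2 := runs_clr (E := E) (d := D (reg i)) (Function.update reg aux (reg i)) aux
    (hD _ le_rfl) (by simpa using hs)
  have e : Function.update reg aux 0 = reg := by rw [← haux, Function.update_eq_self]
  rw [Function.update_idem, e] at h2
  rw [e] at h1
  refine (h1.bind h2).mono ?_
  rw [show reg i + 2 = 1 + (reg i + 1) by omega, Nat.add_mul 1]
  omega

variable {reg : Reg → ℕ} {i j : Reg}

theorem runs_walk_right (hi : i ≠ aux) (haux : reg aux = 0) (hs : E.Small (reg i))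
    (hk : kt.Within E.kBound) :
    Runs E (walk (inMove .right) i) ((Data.base 0 cert kt).store reg)
      ((reg i + 2) * (45 * E.lBound)) ()
      ((Data.base (min (reg i) E.x.length) cert kt).store reg) := by
  have hl : 65 ≤ E.lBound := by unfold Env.Small at hs; omega
  have := runs_walk (E := E) (mv := inMove .right)
    (fun k => Data.base (min k E.x.length) cert kt) hi haux hs
    (fun k _ => ⟨min_le_right _ _, hk⟩) (fun k _ c => by
      have := runs_inMove (E := E) (ip := min k E.x.length) (cert := cert) (kt := kt) (c := c)
        (h := 0) .right ⟨min_le_right _ _, hk⟩ (by omega)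
      simp only [Move.apply] at this
      rwa [show min (min k E.x.length + 1) E.x.length = min (k + 1) E.x.length by omega] at this)
  simpa using this

/-- The start is the position that a walk to the right reaches, which may be cut off by the end of
the input. Superfluous moves to the left are harmless at cell `0`, which truncated subtraction
models. -/
theorem runs_walk_left (hi : i ≠ aux) (haux : reg aux = 0) (hs : E.Small (reg i))
    (hk : kt.Within E.kBound) :
    Runs E (walk (inMove .left) i) ((Data.base (min (reg i) E.x.length) cert kt).store reg)
      ((reg i + 2) * (45 * E.lBound)) ()
      ((Data.base 0 cert kt).store reg) := by
  have hl : 65 ≤ E.lBound := by unfold Env.Small at hs; omega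
  have hF : ∀ k, E.Fits (Data.base (min (reg i) E.x.length - k) cert kt) :=
    fun k => ⟨by simp only [Data.base]; omega, hk⟩
  have := runs_walk (E := E) (mv := inMove .left)
    (fun k => Data.base (min (reg i) E.x.length - k) cert kt) hi haux hs
    (fun k _ => hF k) (fun k _ c => by
      have := runs_inMove (E := E) (c := c) (h := 0) .left (hF k) (by omega)
      simp only [Move.apply] at this
      rwa [show min (min (reg i) E.x.length - k - 1) E.x.length =
        min (reg i) E.x.length - (k + 1) by omega] at this)
  simpa using this

/-- Test whether the input has a one at the position in register `i`. -/
def inpTest (i : Reg) : Frag Bool :=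
  (walk (inMove .right) i).bind fun _ => readIn.bind fun b =>
    (walk (inMove .left) i).bind fun _ => pure (b == some true)

theorem runs_inpTest (hi : i ≠ aux) (haux : reg aux = 0) (hs : E.Small (reg i))
    (hk : kt.Within E.kBound) :
    Runs E (inpTest i) ((Data.base 0 cert kt).store reg)
      ((reg i + 2) * (200 * E.lBound)) (E.x[reg i]? == some true)
      ((Data.base 0 cert kt).store reg) := by
  have hl : 65 ≤ E.lBound := by unfold Env.Small at hs; omega
  have h1 := runs_walk_right (cert := cert) hi haux hs hk
  have h2 := runs_readIn (E := E) (ip := min (reg i) E.x.length) (cert := cert) (kt := kt)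
    (c := regCells reg) (h := 0) ⟨min_le_right _ _, hk⟩ (by omega)
  -- A position behind the input reads `none`, as does the cell right behind the input where the
  -- head is stopped.
  have e : E.x[min (reg i) E.x.length]? = E.x[reg i]? := by
    rcases le_total (reg i) E.x.length with h | h
    · rw [min_eq_left h]
    · rw [min_eq_right h, List.getElem?_eq_none h, List.getElem?_eq_none le_rfl]
  rw [e] at h2
  have h3 := runs_walk_left (cert := cert) hi haux hs hk
  have h4 := runs_pure (E := E) h3.safe (E.x[reg i]? == some true)
  refine (h1.bind (h2.bind (h3.bind h4))).mono ?_
  nlinarith [Nat.zero_le (reg i * E.lBound)]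

theorem runs_kWalk_right (hi : i ≠ aux) (haux : reg aux = 0) (hs : E.Small (reg i))
    (hlt : reg i < E.kBound) {m : ℕ → Bool} :
    Runs E (walk (kMove .right) i) ((Data.base 0 cert ⟨m, 0⟩).store reg)
      ((reg i + 2) * (45 * E.lBound)) ()
      ((Data.base 0 cert ⟨m, reg i⟩).store reg) := by
  have hl : 65 ≤ E.lBound := by unfold Env.Small at hs; omega
  have hF : ∀ k ≤ reg i, E.Fits (Data.base 0 cert ⟨m, k⟩) :=
    fun k hk => ⟨Nat.zero_le _, Or.inl (lt_of_le_of_lt hk hlt)⟩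
  exact runs_walk (E := E) (mv := kMove .right)
    (fun k => Data.base 0 cert ⟨m, k⟩) hi haux hs hF (fun k hk c => by
      have e : WorkTape.update ⟨m, k⟩ (WorkTape.read ⟨m, k⟩) .right = ⟨m, k + 1⟩ := by
        simp [WorkTape.update, WorkTape.read, Move.apply]
      have := runs_kMove (E := E) (c := c) (h := 0) .right (hF k hk.le)
        (by rw [e]; exact Or.inl (show k + 1 < _ by omega)) (by omega)
      rwa [e] at this)

theorem runs_kWalk_left (hi : i ≠ aux) (haux : reg aux = 0) (hs : E.Small (reg i))
    (hlt : reg i < E.kBound) {m : ℕ → Bool} :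
    Runs E (walk (kMove .left) i) ((Data.base 0 cert ⟨m, reg i⟩).store reg)
      ((reg i + 2) * (45 * E.lBound)) ()
      ((Data.base 0 cert ⟨m, 0⟩).store reg) := by
  have hl : 65 ≤ E.lBound := by unfold Env.Small at hs; omega
  have hF : ∀ k, E.Fits (Data.base 0 cert ⟨m, reg i - k⟩) :=
    fun k => ⟨Nat.zero_le _, Or.inl (show reg i - k < _ by omega)⟩
  have := runs_walk (E := E) (mv := kMove .left)
    (fun k => Data.base 0 cert ⟨m, reg i - k⟩) hi haux hs (fun k _ => hF k) (fun k hk c => by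
      have e : WorkTape.update ⟨m, reg i - k⟩ (WorkTape.read ⟨m, reg i - k⟩) .left =
          ⟨m, reg i - (k + 1)⟩ := by
        simp [WorkTape.update, WorkTape.read, Move.apply, Nat.sub_sub]
      have := runs_kMove (E := E) (c := c) (h := 0) .left (hF k)
        (by rw [e]; exact (hF (k + 1)).2) (by omega)
      rwa [e] at this)
  simpa using this

/-- The bit of the `k`-bit tape at the position in register `i`. -/
def kTest (i : Reg) : Frag Bool :=
  (walk (kMove .right) i).bind fun _ => kRead.bind fun b =>
    (walk (kMove .left) i).bind fun _ => pure b

theorem runs_kTest (hi : i ≠ aux) (haux : reg aux = 0) (hs : E.Small (reg i))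
    (hlt : reg i < E.kBound) {m : ℕ → Bool} :
    Runs E (kTest i) ((Data.base 0 cert ⟨m, 0⟩).store reg)
      ((reg i + 2) * (200 * E.lBound)) (m (reg i))
      ((Data.base 0 cert ⟨m, 0⟩).store reg) := by
  have hl : 65 ≤ E.lBound := by unfold Env.Small at hs; omega
  have h1 := runs_kWalk_right (cert := cert) hi haux hs hlt (m := m)
  have h2 := runs_kRead (E := E) (ip := 0) (cert := cert) (kt := ⟨m, reg i⟩)
    (c := regCells reg) (h := 0) ⟨Nat.zero_le _, Or.inl hlt⟩ (by omega)
  have h3 := runs_kWalk_left (cert := cert) hi haux hs hlt (m := m)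
  have h4 := runs_pure (E := E) h3.safe (m (reg i))
  refine (h1.bind (h2.bind (h3.bind h4))).mono ?_
  nlinarith [Nat.zero_le (reg i * E.lBound)]

/-- Set the bit of the `k`-bit tape at the position in register `i`. -/
def kSet (i : Reg) : Frag Unit :=
  (walk (kMove .right) i).bind fun _ => kWrite.bind fun _ => walk (kMove .left) i

theorem runs_kSet (hi : i ≠ aux) (haux : reg aux = 0) (hs : E.Small (reg i))
    (hlt : reg i < E.kBound) {m : ℕ → Bool} :
    Runs E (kSet i) ((Data.base 0 cert ⟨m, 0⟩).store reg)
      ((reg i + 2) * (200 * E.lBound)) ()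
      ((Data.base 0 cert ⟨Function.update m (reg i) true, 0⟩).store reg) := by
  have hl : 65 ≤ E.lBound := by unfold Env.Small at hs; omega
  have h1 := runs_kWalk_right (cert := cert) hi haux hs hlt (m := m)
  have h2 := runs_kWrite (E := E) (ip := 0) (cert := cert) (kt := ⟨m, reg i⟩)
    (c := regCells reg) (h := 0) ⟨Nat.zero_le _, Or.inl hlt⟩ (Or.inl hlt) (by omega)
  have h3 := runs_kWalk_left (cert := cert) hi haux hs hlt (m := Function.update m (reg i) true)
  refine (h1.bind (h2.bind h3)).mono ?_
  nlinarith [Nat.zero_le (reg i * E.lBound)]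

/-- Compare register `i` with the binary number on the input that begins at the position in
register `j`. -/
def cmpTest (i j : Reg) : Frag Bool :=
  (walk (inMove .right) j).bind fun _ =>
    (compare readIn (inMove .right) (inMove .left) i).bind fun b =>
      (walk (inMove .left) j).bind fun _ => pure b

/-- While the logspace head is at block `k`, the input head is at position `reg j + k`, capped by
the length of the input. Hence the two digit sequences are aligned without a further counter. -/
theorem runs_cmpTest (hj : j ≠ aux) (haux : reg aux = 0) (hsi : E.Small (reg i))
    (hs : E.Small (reg j)) (hk : kt.Within E.kBound) :
    Runs E (cmpTest i j) ((Data.base 0 cert kt).store reg)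
      ((reg j + 2) * (200 * E.lBound)) (cmpBits true (reg i).bits (E.x.drop (reg j)))
      ((Data.base 0 cert kt).store reg) := by
  have hl : 65 * ((reg i).bits.length + 1) ≤ E.lBound := hsi
  have h1 := runs_walk_right (cert := cert) hj haux hs hk
  have hF : ∀ k, E.Fits (Data.base (min (reg j + k) E.x.length) cert kt) :=
    fun k => ⟨min_le_right _ _, hk⟩
  have h2 := runs_compare (E := E) (reg := reg) (src := readIn) (adv := inMove .right)
    (back := inMove .left) (i := i)
    (d := fun k => Data.base (min (reg j + k) E.x.length) cert kt) (M := E.x.drop (reg j)) (T := 1)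
    hl hF
    (fun k hk => by
      have := runs_readIn (c := regCells reg) (h := 65 * k) (hF k) (by omega)
      have e : E.x[min (reg j + k) E.x.length]? = (E.x.drop (reg j))[k]? := by
        rw [List.getElem?_drop]
        rcases le_total (reg j + k) E.x.length with h | h
        · rw [min_eq_left h]
        · rw [min_eq_right h, List.getElem?_eq_none h, List.getElem?_eq_none le_rfl]
      rwa [e] at this)
    (fun k hk => by
      have := runs_inMove (c := regCells reg) (h := 65 * (k + 1)) .right (hF k) (by omega)
      simp only [Move.apply] at this
      rwa [show min (min (reg j + k) E.x.length + 1) E.x.length =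
        min (reg j + (k + 1)) E.x.length by omega] at this)
    -- Because of `k < M.length` the position `reg j + (k + 1)` is not capped, so one move to the
    -- left reaches `reg j + k`.
    (fun k hM hk => by
      have := runs_inMove (c := regCells reg) (h := 65 * k) .left (hF (k + 1)) (by omega)
      simp only [Move.apply] at this
      rw [List.length_drop] at hM
      rwa [show min (min (reg j + (k + 1)) E.x.length - 1) E.x.length =
        min (reg j + k) E.x.length by omega] at this)
  have h3 := runs_walk_left (cert := cert) hj haux hs hk
  have h4 := runs_pure (E := E) h3.safe (cmpBits true (reg i).bits (E.x.drop (reg j)))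
  refine (h1.bind (h2.bind (h3.bind h4))).mono ?_
  nlinarith [Nat.zero_le (reg j * E.lBound)]

/-- The registers at the beginning. -/
def initReg (n : ℕ) : Reg → ℕ := Function.update (fun _ => 0) len n

/-- Set up the logspace tape and store the length of the input. -/
def prelude : Frag Unit :=
  (lAct fun _ => (true, .stay, ())).bind fun _ =>
  (iter (fun _ : Unit => readIn.bind fun o => match o with
    | none => pure (.inr ())
    | some _ => (inMove .right).bind fun _ => (inc len).bind fun _ => pure (.inl ())) ()).bind
  fun _ => walk (inMove .left) len

/-- During the count the position of the input head and the value of `len` agree, and `len` then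
measures the walk back to position `0`. -/
theorem runs_prelude (hs : E.Small E.x.length) :
    Runs E prelude (.initial cert) ((E.x.length + 3) * (100 * E.lBound)) ()
      ((Data.base 0 cert .blank).store (initReg E.x.length)) := by
  have hl : 65 ≤ E.lBound := by unfold Env.Small at hs; omega
  have hF : ∀ k ≤ E.x.length, E.Fits (Data.base k cert .blank) := fun k hk => ⟨hk, Or.inr rfl⟩
  have h1 := runs_lAct (E := E) (d := Data.base 0 cert .blank) (f := fun _ => (true, .stay, ()))
    (c := fun _ => false) (h := 0) rfl (hF 0 (Nat.zero_le _)) (by simp only [Move.apply]; omega)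
  -- A blank tape already represents zero in all registers, except that block `0` lacks its marker.
  have e : Function.update (fun _ => false) 0 true = regCells (initReg 0) := by
    funext p
    rw [regCells]
    have e0 : ∀ i, initReg 0 i = 0 := fun i => by
      simp [initReg]
    rcases cell_cases p with ⟨k', rfl⟩ | ⟨k', i', rfl⟩ | ⟨k', i', rfl⟩
    · rw [cells_marker, Function.update_apply]
      by_cases hk : k' = 0 <;> simp [hk]
    · rw [Function.update_of_ne (by omega), cells_left, e0]
      simp
    · rw [Function.update_of_ne (by omega), cells_right, e0]
      simp
  rw [e] at h1
  have key : ∀ n, ∀ k, k + n = E.x.length →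
      Runs E (iter (fun _ : Unit => readIn.bind fun o => match o with
        | none => pure (.inr ())
        | some _ => (inMove .right).bind fun _ => (inc len).bind fun _ => pure (.inl ())) ())
        ((Data.base k cert .blank).store (initReg k)) ((n + 1) * (45 * E.lBound)) ()
        ((Data.base E.x.length cert .blank).store (initReg E.x.length)) := by
    intro n
    induction n with
    | zero =>
      rintro k hk
      obtain rfl : k = E.x.length := hk
      have h1 := runs_readIn (E := E) (c := regCells (initReg E.x.length)) (h := 0)
        (hF _ le_rfl) (by omega)
      rw [List.getElem?_eq_none le_rfl] at h1
      have h2 := runs_pure (E := E) h1.safe (Sum.inr () : Unit ⊕ Unit)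
      refine (Runs.iter_exit (r := ()) (h1.bind h2)).mono ?_
      omega
    | succ n ih =>
      intro k hk
      have h1 := runs_readIn (E := E) (c := regCells (initReg k)) (h := 0)
        (hF k (by omega)) (by omega)
      rw [List.getElem?_eq_getElem (by omega)] at h1
      have h2 := runs_inMove (c := regCells (initReg k)) (h := 0) .right (hF k (by omega)) (by omega)
      simp only [Move.apply] at h2
      rw [show min (k + 1) E.x.length = k + 1 by omega] at h2
      have h3 := runs_inc (E := E) (initReg k) len (hF (k + 1) (by omega))
        (hs.mono (by simp only [initReg, Function.update_self]; omega))
      simp only [initReg, Function.update_self, Function.update_idem] at h3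
      have h4 := runs_pure (E := E) h3.safe (Sum.inl () : Unit ⊕ Unit)
      refine (Runs.iter_next (r := ()) (h1.bind (h2.bind (h3.bind h4)))
        (ih (k + 1) (by omega))).mono ?_
      rw [show n + 1 + 1 = 1 + (n + 1) by omega, Nat.add_mul 1]
      omega
  have h2 := key E.x.length 0 (Nat.zero_add _)
  have e' : initReg E.x.length len = E.x.length := Function.update_self _ _ _
  have h3 := runs_walk_left (E := E) (i := len) (reg := initReg E.x.length) (cert := cert)
    (kt := .blank) (by decide) (Function.update_of_ne (by decide) _ _)
    (by rw [e']; exact hs) (Or.inr rfl)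
  rw [e', min_self] at h3
  refine Runs.mono (h1.bind (h2.bind h3)) ?_
  nlinarith [Nat.zero_le (E.x.length * E.lBound)]

end Frag

end EPNL

namespace EPNL

open Polynomial

/-! ### A programming language for verifiers -/

/-- Tests of the programming language. -/
inductive Test where
  | le (i j : Reg)
  | inp (i : Reg)
  | mem (i : Reg)
  | cmp (i j : Reg)

/-- Programs. The loop `loop a b p` runs `p` for all values of register `a` below the value of
register `b` (and at most as often as the input is long). -/
inductive Cmd where
  | nop
  | inc (i : Reg)
  | clr (i : Reg)
  | set (i : Reg)
  | cert (i : Reg)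
  | seq (p q : Cmd)
  | ite (t : Test) (p q : Cmd)
  | loop (a b : Reg) (p : Cmd)

/-- The store of a program. -/
@[ext]
structure Store where
  reg : Reg → ℕ
  mem : ℕ → Bool
  cert : List Bool

/-- Assign a value to a register. -/
def Store.assign (s : Store) (i : Reg) (v : ℕ) : Store :=
  { s with reg := Function.update s.reg i v }

@[simp] theorem Store.assign_mem (s : Store) (i : Reg) (v : ℕ) : (s.assign i v).mem = s.mem := rfl

@[simp] theorem Store.assign_cert (s : Store) (i : Reg) (v : ℕ) :
    (s.assign i v).cert = s.cert := rfl

@[simp] theorem Store.assign_reg_self (s : Store) (i : Reg) (v : ℕ) :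
    (s.assign i v).reg i = v := Function.update_self ..

theorem Store.assign_reg_of_ne (s : Store) {i j : Reg} (v : ℕ) (h : j ≠ i) :
    (s.assign i v).reg j = s.reg j := Function.update_of_ne h ..

/-- The value of a test. -/
def Test.eval (x : List Bool) (s : Store) : Test → Bool
  | le i j => decide (s.reg i ≤ s.reg j)
  | inp i => x[s.reg i]? == some true
  | mem i => s.mem (s.reg i)
  | cmp i j => cmpBits true (s.reg i).bits (x.drop (s.reg j))

/-- The effect of a program. -/
def Cmd.denote (x : List Bool) : Cmd → Store → Store
  | nop, s => s
  | inc i, s => s.assign i (s.reg i + 1)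
  | clr i, s => s.assign i 0
  | set i, s => { s with mem := Function.update s.mem (s.reg i) true }
  | cert i, s => { s.assign i (s.cert.head? == some true).toNat with cert := s.cert.tail }
  | seq p q, s => q.denote x (p.denote x s)
  | ite t p q, s => if t.eval x s then p.denote x s else q.denote x s
  | loop a b p, s =>
    (fun s => (p.denote x s).assign a ((p.denote x s).reg a + 1))^[min (s.reg b) x.length]
      (s.assign a 0)

/-- The registers that a program may change. -/
def Cmd.writes : Cmd → List Reg
  | nop => []
  | inc i => [i]
  | clr i => [i]
  | set _ => []
  | cert i => [i]
  | seq p q => p.writes ++ q.writes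
  | ite _ p q => p.writes ++ q.writes
  | loop a _ p => a :: p.writes

/-- The frame rule. For concrete programs its hypothesis is settled by `decide`. -/
theorem Cmd.denote_reg (x : List Bool) (p : Cmd) (s : Store) {i : Reg} (h : i ∉ p.writes) :
    (p.denote x s).reg i = s.reg i := by
  induction p generalizing s with
  | nop => rfl
  | inc j => exact Function.update_of_ne (by simpa [writes] using h) _ _
  | clr j => exact Function.update_of_ne (by simpa [writes] using h) _ _
  | set j => rfl
  | cert j => exact Function.update_of_ne (by simpa [writes] using h) _ _
  | seq p q ihp ihq =>
    simp only [writes, List.mem_append, not_or] at h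
    simp only [denote]
    rw [ihq _ h.2, ihp _ h.1]
  | ite t p q ihp ihq =>
    simp only [writes, List.mem_append, not_or] at h
    simp only [denote]
    split_ifs
    · exact ihp _ h.1
    · exact ihq _ h.2
  | loop a b p ih =>
    simp only [writes, List.mem_cons, not_or] at h
    simp only [denote]
    rw [← Function.update_of_ne h.1 0 s.reg]
    change _ = (s.assign a 0).reg i
    generalize s.assign a 0 = s'
    induction min (s.reg b) x.length generalizing s' with
    | zero => rfl
    | succ n ihn =>
      rw [Function.iterate_succ_apply, ihn, Store.assign_reg_of_ne _ _ h.1, ih _ h.2]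

/-- A polynomial in the length of the input that bounds the number of elementary operations of a
program. -/
noncomputable def Cmd.cost : Cmd → ℕ[X]
  | nop => 1
  | inc _ => 1
  | clr _ => 1
  | set _ => 1
  | cert _ => 3
  | seq p q => p.cost + q.cost
  | ite _ p q => 1 + p.cost + q.cost
  | loop _ _ p => 3 + (p.cost + 4) * X

/-- An elementary operation raises the largest register value by at most its cost, so the polynomial
that bounds the time also bounds the values, and thereby the space. A loop runs at most `|x|` times,
whatever its bounding register holds. This keeps the bound polynomial without any analysis of
values. -/
theorem Cmd.denote_reg_le (x : List Bool) (p : Cmd) (s : Store) {M : ℕ} (h : ∀ i, s.reg i ≤ M)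
    (i : Reg) : (p.denote x s).reg i ≤ M + p.cost.eval x.length := by
  -- A common bound for all registers survives an assignment of a bounded value.
  have hup : ∀ (r : Reg → ℕ) (j : Reg) (v m : ℕ), (∀ i, r i ≤ m) → v ≤ m →
      ∀ i, Function.update r j v i ≤ m := by
    intro r j v m hr hv i
    rw [Function.update_apply]
    split_ifs
    · exact hv
    · exact hr i
  induction p generalizing s M i with
  | nop => exact (h i).trans (Nat.le_add_right _ _)
  | inc j =>
    exact hup _ _ _ _ (fun i => (h i).trans (Nat.le_add_right _ _))
      (by have := h j; simp [cost]; omega) i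
  | clr j =>
    exact hup _ _ _ _ (fun i => (h i).trans (Nat.le_add_right _ _)) (Nat.zero_le _) i
  | set j => exact (h i).trans (Nat.le_add_right _ _)
  | cert j =>
    refine hup _ _ _ _ (fun i => (h i).trans (Nat.le_add_right _ _)) ?_ i
    have := Bool.toNat_le (s.cert.head? == some true)
    have e : eval x.length (cert j).cost = 3 := by simp [cost]
    omega
  | seq p q ihp ihq =>
    have := ihq _ (ihp _ h) i
    simp only [cost, eval_add]
    simp only [denote]
    omega
  | ite t p q ihp ihq =>
    have h1 := ihp _ h i
    have h2 := ihq _ h i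
    simp only [cost, eval_add]
    simp only [denote]
    split_ifs <;> omega
  | loop a b p ih =>
    simp only [denote]
    have h0 : ∀ i, (s.assign a 0).reg i ≤ M := hup _ _ _ _ h (Nat.zero_le _)
    have hn : min (s.reg b) x.length ≤ x.length := min_le_right _ _
    revert h0 hn
    generalize s.assign a 0 = s'
    generalize min (s.reg b) x.length = n
    intro h0 hn
    -- Each round adds the cost of the body, and one more for the increment of the loop register.
    have key : ∀ (n : ℕ) (s' : Store) (M : ℕ), (∀ i, s'.reg i ≤ M) →
        ∀ i, ((fun s => (p.denote x s).assign a ((p.denote x s).reg a + 1))^[n] s').reg i ≤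
          M + n * (p.cost.eval x.length + 1) := by
      intro n
      induction n with
      | zero => intro s' M h i; simpa using h i
      | succ n ihn =>
        intro s' M h i
        rw [Function.iterate_succ_apply]
        refine (ihn _ (M + p.cost.eval x.length + 1) ?_ i).trans (le_of_eq (by ring))
        exact hup _ _ _ _ (fun i => (ih _ h i).trans (Nat.le_succ _))
          (Nat.succ_le_succ (ih _ h a))
    refine (key n s' M h0 i).trans ?_
    simp only [cost, eval_add, eval_mul, eval_X, eval_ofNat]
    nlinarith [Nat.mul_le_mul_right (p.cost.eval x.length + 1) hn]

/-! ### Compilation -/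

/-- A test accesses the `k`-bit tape only at positions in the registers of the list `K`. -/
def Test.ok (K : List Reg) : Test → Bool
  | le _ _ => true
  | inp i => decide (i ≠ aux)
  | mem i => decide (i ∈ K)
  | cmp _ j => decide (j ≠ aux)

/-- A program changes neither the registers of the list `P` nor, inside a loop, the registers that
control the loop, and it accesses the `k`-bit tape only at positions in the registers of the
list `K` or in loop registers bounded by register `kb`. -/
def Cmd.ok (kb : Reg) : List Reg → List Reg → Cmd → Bool
  | _, _, nop => true
  | P, _, inc i => decide (i ∉ P)
  | P, _, clr i => decide (i ∉ P)
  | _, K, set i => decide (i ∈ K)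
  | P, _, cert i => decide (i ∉ P)
  | P, K, seq p q => p.ok kb P K && q.ok kb P K
  | P, K, ite t p q => t.ok K && p.ok kb P K && q.ok kb P K
  | P, K, loop a b p => decide (a ∉ P) && decide (a ≠ b) &&
      p.ok kb (a :: b :: P) (if b = kb then a :: K else K)

/-- Soundness of the first part of the check `ok`: protected registers are never written. In a loop
the protected list only grows. -/
theorem Cmd.notMem_writes {kb : Reg} {p : Cmd} {P K : List Reg} (h : p.ok kb P K) {i : Reg}
    (hi : i ∈ P) : i ∉ p.writes := by
  induction p generalizing P K with
  | nop => simp [writes]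
  | set j => simp [writes]
  | inc j => rintro h'; simp_all [writes, ok]
  | clr j => rintro h'; simp_all [writes, ok]
  | cert j => rintro h'; simp_all [writes, ok]
  | seq p q ihp ihq =>
    simp only [ok, Bool.and_eq_true] at h
    simp [writes, ihp h.1 hi, ihq h.2 hi]
  | ite t p q ihp ihq =>
    simp only [ok, Bool.and_eq_true] at h
    simp [writes, ihp h.1.2 hi, ihq h.2 hi]
  | loop a b p ih =>
    simp only [ok, Bool.and_eq_true, decide_eq_true_eq] at h
    simp only [writes, List.mem_cons, not_or]
    exact ⟨fun e => h.1.1 (e ▸ hi), ih h.2 (by simp [hi])⟩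

/-- The fragment for a test. -/
def Test.compile : Test → Frag Bool
  | le i j => Frag.leReg i j
  | inp i => Frag.inpTest i
  | mem i => Frag.kTest i
  | cmp i j => Frag.cmpTest i j

/-- The fragment for a program. -/
def Cmd.compile : Cmd → Frag Unit
  | nop => Frag.pure ()
  | inc i => Frag.inc i
  | clr i => Frag.clr i
  | set i => Frag.kSet i
  | cert i => (Frag.clr i).bind fun _ => Frag.pop.bind fun b => if b then Frag.inc i else Frag.pure ()
  | seq p q => p.compile.bind fun _ => q.compile
  | ite t p q => t.compile.bind fun b => if b then p.compile else q.compile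
  | loop a b p => (Frag.clr a).bind fun _ => Frag.iter (fun _ : Unit =>
      (Frag.leReg b a).bind fun t => if t then Frag.pure (.inr ()) else
      (Frag.leReg len a).bind fun t => if t then Frag.pure (.inr ()) else
      p.compile.bind fun _ => (Frag.inc a).bind fun _ => Frag.pure (.inl ())) ()

/-- The data that represent a store. -/
def Store.toData (s : Store) : Data := (Data.base 0 s.cert ⟨s.mem, 0⟩).store s.reg

/-- The conditions under which compiled programs work correctly. -/
structure Store.Valid (E : Env) (kb : Reg) (P K : List Reg) (s : Store) : Prop where
  aux_mem : aux ∈ P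
  len_mem : len ∈ P
  kb_mem : kb ∈ P
  aux_eq : s.reg aux = 0
  len_eq : s.reg len = E.x.length
  kb_le : s.reg kb ≤ E.kBound
  mem_of_mem : ∀ i ∈ K, i ∈ P
  ne_aux : ∀ i ∈ K, i ≠ aux
  lt_of_mem : ∀ i ∈ K, s.reg i < E.kBound
  within : (WorkTape.mk s.mem 0).Within E.kBound

namespace Store.Valid

variable {E : Env} {kb : Reg} {P K : List Reg} {s s' : Store}

theorem fits (h : s.Valid E kb P K) : E.Fits (Data.base 0 s.cert ⟨s.mem, 0⟩) :=
  ⟨Nat.zero_le _, h.within⟩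

theorem congr (h : s.Valid E kb P K) (hr : ∀ i ∈ P, s'.reg i = s.reg i)
    (hw : (WorkTape.mk s'.mem 0).Within E.kBound) : s'.Valid E kb P K where
  aux_mem := h.aux_mem
  len_mem := h.len_mem
  kb_mem := h.kb_mem
  aux_eq := by rw [hr _ h.aux_mem, h.aux_eq]
  len_eq := by rw [hr _ h.len_mem, h.len_eq]
  kb_le := by rw [hr _ h.kb_mem]; exact h.kb_le
  mem_of_mem := h.mem_of_mem
  ne_aux := h.ne_aux
  lt_of_mem i hi := by rw [hr _ (h.mem_of_mem i hi)]; exact h.lt_of_mem i hi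
  within := hw

theorem assign (h : s.Valid E kb P K) {i : Reg} (hi : i ∉ P) (v : ℕ) :
    (s.assign i v).Valid E kb P K :=
  h.congr (fun _ hj => Store.assign_reg_of_ne _ _ (fun e => hi (e ▸ hj))) h.within

/-- This is where the space bound for the `k`-bit tape comes from: inside a loop bounded by `kb` the
loop register is smaller than `kb`, hence smaller than `kBound`, and so it is a permitted position.
-/
theorem loop_body (h : s.Valid E kb P K) {a b : Reg} (ha : a ∉ P) (hab : s.reg a < s.reg b) :
    s.Valid E kb (a :: b :: P) (if b = kb then a :: K else K) where
  aux_mem := by simp [h.aux_mem]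
  len_mem := by simp [h.len_mem]
  kb_mem := by simp [h.kb_mem]
  aux_eq := h.aux_eq
  len_eq := h.len_eq
  kb_le := h.kb_le
  mem_of_mem i hi := by
    split_ifs at hi
    · rcases List.mem_cons.1 hi with rfl | hi
      · simp
      · simp [h.mem_of_mem i hi]
    · simp [h.mem_of_mem i hi]
  ne_aux i hi := by
    split_ifs at hi
    · rcases List.mem_cons.1 hi with rfl | hi
      · exact fun e => ha (e ▸ h.aux_mem)
      · exact h.ne_aux i hi
    · exact h.ne_aux i hi
  lt_of_mem i hi := by
    split_ifs at hi with hb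
    · rcases List.mem_cons.1 hi with rfl | hi
      · exact hab.trans_le (hb ▸ h.kb_le)
      · exact h.lt_of_mem i hi
    · exact h.lt_of_mem i hi
  within := h.within

end Store.Valid

theorem Test.runs_compile {E : Env} {kb : Reg} {P K : List Reg} {s : Store} {t : Test} {V : ℕ}
    (ht : t.ok K) (h : s.Valid E kb P K) (hV : ∀ i, s.reg i ≤ V) (hs : E.Small V) :
    Frag.Runs E t.compile s.toData ((V + 2) * (200 * E.lBound)) (t.eval E.x s) s.toData := by
  have hle : ∀ i, (s.reg i + 2) * (200 * E.lBound) ≤ (V + 2) * (200 * E.lBound) := fun i =>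
    Nat.mul_le_mul_right _ (Nat.add_le_add_right (hV i) 2)
  cases t with
  | le i j =>
    refine (Frag.runs_leReg s.reg i j h.fits (hs.mono (hV i))).mono ?_
    nlinarith [Nat.zero_le (V * E.lBound)]
  | inp i =>
    exact (Frag.runs_inpTest (by simpa [ok] using ht) h.aux_eq (hs.mono (hV i)) h.within).mono
      (hle i)
  | mem i =>
    have hi : i ∈ K := by simpa [ok] using ht
    exact (Frag.runs_kTest (h.ne_aux i hi) h.aux_eq (hs.mono (hV i)) (h.lt_of_mem i hi)).mono
      (hle i)
  | cmp i j =>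
    exact (Frag.runs_cmpTest (by simpa [ok] using ht) h.aux_eq (hs.mono (hV i)) (hs.mono (hV j))
      h.within).mono (hle j)

/-- The quantity `(V + 2) * (200 * E.lBound)`, called `C` in the proof, bounds every elementary
operation, walks included, as long as all registers are at most `V`. The cost then counts such
operations. The bound `M` on the registers grows during the induction, but `M` plus the remaining
cost stays at most `V`. -/
theorem Cmd.runs_compile {E : Env} {kb : Reg} {V : ℕ} (hs : E.Small V) {P K : List Reg}
    {s : Store} {p : Cmd} {M : ℕ} (hp : p.ok kb P K) (h : s.Valid E kb P K)
    (hM : ∀ i, s.reg i ≤ M) (hMV : M + p.cost.eval E.x.length ≤ V) :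
    Frag.Runs E p.compile s.toData
      (p.cost.eval E.x.length * ((V + 2) * (200 * E.lBound))) () (p.denote E.x s).toData := by
  have hl : 65 ≤ E.lBound := by unfold Env.Small at hs; omega
  have hC : 20 * E.lBound + 1 ≤ (V + 2) * (200 * E.lBound) := by
    nlinarith [Nat.zero_le (V * E.lBound)]
  have hle : ∀ i, (s.reg i + 2) * (200 * E.lBound) ≤ (V + 2) * (200 * E.lBound) := fun i =>
    Nat.mul_le_mul_right _ (Nat.add_le_add_right ((hM i).trans (by omega)) 2)
  generalize hCe : (V + 2) * (200 * E.lBound) = C at *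
  induction p generalizing P K s M with
  | nop =>
    exact (Frag.runs_pure (h.fits.safe (by omega)) ()).mono (by simp [cost]; omega)
  | inc i =>
    simp only [cost, eval_one] at hMV
    refine (Frag.runs_inc s.reg i h.fits (hs.mono (by have := hM i; omega))).mono ?_
    simp only [cost, eval_one]; omega
  | clr i =>
    simp only [cost, eval_one] at hMV
    refine (Frag.runs_clr s.reg i h.fits (hs.mono (by have := hM i; omega))).mono ?_
    simp only [cost, eval_one]; omega
  | set i =>
    simp only [cost, eval_one] at hMV
    have hi : i ∈ K := by simpa [ok] using hp
    refine (Frag.runs_kSet (h.ne_aux i hi) h.aux_eq (hs.mono (by have := hM i; omega))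
      (h.lt_of_mem i hi)).mono ?_
    simp only [cost, eval_one, one_mul]
    exact hle i
  | cert i =>
    simp only [cost, eval_ofNat] at hMV
    have h1 := Frag.runs_clr s.reg i h.fits (hs.mono (by have := hM i; omega))
    have h2 := Frag.runs_pop (E := E) (c := regCells (Function.update s.reg i 0)) (h := 0) h.fits
      (by omega)
    have hf : E.Fits (Data.base 0 s.cert.tail ⟨s.mem, 0⟩) := ⟨Nat.zero_le _, h.within⟩
    have e : (cert i).compile = (Frag.clr i).bind fun _ => Frag.pop.bind fun b =>
      if b then Frag.inc i else Frag.pure () := rfl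
    have h3 : Frag.Runs E (if (s.cert.head? == some true) then Frag.inc i else Frag.pure ())
        ((Data.base 0 s.cert.tail ⟨s.mem, 0⟩).store (Function.update s.reg i 0)) C ()
        ((cert i).denote E.x s).toData := by
      simp only [denote, Store.assign]
      cases s.cert.head? == some true with
      | false => exact (Frag.runs_pure (hf.safe (by omega)) ()).mono (by omega)
      | true =>
        have := Frag.runs_inc (E := E) (Function.update s.reg i 0) i hf
          (hs.mono (by simp only [Function.update_self]; omega))
        simp only [Function.update_self, Function.update_idem] at this
        exact this.mono (by omega)
    rw [e]
    refine (h1.bind (h2.bind h3)).mono ?_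
    simp only [cost, eval_ofNat]
    omega
  | seq p q ihp ihq =>
    simp only [ok, Bool.and_eq_true] at hp
    simp only [cost, eval_add] at hMV
    have h1 := ihp hp.1 h hM (by omega) hle
    -- The space condition on the new `k`-bit tape is read off the safety of the run of `p`, so it
    -- needs no separate analysis of the semantics.
    have h' : (p.denote E.x s).Valid E kb P K :=
      h.congr (fun i hi => denote_reg _ _ _ (notMem_writes hp.1 hi)) h1.safe.kTape
    have hM' := denote_reg_le E.x p s hM
    have h2 := ihq hp.2 h' hM' (by omega) (fun i => hCe ▸ Nat.mul_le_mul_right _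
      (Nat.add_le_add_right ((hM' i).trans (by omega)) 2))
    refine (h1.bind h2).mono ?_
    simp only [cost, eval_add, Nat.add_mul]
    exact le_rfl
  | ite t p q ihp ihq =>
    simp only [ok, Bool.and_eq_true] at hp
    simp only [cost, eval_add, eval_one] at hMV
    have h1 := Test.runs_compile hp.1.1 h (fun i => (hM i).trans (show M ≤ V by omega)) hs
    rw [hCe] at h1
    have h2 := ihp hp.1.2 h hM (by omega) hle
    have h3 := ihq hp.2 h hM (by omega) hle
    simp only [cost, eval_add, eval_one, Nat.add_mul, one_mul]
    simp only [denote]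
    have e : (ite t p q).compile =
      t.compile.bind fun b => if b then p.compile else q.compile := rfl
    rw [e]
    cases hb : t.eval E.x s with
    | true =>
      rw [hb] at h1
      have h4 := h1.bind (G := fun b => if b then p.compile else q.compile) h2
      refine h4.mono ?_
      omega
    | false =>
      rw [hb] at h1
      have h4 := h1.bind (G := fun b => if b then p.compile else q.compile) h3
      refine h4.mono ?_
      omega
  | loop a b p ih =>
    simp only [ok, Bool.and_eq_true, decide_eq_true_eq] at hp
    obtain ⟨⟨ha, hab⟩, hp⟩ := hp
    simp only [cost, eval_add, eval_mul, eval_X, eval_ofNat] at hMV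
    have hal : len ≠ a := fun e => ha (e ▸ h.len_mem)
    have haw : a ∉ p.writes := notMem_writes hp (by simp)
    have hbw : b ∉ p.writes := notMem_writes hp (by simp)
    -- Here `n` is the number of rounds still to come. Per round there are the body and at most four
    -- further operations, and the last two units pay for the tests that leave the loop.
    have key : ∀ n, ∀ (s : Store) (M : ℕ), s.reg a + n = min (s.reg b) E.x.length →
        s.Valid E kb P K → (∀ i, s.reg i ≤ M) → M + n * (p.cost.eval E.x.length + 1) ≤ V →
        Frag.Runs E (Frag.iter (fun _ : Unit =>
            (Frag.leReg b a).bind fun t => if t then Frag.pure (.inr ()) else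
            (Frag.leReg len a).bind fun t => if t then Frag.pure (.inr ()) else
            p.compile.bind fun _ => (Frag.inc a).bind fun _ => Frag.pure (.inl ())) ())
          s.toData ((n * (p.cost.eval E.x.length + 4) + 2) * C) ()
          ((fun s => (p.denote E.x s).assign a ((p.denote E.x s).reg a + 1))^[n] s).toData := by
      intro n
      induction n with
      | zero =>
        intro s M hk h hM hMV
        have hMV' : M ≤ V := by omega
        have h1 := Frag.runs_leReg (E := E) s.reg b a h.fits (hs.mono ((hM b).trans hMV'))
        have h2 := Frag.runs_leReg (E := E) s.reg len a h.fits (hs.mono ((hM len).trans hMV'))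
        have h3 := Frag.runs_pure (E := E) h1.safe (Sum.inr () : Unit ⊕ Unit)
        rw [h.len_eq] at h2
        -- The loop register has reached the minimum of `s.reg b` and the input length, so one of
        -- the two tests succeeds.
        by_cases hba : s.reg b ≤ s.reg a
        · rw [decide_eq_true hba] at h1
          exact (Frag.Runs.iter_exit (r := ()) (h1.bind h3)).mono (by omega)
        · rw [decide_eq_false hba] at h1
          rw [decide_eq_true (by omega)] at h2
          exact (Frag.Runs.iter_exit (r := ()) (h1.bind (h2.bind h3))).mono (by omega)
      | succ n ihn =>
        intro s M hk h hM hMV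
        have hexp : (n + 1) * (p.cost.eval E.x.length + 1) =
          n * (p.cost.eval E.x.length + 1) + p.cost.eval E.x.length + 1 := by ring
        rw [hexp] at hMV
        have hMV' : M ≤ V := by omega
        have h1 := Frag.runs_leReg (E := E) s.reg b a h.fits (hs.mono ((hM b).trans hMV'))
        have h2 := Frag.runs_leReg (E := E) s.reg len a h.fits (hs.mono ((hM len).trans hMV'))
        rw [h.len_eq] at h2
        rw [decide_eq_false (by omega)] at h1 h2
        have h3 := ih hp (h.loop_body ha (by omega)) hM (by omega) (fun i => hCe ▸
          Nat.mul_le_mul_right _ (Nat.add_le_add_right ((hM i).trans (by omega)) 2))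
        have hM' := denote_reg_le E.x p s hM
        have hw := h3.safe.kTape
        have h4 := Frag.runs_inc (E := E) (p.denote E.x s).reg a
          (d := Data.base 0 (p.denote E.x s).cert ⟨(p.denote E.x s).mem, 0⟩)
          ⟨Nat.zero_le _, hw⟩ (hs.mono (by have := hM' a; omega))
        have h5 := Frag.runs_pure (E := E) h4.safe (Sum.inl () : Unit ⊕ Unit)
        have h6 := ihn ((p.denote E.x s).assign a ((p.denote E.x s).reg a + 1))
          (M + p.cost.eval E.x.length + 1)
          (by
            rw [Store.assign_reg_self, Store.assign_reg_of_ne _ _ hab.symm, denote_reg _ _ _ haw,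
              denote_reg _ _ _ hbw]
            omega)
          (by
            refine Store.Valid.assign (h.congr (fun i hi => denote_reg _ _ _ ?_) hw) ha _
            exact notMem_writes hp (by simp [hi]))
          (by
            intro i
            by_cases hi : i = a
            · rw [hi, Store.assign_reg_self]
              have := hM' a
              omega
            · rw [Store.assign_reg_of_ne _ _ hi]
              have := hM' i
              omega)
          (by omega)
        refine (Frag.Runs.iter_next (r := ())
          (h1.bind (h2.bind (h3.bind (h4.bind h5)))) h6).mono ?_
        have e : ((n + 1) * (p.cost.eval E.x.length + 4) + 2) * C =
          p.cost.eval E.x.length * C + 4 * C +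
            (n * (p.cost.eval E.x.length + 4) + 2) * C := by ring
        rw [e]
        omega
    have h1 := Frag.runs_clr s.reg a h.fits (hs.mono (by have := hM a; omega))
    have hn : min (s.reg b) E.x.length ≤ E.x.length := min_le_right _ _
    have hn1 := Nat.mul_le_mul_right (p.cost.eval E.x.length + 4) hn
    have hn2 := Nat.mul_le_mul_left (min (s.reg b) E.x.length)
      (show p.cost.eval E.x.length + 1 ≤ p.cost.eval E.x.length + 4 by omega)
    have hn3 := Nat.mul_comm (p.cost.eval E.x.length + 4) E.x.length
    have h2 := key (min (s.reg b) E.x.length) (s.assign a 0) M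
      (by rw [Store.assign_reg_self, Store.assign_reg_of_ne _ _ hab.symm, Nat.zero_add])
      (h.assign ha 0)
      (by
        intro i
        by_cases hi : i = a
        · rw [hi, Store.assign_reg_self]
          exact Nat.zero_le _
        · rw [Store.assign_reg_of_ne _ _ hi]
          exact hM i)
      (by omega)
    refine (h1.bind h2).mono ?_
    simp only [cost, eval_add, eval_mul, eval_X, eval_ofNat]
    have e : (3 + (p.cost.eval E.x.length + 4) * E.x.length) * C =
      C + (E.x.length * (p.cost.eval E.x.length + 4) + 2) * C := by ring
    rw [e]
    have := Nat.mul_le_mul_right C (Nat.add_le_add_right hn1 2)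
    omega

/-! ### Programs show membership in EPNL -/

theorem monotone_eval (P : ℕ[X]) : Monotone fun n => P.eval n := by
  induction P using Polynomial.induction_on' with
  | add p q hp hq =>
    intro a b h
    simpa using Nat.add_le_add (hp h) (hq h)
  | monomial n c =>
    intro a b h
    simpa using Nat.mul_le_mul_left c (Nat.pow_le_pow_left h n)

theorem size_mul_le (a b : ℕ) : (a * b).size ≤ a.size + b.size := by
  rw [Nat.size_le, pow_add]
  exact Nat.mul_lt_mul'' (Nat.lt_size_self a) (Nat.lt_size_self b)

theorem size_add_le (a b : ℕ) : (a + b).size ≤ a.size + b.size + 1 := by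
  rw [Nat.size_le, pow_succ, pow_add]
  have h1 := Nat.lt_size_self a
  have h2 := Nat.lt_size_self b
  nlinarith [Nat.one_le_two_pow (n := a.size), Nat.one_le_two_pow (n := b.size)]

/-- The number of binary digits is subadditive under products, and under sums up to one digit. So a
polynomial in `n` has `O(log n)` digits, by induction on the polynomial. -/
theorem exists_size_eval_le (P : ℕ[X]) :
    ∃ c, ∀ n, (P.eval n).size ≤ c * (Nat.log 2 n + 1) := by
  induction P using Polynomial.induction_on with
  | C a => exact ⟨a.size, fun n => by simpa using Nat.le_mul_of_pos_right _ (Nat.succ_pos _)⟩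
  | add p q hp hq =>
    obtain ⟨c, hc⟩ := hp
    obtain ⟨c', hc'⟩ := hq
    refine ⟨c + c' + 1, fun n => ?_⟩
    rw [eval_add]
    refine (size_add_le _ _).trans ?_
    have := hc n
    have := hc' n
    nlinarith
  | monomial k a h =>
    obtain ⟨c, hc⟩ := h
    refine ⟨c + 1, fun n => ?_⟩
    have e : (C a * X ^ (k + 1)).eval n = (C a * X ^ k).eval n * n := by
      simp [pow_succ, mul_assoc]
    rw [e]
    refine (size_mul_le _ _).trans ?_
    have := hc n
    have h2 : n.size ≤ Nat.log 2 n + 1 := by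
      rw [Nat.size_le]
      exact Nat.lt_pow_succ_log_self (by norm_num) n
    nlinarith

/-- The store at the beginning. -/
def Store.initial (x y : List Bool) : Store := ⟨Frag.initReg x.length, fun _ => false, y⟩

theorem Store.initial_reg (x y : List Bool) {i : Reg} (h : i ≠ len) :
    (Store.initial x y).reg i = 0 := by
  simp [Store.initial, Frag.initReg, h]

theorem Store.initial_len (x y : List Bool) : (Store.initial x y).reg len = x.length := by
  simp [Store.initial, Frag.initReg]

/-- A complete verifier: the program `p₁` decides (in register `v`) whether the input is an
instance; in this case the program `p₂` decides (in register `r`) about acceptance. -/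
def Frag.verify (p₁ p₂ : Cmd) (v r : Reg) : Frag Bool :=
  prelude.bind fun _ => p₁.compile.bind fun _ => (leReg v zero).bind fun t =>
    if t then pure false else p₂.compile.bind fun _ => (leReg r zero).bind fun t => pure !t

/-- The verdict of a complete verifier. -/
def verdict (p₁ p₂ : Cmd) (v r : Reg) (x y : List Bool) : Prop :=
  (p₁.denote x (.initial x y)).reg v ≠ 0 ∧
    (p₂.denote x (p₁.denote x (.initial x y))).reg r ≠ 0

/-- The bound `hk` on register `kb` is available only on instances, so it may be used only behind
the test of register `v`. -/
theorem Frag.runs_verify {E : Env} {y : List Bool} {p₁ p₂ : Cmd} {v r kb : Reg}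
    (h₁ : p₁.ok zero [aux, len, zero] []) (h₂ : p₂.ok kb [aux, len, zero, kb] [])
    (hk : (p₁.denote E.x (.initial E.x y)).reg v ≠ 0 →
      (p₁.denote E.x (.initial E.x y)).reg kb ≤ E.kBound) {V : ℕ}
    (hV : V = E.x.length + p₁.cost.eval E.x.length + p₂.cost.eval E.x.length)
    (hs : E.Small V) :
    ∃ d' b, (b = true ↔ verdict p₁ p₂ v r E.x y) ∧
      Runs E (verify p₁ p₂ v r) (.initial y)
        ((V + 5) * ((V + 2) * (200 * E.lBound))) b d' := by
  have hl : 65 ≤ E.lBound := by unfold Env.Small at hs; omega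
  have s0 := runs_prelude (E := E) (cert := y) (hs.mono (by omega))
  have hM : ∀ i, (Store.initial E.x y).reg i ≤ E.x.length := by
    intro i
    simp only [Store.initial, initReg, Function.update_apply]
    split_ifs <;> omega
  -- For the parser the bounding register is `zero`, whose value `0` respects every space bound. No
  -- position on the `k`-bit tape is permitted.
  have v0 : (Store.initial E.x y).Valid E zero [aux, len, zero] [] := by
    refine ⟨by simp, by simp, by simp, ?_, ?_, ?_, by simp, by simp, by simp, Or.inr rfl⟩
    · exact Store.initial_reg _ _ (by decide)
    · exact Store.initial_len _ _
    · exact (Store.initial_reg _ _ (by decide)).trans_le (Nat.zero_le _)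
  have s1 := Cmd.runs_compile hs h₁ v0 hM (by omega)
  unfold verdict
  have hM1 := Cmd.denote_reg_le E.x p₁ _ hM
  have hr : ∀ i ∈ [aux, len, zero], (p₁.denote E.x (.initial E.x y)).reg i =
    (Store.initial E.x y).reg i := fun i hi => Cmd.denote_reg _ _ _ (Cmd.notMem_writes h₁ hi)
  have v1 := v0.congr hr s1.safe.kTape
  have hz : (p₁.denote E.x (.initial E.x y)).reg zero = 0 :=
    (hr zero (by simp)).trans (Store.initial_reg _ _ (by decide))
  generalize hst : p₁.denote E.x (.initial E.x y) = s at *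
  have s2 := runs_leReg (E := E) s.reg v zero v1.fits (hs.mono ((hM1 v).trans (by omega)))
  rw [hz] at s2
  generalize hC : (V + 2) * (200 * E.lBound) = C at *
  have hC1 : 20 * E.lBound + 1 ≤ C := by
    rw [← hC]; nlinarith [Nat.zero_le (V * E.lBound)]
  have hC2 : (E.x.length + 3) * (100 * E.lBound) ≤ 2 * C := by
    rw [← hC]
    have : E.x.length * E.lBound ≤ V * E.lBound := Nat.mul_le_mul_right _ (by omega)
    nlinarith [Nat.zero_le (V * E.lBound)]
  by_cases hv : s.reg v ≤ 0
  · refine ⟨s.toData, false, by simp; omega, ?_⟩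
    rw [decide_eq_true hv] at s2
    have s3 := runs_pure s2.safe false
    have s4 := s2.bind (G := fun t => if t then pure false else p₂.compile.bind fun _ =>
      (leReg r zero).bind fun t => pure !t) s3
    refine Runs.mono (s0.bind (s1.bind s4)) ?_
    nlinarith [Nat.zero_le (E.x.length * C), Nat.zero_le (p₂.cost.eval E.x.length * C)]
  · rw [decide_eq_false hv] at s2
    have v2 : s.Valid E kb [aux, len, zero, kb] [] := by
      refine ⟨by simp, by simp, by simp, v1.aux_eq, v1.len_eq, hk (by omega), by simp, by simp,
        by simp, v1.within⟩
    have s3 := Cmd.runs_compile hs h₂ v2 hM1 (by omega)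
    have hM2 := Cmd.denote_reg_le E.x p₂ _ hM1
    have hz2 : (p₂.denote E.x s).reg zero = 0 :=
      (Cmd.denote_reg _ _ _ (Cmd.notMem_writes h₂ (by simp))).trans hz
    have s4 := runs_leReg (E := E) (p₂.denote E.x s).reg r zero ⟨Nat.zero_le _, s3.safe.kTape⟩
      (hs.mono ((hM2 r).trans (by omega)))
    rw [hz2] at s4
    have s5 := runs_pure s4.safe (!decide ((p₂.denote E.x s).reg r ≤ 0))
    refine ⟨_, _, ?_, Runs.mono (s0.bind (s1.bind (s2.bind (s3.bind (s4.bind s5))))) ?_⟩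
    · simp only [Bool.not_eq_true', decide_eq_false_iff_not]
      omega
    · rw [hC]
      nlinarith [Nat.zero_le (E.x.length * C)]

/-- The certificate length is the polynomial `X`, that is, `|x|`. The value `V` bounds all registers
during both programs, and the logspace bound is one block for each digit of `V` plus a spare block
in which the end of a register can be seen. -/
theorem inEPNL_of_program {A : ParamProblem} (p₁ p₂ : Cmd) (v r kb : Reg)
    (h₁ : p₁.ok zero [aux, len, zero] []) (h₂ : p₂.ok kb [aux, len, zero, kb] [])
    (hk : ∀ x y, (p₁.denote x (.initial x y)).reg v ≠ 0 →
      (p₁.denote x (.initial x y)).reg kb ≤ A.param x)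
    (hA : ∀ x, x ∈ A.lang ↔ ∃ y : List Bool, y.length = x.length ∧ verdict p₁ p₂ v r x y) :
    InEPNL A := by
  let V : ℕ[X] := X + p₁.cost + p₂.cost
  have hV : ∀ n, V.eval n = n + p₁.cost.eval n + p₂.cost.eval n := fun n => by simp [V]
  let E : List Bool → Env := fun x =>
    ⟨x, A.param x, 65 * ((V.eval x.length).size + 1)⟩
  have key := fun x y => Frag.runs_verify (E := E x) (y := y) (r := r) h₁ h₂ (hk x y) (hV x.length)
    (by unfold Env.Small; rw [Nat.size_eq_bits_len])
  refine ⟨X, (Frag.verify p₁ p₂ v r).toVerifier, ?_, ?_, ?_⟩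
  -- The number of digits of `V` is at most `V`, so the space bound inside the time bound may be
  -- replaced by `65 * (V + 1)`. Monotonicity passes from `|x|` to `|x| + |y|`.
  · refine ⟨(V + 5) * ((V + 2) * (200 * (65 * (V + 1)))), fun x y => ?_⟩
    obtain ⟨d', b, -, hb⟩ := key x y
    refine Option.isSome_of_eq_some (hb.output_run (E := E x) ?_)
    refine le_trans ?_ (monotone_eval _ (Nat.le_add_right x.length y.length))
    have : (V.eval x.length).size ≤ V.eval x.length := by
      rw [Nat.size_le]
      exact Nat.lt_two_pow_self
    simp only [eval_mul, eval_add, eval_ofNat, eval_one, E]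
    gcongr
  · intro x
    simp only [eval_X]
    rw [hA]
    refine exists_congr fun y => and_congr_right fun _ => ?_
    obtain ⟨d', b, hv, hb⟩ := key x y
    rw [← hv]
    exact (hb.accepts_iff (E := E x)).symm
  · obtain ⟨c, hc⟩ := exists_size_eval_le V
    -- The additional `65` absorbs the spare block.
    refine ⟨65 * (c + 1), fun x y _ t => ?_⟩
    obtain ⟨d', b, -, hb⟩ := key x y
    have hsafe := hb.safe_run ⟨Nat.zero_le _, Or.inr rfl, show 0 < 65 * _ by omega⟩ t
    refine ⟨hsafe.kTape, Or.inl (hsafe.lTape.trans_le ?_)⟩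
    have := hc x.length
    simp only [E]
    nlinarith

end EPNL

namespace EPNL

/-! ### Reasoning about programs -/

/-- The program never writes on the `k`-bit tape. -/
def Cmd.keepsMem : Cmd → Bool
  | set _ => false
  | seq p q => p.keepsMem && q.keepsMem
  | ite _ p q => p.keepsMem && q.keepsMem
  | loop _ _ p => p.keepsMem
  | _ => true

/-- The program never reads the certificate. -/
def Cmd.keepsCert : Cmd → Bool
  | cert _ => false
  | seq p q => p.keepsCert && q.keepsCert
  | ite _ p q => p.keepsCert && q.keepsCert
  | loop _ _ p => p.keepsCert
  | _ => true

theorem iterate_preserves {α β : Type} {g : α → β} {f : α → α} (h : ∀ a, g (f a) = g a) (n : ℕ)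
    (a : α) : g (f^[n] a) = g a := by
  induction n generalizing a with
  | zero => rfl
  | succ n ih => rw [Function.iterate_succ_apply, ih, h]

theorem Cmd.denote_mem (x : List Bool) {p : Cmd} (h : p.keepsMem) (s : Store) :
    (p.denote x s).mem = s.mem := by
  induction p generalizing s with
  | set i => simp [keepsMem] at h
  | seq p q ihp ihq =>
    simp only [keepsMem, Bool.and_eq_true] at h
    simp only [denote]
    rw [ihq h.2, ihp h.1]
  | ite t p q ihp ihq =>
    simp only [keepsMem, Bool.and_eq_true] at h
    simp only [denote]
    split_ifs
    · exact ihp h.1 s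
    · exact ihq h.2 s
  | loop a b p ih =>
    simp only [denote]
    rw [iterate_preserves (g := Store.mem) (fun s => by simp only [Store.assign_mem]; exact ih h s)]
    rfl
  | _ => rfl

theorem Cmd.denote_cert (x : List Bool) {p : Cmd} (h : p.keepsCert) (s : Store) :
    (p.denote x s).cert = s.cert := by
  induction p generalizing s with
  | cert i => simp [keepsCert] at h
  | seq p q ihp ihq =>
    simp only [keepsCert, Bool.and_eq_true] at h
    simp only [denote]
    rw [ihq h.2, ihp h.1]
  | ite t p q ihp ihq =>
    simp only [keepsCert, Bool.and_eq_true] at h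
    simp only [denote]
    split_ifs
    · exact ihp h.1 s
    · exact ihq h.2 s
  | loop a b p ih =>
    simp only [denote]
    rw [iterate_preserves (g := Store.cert)
      (fun s => by simp only [Store.assign_cert]; exact ih h s)]
    rfl
  | _ => rfl

/-- The invariant rule for loops. -/
theorem Cmd.loop_rule {x : List Bool} {a b : Reg} {p : Cmd} {s : Store} (I : ℕ → Store → Prop)
    (ha : a ∉ p.writes)
    (hI : ∀ k s' v, I k s' → I k (s'.assign a v)) (h0 : I 0 s)
    (hstep : ∀ k s', k < s.reg b → k < x.length → s'.reg a = k →
      (∀ i, i ≠ a → i ∉ p.writes → s'.reg i = s.reg i) → I k s' → I (k + 1) (p.denote x s')) :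
    I (min (s.reg b) x.length) ((loop a b p).denote x s) := by
  have key : ∀ n ≤ min (s.reg b) x.length,
      ((fun s => (p.denote x s).assign a ((p.denote x s).reg a + 1))^[n] (s.assign a 0)).reg a = n ∧
      (∀ i, i ≠ a → i ∉ p.writes →
        ((fun s => (p.denote x s).assign a ((p.denote x s).reg a + 1))^[n] (s.assign a 0)).reg i =
          s.reg i) ∧
      I n ((fun s => (p.denote x s).assign a ((p.denote x s).reg a + 1))^[n] (s.assign a 0)) := by
    intro n
    induction n with
    | zero =>
      intro _
      exact ⟨Store.assign_reg_self _ _ _, fun i hi _ => Store.assign_reg_of_ne _ _ hi,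
        hI _ _ _ h0⟩
    | succ n ih =>
      intro hn
      obtain ⟨h1, h2, h3⟩ := ih (by omega)
      rw [Function.iterate_succ_apply']
      refine ⟨?_, fun i hi hw => ?_, hI _ _ _ (hstep n _ (by omega) (by omega) h1 h2 h3)⟩
      · rw [Store.assign_reg_self, denote_reg _ _ _ ha, h1]
      · rw [Store.assign_reg_of_ne _ _ hi, denote_reg _ _ _ hw, h2 i hi hw]
  exact (key _ le_rfl).2.2

theorem Cmd.denote_seq (x : List Bool) (p q : Cmd) (s : Store) :
    (seq p q).denote x s = q.denote x (p.denote x s) := rfl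

theorem Cmd.denote_ite (x : List Bool) (t : Test) (p q : Cmd) (s : Store) :
    (ite t p q).denote x s = if t.eval x s then p.denote x s else q.denote x s := rfl

theorem Cmd.denote_inc (x : List Bool) (i : Reg) (s : Store) :
    (inc i).denote x s = s.assign i (s.reg i + 1) := rfl

theorem Cmd.denote_clr (x : List Bool) (i : Reg) (s : Store) :
    (clr i).denote x s = s.assign i 0 := rfl

theorem Cmd.denote_nop (x : List Bool) (s : Store) : nop.denote x s = s := rfl

/-! ### Registers of the verifiers -/

/-- Roles: `rN` number of vertices or elements, `rB` beginning of the matrix, `rM` number of rows,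
`rQ` beginning of the binary bound, `rF` and `rF'` flags, `rV` verdict of the parser, `rA`
acceptance, `rC` number of visited vertices, `rS` accumulated cost, `rT`, `rU`, `rI`, `rJ` loop
registers (`rU` is also the proposed vertex), `rG` certificate bit, `rR` computed position, `rX` and
`rY` loop registers of the arithmetic, `rP` last and `rD` first vertex of the path, `rL` last input
bit, `rE` number of uncovered elements. -/
abbrev rN : Reg := 0
abbrev rB : Reg := 1
abbrev rM : Reg := 2
abbrev rQ : Reg := 3
abbrev rF : Reg := 4
abbrev rF' : Reg := 5
abbrev rV : Reg := 6
abbrev rA : Reg := 7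
abbrev rC : Reg := 8
abbrev rS : Reg := 9
abbrev rT : Reg := 10
abbrev rU : Reg := 11
abbrev rG : Reg := 12
abbrev rR : Reg := 13
abbrev rX : Reg := 14
abbrev rY : Reg := 15
abbrev rP : Reg := 16
abbrev rD : Reg := 17
abbrev rI : Reg := 18
abbrev rJ : Reg := 19
abbrev rL : Reg := 20
abbrev rE : Reg := 21

namespace Cmd

variable {x : List Bool} {s : Store}

/-! ### Arithmetic -/

/-- Add register `b` to register `a`. -/
def add (a b : Reg) : Cmd := loop rX b (inc a)

/-- Loops are capped at `|x|` rounds, whence the hypothesis on the summand. All later arithmetic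
inherits such hypotheses. -/
theorem add_reg {a b : Reg} (ha : a ≠ rX) (hx : s.reg b ≤ x.length) :
    ((add a b).denote x s).reg a = s.reg a + s.reg b := by
  have := loop_rule (x := x) (a := rX) (b := b) (p := inc a) (s := s)
    (fun k s' => s'.reg a = s.reg a + k)
    (by simpa [writes] using ha.symm)
    (fun k s' v h => by rw [Store.assign_reg_of_ne _ _ ha, h]) rfl
    (fun k s' _ _ _ _ h => by rw [denote_inc, Store.assign_reg_self, h, Nat.add_assoc])
  rwa [min_eq_left hx] at this

/-- Copy register `b` to register `a`. -/
def copy (a b : Reg) : Cmd := seq (clr a) (add a b)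

theorem copy_reg {a b : Reg} (hab : a ≠ b) (ha : a ≠ rX) (hx : s.reg b ≤ x.length) :
    ((copy a b).denote x s).reg a = s.reg b := by
  have e : ((clr a).denote x s).reg b = s.reg b := by
    rw [denote_clr, Store.assign_reg_of_ne _ _ hab.symm]
  rw [copy, denote_seq, add_reg ha (by rw [e]; exact hx), e, denote_clr,
    Store.assign_reg_self, Nat.zero_add]

theorem copy_writes (a b : Reg) : (copy a b).writes = [a, rX, a] := rfl

/-- Compute the position of the matrix entry with row `i` and column `j`. -/
def pos (i j : Reg) : Cmd :=
  seq (copy rR rB) (seq (loop rY i (add rR rN)) (add rR j))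

theorem pos_writes (i j : Reg) : (pos i j).writes = [rR, rX, rR, rY, rX, rR, rX, rR] := rfl

theorem pos_reg {i j : Reg} (hi : i ∉ [rR, rX, rY]) (hj : j ∉ [rR, rX, rY])
    (hB : s.reg rB ≤ x.length) (hN : s.reg rN ≤ x.length) (hi' : s.reg i ≤ x.length)
    (hj' : s.reg j ≤ x.length) :
    ((pos i j).denote x s).reg rR = s.reg rB + s.reg rN * s.reg i + s.reg j := by
  simp only [List.mem_cons, List.not_mem_nil, or_false, not_or] at hi hj
  obtain ⟨i1, i2, i3⟩ := hi
  obtain ⟨j1, j2, j3⟩ := hj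
  have h1 := copy_reg (x := x) (s := s) (a := rR) (b := rB) (by decide) (by decide) hB
  have hf : ∀ k, k ≠ rR → k ≠ rX → ((copy rR rB).denote x s).reg k = s.reg k := fun k h h' =>
    denote_reg _ _ _ (by simp [copy_writes, h, h'])
  have h2 := loop_rule (x := x) (a := rY) (b := i) (p := add rR rN) (s := (copy rR rB).denote x s)
    (fun k s' => s'.reg rR = s.reg rB + s.reg rN * k)
    (by decide)
    (fun k s' v h => by rw [Store.assign_reg_of_ne _ _ (by decide), h]) (by simpa using h1)
    (fun k s' _ _ _ hs h => by
      have e : s'.reg rN = s.reg rN := by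
        rw [hs rN (by decide) (by decide), hf rN (by decide) (by decide)]
      rw [add_reg (by decide) (by rw [e]; exact hN), h, e]
      ring)
  rw [hf i i1 i2, min_eq_left hi'] at h2
  have hf' : ((loop rY i (add rR rN)).denote x ((copy rR rB).denote x s)).reg j = s.reg j := by
    rw [denote_reg, hf j j1 j2]
    change j ∉ [rY, rX, rR]
    simp [j1, j2, j3]
  rw [pos, denote_seq, denote_seq, add_reg (by decide) (by rw [hf']; exact hj'), h2,
    hf']

theorem pos_frame {i j k : Reg} (h : k ∉ [rR, rX, rY]) :
    ((pos i j).denote x s).reg k = s.reg k := by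
  refine denote_reg _ _ _ ?_
  rw [pos_writes]
  simp only [List.mem_cons, List.not_mem_nil, or_false, not_or] at h ⊢
  tauto

/-! ### Parsing -/

/-- Count the ones from position `p` on in `c`, up to the first zero, which sets `f`. -/
def unary (p c f : Reg) : Cmd :=
  loop rU len (ite (.le p rU)
    (ite (.inp rU) (ite (.le f zero) (inc c) nop) (seq (clr f) (inc f))) nop)

/-- The language has no early exit, so the loop scans the whole input, and the flag `f` stops the
counting after the first zero. The invariant is the claim for the first `k` bits of the input. -/
theorem unary_reg {p c f : Reg} (hpc : p ≠ c) (hpf : p ≠ f) (hcf : c ≠ f) (hpu : p ≠ rU)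
    (hcu : c ≠ rU) (hfu : f ≠ rU) (hcz : c ≠ zero) (hfz : f ≠ zero)
    (hc : s.reg c = 0) (hf : s.reg f = 0) (hz : s.reg zero = 0) (hl : s.reg len = x.length) :
    ((unary p c f).denote x s).reg c = ((x.drop (s.reg p)).takeWhile id).length ∧
      (((unary p c f).denote x s).reg f ≠ 0 ↔ false ∈ x.drop (s.reg p)) := by
  have hw : ∀ i, i ≠ c → i ≠ f → i ∉ (ite (.le p rU)
    (ite (.inp rU) (ite (.le f zero) (inc c) nop) (seq (clr f) (inc f))) nop).writes := by
    intro i h1 h2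
    simp [writes, h1, h2]
  have := loop_rule (x := x) (a := rU) (b := len) (s := s)
    (p := ite (.le p rU) (ite (.inp rU) (ite (.le f zero) (inc c) nop) (seq (clr f) (inc f))) nop)
    (fun k s' => s'.reg c = (((x.take k).drop (s.reg p)).takeWhile id).length ∧
      (s'.reg f ≠ 0 ↔ false ∈ (x.take k).drop (s.reg p)))
    (hw _ hcu.symm hfu.symm)
    (fun k s' v h => by
      rw [Store.assign_reg_of_ne _ _ hcu, Store.assign_reg_of_ne _ _ hfu]; exact h)
    (by simp [hc, hf])
    (fun k s' _ hk hu hs ⟨h1, h2⟩ => by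
      have hp' := hs p hpu (hw p hpc hpf)
      have hz' := hs zero (by decide) (hw zero hcz.symm hfz.symm)
      rw [hz] at hz'
      rw [denote_ite]
      simp only [Test.eval, hu, hp', decide_eq_true_eq]
      rw [List.take_add_one, List.getElem?_eq_getElem hk, Option.toList_some]
      split_ifs with hpk
      · rw [List.drop_append_of_le_length (by rw [List.length_take]; omega)]
        rw [denote_ite]
        simp only [Test.eval, hu, List.getElem?_eq_getElem hk]
        cases hxk : x[k] with
        | false =>
          simp only [Option.some_beq_some, Bool.false_beq, Bool.not_true, Bool.false_eq_true,
            if_false, denote_seq, denote_clr, denote_inc, Store.assign_reg_self]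
          refine ⟨?_, by simp⟩
          rw [Store.assign_reg_of_ne _ _ hcf, Store.assign_reg_of_ne _ _ hcf, h1,
            List.takeWhile_append]
          split_ifs with e
          · simp [e]
          · rfl
        | true =>
          simp only [beq_self_eq_true, if_true, denote_ite, Test.eval, hz', Nat.le_zero,
            decide_eq_true_eq]
          split_ifs with hf0
          · have hall : ∀ b ∈ (x.take k).drop (s.reg p), id b = true := by
              intro b hb
              cases b with
              | true => rfl
              | false => exact absurd hf0 (h2.2 hb)
            rw [denote_inc, Store.assign_reg_self, Store.assign_reg_of_ne _ _ hcf.symm, h1,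
              List.takeWhile_append_of_pos hall, List.takeWhile_eq_self_iff.2 hall]
            refine ⟨by simp, ?_⟩
            rw [h2]
            simp
          -- A zero has occurred before position `k`, so `takeWhile` ends before the new bit and the
          -- count stays.
          · have hm := h2.1 hf0
            rw [denote_nop, h1, List.takeWhile_append, if_neg]
            · refine ⟨rfl, ?_⟩
              rw [h2]
              simp
            · intro e
              have := List.takeWhile_eq_self_iff.1
                ((List.takeWhile_prefix (p := id) (l := (x.take k).drop (s.reg p))).eq_of_length e)
                _ hm
              simp at this
      · rw [denote_nop]
        have e1 : (x.take k).drop (s.reg p) = [] := by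
          rw [List.drop_eq_nil_iff, List.length_take]; omega
        have e2 : (x.take k ++ [x[k]]).drop (s.reg p) = [] := by
          rw [List.drop_eq_nil_iff, List.length_append, List.length_take, List.length_singleton]
          omega
        rw [e1] at h1 h2
        rw [e2]
        exact ⟨h1, h2⟩)
  rw [hl, min_self, List.take_length] at this
  exact this

/-- Store the last bit of the input in register `rL`. -/
def lastBit : Cmd :=
  loop rU len (seq (clr rL) (ite (.inp rU) (inc rL) nop))

theorem lastBit_reg (hL : s.reg rL = 0) (hl : s.reg len = x.length) :
    ((lastBit).denote x s).reg rL ≠ 0 ↔ x.getLast? = some true := by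
  have := loop_rule (x := x) (a := rU) (b := len) (s := s)
    (p := seq (clr rL) (ite (.inp rU) (inc rL) nop))
    (fun k s' => s'.reg rL ≠ 0 ↔ (x.take k).getLast? = some true)
    (by decide)
    (fun k s' v h => by rw [Store.assign_reg_of_ne _ _ (by decide)]; exact h)
    (by simp [hL])
    (fun k s' _ hk hu hs h => by
      rw [denote_seq, denote_ite]
      have hu' : (s'.assign rL 0).reg rU = k := by
        rw [Store.assign_reg_of_ne _ _ (by decide), hu]
      simp only [Test.eval, denote_clr, hu', denote_inc, denote_nop]
      rw [List.take_add_one, List.getElem?_eq_getElem hk, Option.toList_some,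
        List.getLast?_append]
      cases x[k] <;> simp)
  rw [hl, min_self, List.take_length] at this
  exact this

end Cmd

/-! ### Decoding -/

theorem exists_eq_unaryThen {w : List Bool} (h : false ∈ w) :
    ∃ v, w = unaryThen (w.takeWhile id).length v := by
  induction w with
  | nil => simp at h
  | cons b w ih =>
    cases b with
    | false => exact ⟨w, by simp [unaryThen]⟩
    | true =>
      obtain ⟨v, hv⟩ := ih (by simpa using h)
      refine ⟨v, ?_⟩
      conv_lhs => rw [hv]
      simp [unaryThen, List.replicate_succ]

theorem takeWhile_unaryThen (n : ℕ) (w : List Bool) :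
    ((unaryThen n w).takeWhile id).length = n := by
  induction n with
  | zero => simp [unaryThen]
  | succ n ih =>
    have e : unaryThen (n + 1) w = true :: unaryThen n w := by
      simp [unaryThen, List.replicate_succ]
    simpa [e, List.takeWhile_cons] using ih

theorem length_unaryThen (n : ℕ) (w : List Bool) : (unaryThen n w).length = n + 1 + w.length := by
  simp [unaryThen]; ring

theorem drop_unaryThen (n : ℕ) (w : List Bool) : (unaryThen n w).drop (n + 1) = w := by
  simp [unaryThen, List.drop_append]

theorem false_mem_unaryThen (n : ℕ) (w : List Bool) : false ∈ unaryThen n w := by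
  simp [unaryThen]

theorem getElem?_matrixBits {m n : ℕ} (r : Fin m → Fin n → Prop) (i : Fin m) (j : Fin n)
    (w : List Bool) :
    (matrixBits r ++ w)[n * i + j]? = some true ↔ r i j := by
  have hlt : n * (i : ℕ) + j < m * n := by
    have := (finProdFinEquiv (i, j)).isLt
    simp only [finProdFinEquiv_apply_val] at this
    omega
  rw [List.getElem?_append_left (by rw [matrixBits_length]; exact hlt)]
  have e : finProdFinEquiv.symm (finProdFinEquiv (i, j)) = (i, j) :=
    finProdFinEquiv.symm_apply_apply (i, j)
  have e0 : finProdFinEquiv (i, j) = ⟨n * i + j, hlt⟩ := by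
    apply Fin.ext
    simp only [finProdFinEquiv_apply_val]
    omega
  rw [e0] at e
  have e1 : (⟨n * i + j, hlt⟩ : Fin (m * n)).divNat = i := congrArg Prod.fst e
  have e2 : (⟨n * i + j, hlt⟩ : Fin (m * n)).modNat = j := congrArg Prod.snd e
  rw [matrixBits, List.getElem?_ofFn, dif_pos hlt, e1, e2]
  simp

/-- Every word of sufficient length begins with some matrix, so recognizing a matrix amounts to
checking lengths. -/
theorem eq_matrixBits_append {m n : ℕ} {w : List Bool} (h : m * n ≤ w.length) :
    w = matrixBits (fun (i : Fin m) (j : Fin n) => w[n * (i : ℕ) + j]? = some true) ++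
      w.drop (m * n) := by
  conv_lhs => rw [← List.take_append_drop (m * n) w]
  congr 1
  apply List.ext_getElem
  · rw [matrixBits_length, List.length_take, min_eq_left h]
  · intro k h1 h2
    rw [matrixBits_length] at h2
    simp only [matrixBits, List.getElem_ofFn, List.getElem_take]
    have e : n * ((⟨k, h2⟩ : Fin (m * n)).divNat : ℕ) + ((⟨k, h2⟩ : Fin (m * n)).modNat : ℕ) = k := by
      simp only [Fin.coe_divNat, Fin.coe_modNat]
      exact Nat.div_add_mod k n
    refine Bool.eq_iff_iff.2 (Iff.trans ?_ (@decide_eq_true_iff _ (Classical.propDecidable _)).symm)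
    rw [e, List.getElem?_eq_getElem (by omega), Option.some_inj]

/-- Together with `bits_eq_nil_or` this characterizes the canonical binary words: they are empty or
end with a one. So looking at the last input bit suffices to validate the bound. -/
theorem exists_bits_eq {w : List Bool} (h : w = [] ∨ w.getLast? = some true) :
    ∃ b, Nat.bits b = w := by
  induction w with
  | nil => exact ⟨0, Nat.zero_bits⟩
  | cons c w ih =>
    obtain ⟨b, hb⟩ : ∃ b, Nat.bits b = w := by
      apply ih
      cases w with
      | nil => exact .inl rfl
      | cons d w => exact .inr (by simpa using h)
    refine ⟨Nat.bit c b, ?_⟩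
    rw [Nat.bits_append_bit, hb]
    rintro rfl
    rw [Nat.zero_bits] at hb
    subst hb
    simpa using h

theorem bits_eq_nil_or (b : ℕ) : b.bits = [] ∨ b.bits.getLast? = some true := by
  induction b using Nat.binaryRec' with
  | zero => exact .inl Nat.zero_bits
  | bit p b hb ih =>
    right
    rw [Nat.bits_append_bit _ _ hb]
    rcases ih with h | h
    · have hb0 : b = 0 := by
        rw [← Nat.size_eq_zero, ← Nat.size_eq_bits_len, h]; rfl
      simp [h, hb hb0]
    · rw [List.getLast?_cons, h]; rfl

end EPNL

namespace EPNL

/-! ### Problems given by an encoding -/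

/-- The program `p₁` has to recognize exactly the image of the encoding, whatever the certificate
is. On that image the word is `enc I`, so all claims about `p₂` can be stated for instances instead
of words. -/
theorem inEPNL_ofEncoding {ι : Type} (enc : ι ↪ List Bool) (yes : ι → Prop) (size : ι → ℕ)
    (p₁ p₂ : Cmd) (v r kb : Reg)
    (h₁ : p₁.ok zero [aux, len, zero] []) (h₂ : p₂.ok kb [aux, len, zero, kb] [])
    (hdec : ∀ x y, (p₁.denote x (.initial x y)).reg v ≠ 0 → ∃ I, enc I = x)
    (henc : ∀ I y, (p₁.denote (enc I) (.initial (enc I) y)).reg v ≠ 0 ∧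
      (p₁.denote (enc I) (.initial (enc I) y)).reg kb = size I)
    (hyes : ∀ I, yes I ↔ ∃ y : List Bool, y.length = (enc I).length ∧
      (p₂.denote (enc I) (p₁.denote (enc I) (.initial (enc I) y))).reg r ≠ 0) :
    InEPNL (.ofEncoding enc yes size) := by
  refine inEPNL_of_program p₁ p₂ v r kb h₁ h₂ (fun x y hv => ?_) (fun x => ⟨?_, ?_⟩)
  · obtain ⟨I, rfl⟩ := hdec x y hv
    rw [ParamProblem.ofEncoding_param]
    exact (henc I y).2.le
  · rintro ⟨I, rfl, hI⟩
    obtain ⟨y, hy, hr⟩ := (hyes I).1 hI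
    exact ⟨y, hy, (henc I y).1, hr⟩
  · rintro ⟨y, hy, hv, hr⟩
    obtain ⟨I, rfl⟩ := hdec x y hv
    exact ⟨I, rfl, (hyes I).2 ⟨y, hy, hr⟩⟩

/-- The situation in which the second program of a verifier starts. -/
structure Store.Start (x y : List Bool) (s : Store) : Prop where
  mem : s.mem = fun _ => false
  cert : s.cert = y
  len : s.reg len = x.length
  reg : ∀ i ∈ [zero, rA, rC, rS, rP, rD, rE], s.reg i = 0

theorem Cmd.start_denote {x y : List Bool} {p : Cmd} (hm : p.keepsMem) (hc : p.keepsCert)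
    (hw : ∀ i ∈ [zero, rA, rC, rS, rP, rD, rE], i ∉ p.writes) (hl : EPNL.len ∉ p.writes) :
    (p.denote x (.initial x y)).Start x y where
  mem := denote_mem x hm _
  cert := denote_cert x hc _
  len := by rw [denote_reg _ _ _ hl, Store.initial_len]
  reg i hi := by
    rw [denote_reg _ _ _ (hw i hi), Store.initial_reg]
    rintro rfl
    revert hi
    decide

/-! ### Parsing instances -/

namespace Cmd

variable {x : List Bool} {s : Store}

/-- Compute the end of the matrix and the last bit of the input. -/
def measure : Cmd := seq lastBit (pos rM zero)

theorem measure_reg (hL : s.reg rL = 0) (hz : s.reg zero = 0) (hl : s.reg len = x.length)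
    (hB : s.reg rB ≤ x.length) (hN : s.reg rN ≤ x.length) (hM : s.reg rM ≤ x.length) :
    (measure.denote x s).reg rR = s.reg rB + s.reg rN * s.reg rM ∧
      ((measure.denote x s).reg rL ≠ 0 ↔ x.getLast? = some true) := by
  have hf : ∀ i ∉ lastBit.writes, (lastBit.denote x s).reg i = s.reg i := fun i hi =>
    denote_reg _ _ _ hi
  have hfB := hf rB (by decide)
  have hfN := hf rN (by decide)
  have hfM := hf rM (by decide)
  have hfz := hf zero (by decide)
  rw [measure, denote_seq]
  constructor
  · rw [pos_reg (by decide) (by decide) (by omega) (by omega) (by omega) (by omega), hfB, hfN, hfM,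
      hfz, hz, Nat.add_zero]
  · rw [pos_frame (by decide)]
    exact lastBit_reg hL hl

/-- Run `p` if the matrix is complete and followed by a binary number. -/
def guard (p : Cmd) : Cmd :=
  ite (.le rF zero) nop (ite (.le rR len) (ite (.le len rR) p (ite (.le rL zero) nop p)) nop)

theorem denote_guard (p : Cmd) (hz : s.reg zero = 0) (hl : s.reg len = x.length) :
    (guard p).denote x s = if s.reg rF ≠ 0 ∧ s.reg rR ≤ x.length ∧
      (s.reg rR = x.length ∨ s.reg rL ≠ 0) then p.denote x s else s := by
  simp only [guard, denote_ite, Test.eval, hz, hl, denote_nop, decide_eq_true_eq]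
  split_ifs <;> first | rfl | omega

/-- Run `p` if the input ends with the matrix. -/
def guardEnd (p : Cmd) : Cmd :=
  ite (.le rF zero) nop (ite (.le rR len) (ite (.le len rR) p nop) nop)

theorem denote_guardEnd (p : Cmd) (hz : s.reg zero = 0) (hl : s.reg len = x.length) :
    (guardEnd p).denote x s = if s.reg rF ≠ 0 ∧ s.reg rR = x.length then p.denote x s else s := by
  simp only [guardEnd, denote_ite, Test.eval, hz, hl, denote_nop, decide_eq_true_eq]
  split_ifs <;> first | rfl | omega

/-- Parse the number of vertices of a graph and compute the end of the adjacency matrix. -/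
def graphPrefix : Cmd :=
  seq (unary zero rN rF) (seq (copy rB rN) (seq (inc rB) (seq (copy rM rN) measure)))

/-- The values are claimed only if the input contains a zero. Otherwise `n + 1` would exceed `|x|`,
and the capped loops would no longer compute the intended numbers. -/
theorem graphPrefix_reg (x y : List Bool) :
    let s := graphPrefix.denote x (.initial x y)
    let n := (x.takeWhile id).length
    (s.reg rF ≠ 0 ↔ false ∈ x) ∧ (false ∈ x → s.reg rN = n ∧ s.reg rB = n + 1 ∧
      s.reg rR = n + 1 + n * n ∧ (s.reg rL ≠ 0 ↔ x.getLast? = some true)) := by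
  intro s n
  have i0 : ∀ i, i ≠ len → (Store.initial x y).reg i = 0 := fun i hi => Store.initial_reg x y hi
  obtain ⟨hn, hF⟩ := unary_reg (x := x) (s := .initial x y) (p := zero) (c := rN) (f := rF)
    (by decide) (by decide) (by decide) (by decide) (by decide) (by decide) (by decide) (by decide)
    (i0 _ (by decide)) (i0 _ (by decide)) (i0 _ (by decide)) (Store.initial_len x y)
  rw [i0 zero (by decide), List.drop_zero] at hn hF
  have hs : s = graphPrefix.denote x (.initial x y) := rfl
  simp only [graphPrefix, denote_seq] at hs
  have f1 : ∀ i ∉ (unary zero rN rF).writes, ((unary zero rN rF).denote x (.initial x y)).reg i =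
    (Store.initial x y).reg i := fun i hi => denote_reg _ _ _ hi
  generalize (unary zero rN rF).denote x (.initial x y) = s1 at *
  have f2 : ∀ i ∉ (copy rB rN).writes, ((copy rB rN).denote x s1).reg i = s1.reg i :=
    fun i hi => denote_reg _ _ _ hi
  have f3 : ∀ i, i ≠ rB → ((inc rB).denote x ((copy rB rN).denote x s1)).reg i =
    ((copy rB rN).denote x s1).reg i := fun i hi => by
      rw [denote_inc, Store.assign_reg_of_ne _ _ hi]
  have c1 := copy_reg (x := x) (s := s1) (a := rB) (b := rN) (by decide) (by decide)
  have c2 : ((inc rB).denote x ((copy rB rN).denote x s1)).reg rB =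
    ((copy rB rN).denote x s1).reg rB + 1 := by rw [denote_inc, Store.assign_reg_self]
  generalize (copy rB rN).denote x s1 = s2 at *
  generalize (inc rB).denote x s2 = s3 at *
  have f4 : ∀ i ∉ (copy rM rN).writes, ((copy rM rN).denote x s3).reg i = s3.reg i :=
    fun i hi => denote_reg _ _ _ hi
  have c3 := copy_reg (x := x) (s := s3) (a := rM) (b := rN) (by decide) (by decide)
  generalize (copy rM rN).denote x s3 = s4 at *
  have f5 : ∀ i ∉ measure.writes, (measure.denote x s4).reg i = s4.reg i :=
    fun i hi => denote_reg _ _ _ hi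
  have hF' : s.reg rF = s1.reg rF := by
    rw [hs, f5 _ (by decide), f4 _ (by decide), f3 _ (by decide), f2 _ (by decide)]
  refine ⟨by rw [hF']; exact hF, fun hfalse => ?_⟩
  have hnx : n + 1 ≤ x.length := by
    obtain ⟨v, hv⟩ := exists_eq_unaryThen hfalse
    rw [hv, length_unaryThen]
    change n + 1 ≤ n + 1 + _
    omega
  have n1 : s1.reg rN = n := hn
  have n3 : s3.reg rN = n := by rw [f3 _ (by decide), f2 _ (by decide), n1]
  have b3 : s3.reg rB = n + 1 := by rw [c2, c1 (by omega), n1]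
  have n4 : s4.reg rN = n := by rw [f4 _ (by decide), n3]
  have b4 : s4.reg rB = n + 1 := by rw [f4 _ (by decide), b3]
  have m4 : s4.reg rM = n := by rw [c3 (by omega), n3]
  have r4 : ∀ i ∈ [rL, zero, len], s4.reg i = (Store.initial x y).reg i := by
    intro i hi
    rw [f4, f3, f2, f1]
    all_goals
      revert i
      decide
  obtain ⟨m1, m2⟩ := measure_reg (x := x) (s := s4)
    (by rw [r4 rL (by simp), i0 _ (by decide)]) (by rw [r4 zero (by simp), i0 _ (by decide)])
    (by rw [r4 len (by simp), Store.initial_len]) (by omega) (by omega) (by omega)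
  rw [b4, n4, m4] at m1
  exact ⟨by rw [hs, f5 _ (by decide), n4], by rw [hs, f5 _ (by decide), b4],
    by rw [hs, m1], by rw [hs, m2]⟩

end Cmd

/-- An input that consists of a prefix, a matrix and a binary number. -/
theorem exists_matrixBits_bits {x : List Bool} {b m n : ℕ} (hx : b + n * m ≤ x.length)
    (h : b + n * m = x.length ∨ x.getLast? = some true) :
    ∃ (A : Fin m → Fin n → Prop) (k : ℕ), x.drop b = matrixBits A ++ Nat.bits k := by
  have hm : m * n = n * m := Nat.mul_comm m n
  have e := eq_matrixBits_append (m := m) (n := n) (w := x.drop b)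
    (by rw [List.length_drop]; omega)
  obtain ⟨k, hk⟩ := exists_bits_eq (w := (x.drop b).drop (m * n)) (by
    rw [List.drop_drop, hm]
    rcases h with h | h
    · left
      rw [List.drop_eq_nil_iff]
      omega
    · rcases eq_or_lt_of_le hx with h' | h'
      · left
        rw [List.drop_eq_nil_iff]
        omega
      · right
        rw [List.getLast?_drop, if_neg (by omega), h])
  exact ⟨_, k, by rw [hk]; exact e⟩

/-! ### Visiting vertices in a certified order -/

open Classical in
/-- The list of vertices visited by the first `k` bits of the certificate: bit `k` proposes the
vertex `k % n`. -/
noncomputable def visit (cond : List ℕ → ℕ → Prop) (n : ℕ) (y : List Bool) : ℕ → List ℕ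
  | 0 => []
  | k + 1 =>
    if y[k]? = some true ∧ k % n ∉ visit cond n y k ∧ cond (visit cond n y k) (k % n) then
      visit cond n y k ++ [k % n] else visit cond n y k

/-- The restriction `k ≤ n * n` excludes the degenerate case `n = 0`, where `k % 0 = k` is not a
vertex. -/
theorem visit_induction {cond : List ℕ → ℕ → Prop} {n : ℕ} {y : List Bool} (P : List ℕ → Prop)
    (h0 : P []) (hs : ∀ l v, v < n → v ∉ l → cond l v → P l → P (l ++ [v])) {k : ℕ}
    (hk : k ≤ n * n) : P (visit cond n y k) := by
  induction k with
  | zero => exact h0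
  | succ k ih =>
    have hn : 0 < n := by
      rcases Nat.eq_zero_or_pos n with rfl | h
      · simp at hk
      · exact h
    rw [visit]
    split_ifs with h
    · exact hs _ _ (Nat.mod_lt _ hn) h.2.1 h.2.2 (ih (by omega))
    · exact ih (by omega)

theorem visit_props {cond : List ℕ → ℕ → Prop} {n : ℕ} {y : List Bool} {k : ℕ} (hk : k ≤ n * n) :
    (visit cond n y k).Nodup ∧ ∀ v ∈ visit cond n y k, v < n := by
  refine visit_induction (fun l => l.Nodup ∧ ∀ v ∈ l, v < n) (by simp) ?_ hk
  rintro l v hv hl - ⟨h1, h2⟩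
  refine ⟨?_, ?_⟩
  · rw [List.nodup_append]
    refine ⟨h1, List.nodup_singleton v, fun a ha b hb => ?_⟩
    rintro rfl
    exact hl (List.mem_singleton.1 hb ▸ ha)
  · intro a ha
    rcases List.mem_append.1 ha with ha | ha
    · exact h2 a ha
    · rwa [List.mem_singleton.1 ha]

/-- The certificate lists `l` row by row: in row `t` only the bit in column `l[t]` is set. All bits
behind the first `n * n` are irrelevant, so any sufficient length `L` can be attained. -/
theorem exists_visit_eq {cond : List ℕ → ℕ → Prop} {n L : ℕ} (hL : n * n ≤ L) {l : List ℕ}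
    (hl : l.length = n) (hd : l.Nodup) (hlt : ∀ v ∈ l, v < n)
    (hc : ∀ k (h : k < l.length), cond (l.take k) l[k]) :
    ∃ y : List Bool, y.length = L ∧ visit cond n y (n * n) = l := by
  refine ⟨(List.range L).map fun k => decide (l[k / n]? = some (k % n)), by simp, ?_⟩
  set y := (List.range L).map fun k => decide (l[k / n]? = some (k % n)) with hy
  have hyk : ∀ t u, t < n → u < n → (y[n * t + u]? = some true ↔ l[t]? = some u) := by
    intro t u ht hu
    have h1 : n * t + u < L := by nlinarith
    have h2 : (n * t + u) / n = t := by
      rw [Nat.mul_add_div (by omega), Nat.div_eq_of_lt hu, Nat.add_zero]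
    have h3 : (n * t + u) % n = u := by
      rw [Nat.mul_add_mod, Nat.mod_eq_of_lt hu]
    simp [hy, List.getElem?_map, List.getElem?_range h1, h2, h3]
  have key : ∀ t ≤ n, visit cond n y (n * t) = l.take t := by
    intro t
    induction t with
    | zero => intro _; simp [visit]
    | succ t ih =>
      intro ht
      have htl : t < l.length := by omega
      -- Inside row `t` the list grows exactly once, when column `l[t]` is passed.
      have inner : ∀ u ≤ n, visit cond n y (n * t + u) =
          if l[t] < u then l.take (t + 1) else l.take t := by
        intro u
        induction u with
        | zero => intro _; simpa using ih (by omega)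
        | succ u ihu =>
          intro hu
          have h3 : (n * t + u) % n = u := by
            rw [Nat.mul_add_mod, Nat.mod_eq_of_lt (by omega)]
          have hyk' := hyk t u (by omega) (by omega)
          rw [List.getElem?_eq_getElem htl, Option.some_inj] at hyk'
          rw [← Nat.add_assoc, visit, ihu (by omega), h3]
          rcases lt_trichotomy l[t] u with h | h | h
          · rw [if_neg (fun h' => absurd (hyk'.1 h'.1) h.ne), if_pos h, if_pos (by omega)]
          -- Since `l` has no repetitions, `l[t]` does not occur before position `t`, so the
          -- proposal is not ignored.
          · have hmem : u ∉ l.take t := by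
              intro hm
              obtain ⟨k, hk, hk'⟩ := List.getElem_of_mem hm
              rw [List.length_take] at hk
              rw [List.getElem_take, ← h] at hk'
              have := (List.Nodup.getElem_inj_iff hd).1 hk'
              omega
            rw [if_neg (show ¬ l[t] < u by omega)]
            rw [if_pos ⟨hyk'.2 h, hmem, h ▸ hc t htl⟩, if_pos (by omega), List.take_add_one,
              List.getElem?_eq_getElem htl, h, Option.toList_some]
          · rw [if_neg (fun h' => absurd (hyk'.1 h'.1) h.ne'), if_neg (by omega), if_neg (by omega)]
      rw [Nat.mul_succ, inner n le_rfl, if_pos (hlt _ (List.getElem_mem _))]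
  rw [key n le_rfl, ← hl, List.take_length]

namespace Cmd

/-- Go through `n` times `n` bits of the certificate and run `body` for each proposed vertex that
has not been visited. -/
def scan (body : Cmd) : Cmd :=
  loop rT rN (loop rU rN (seq (cert rG) (ite (.le rG zero) nop (ite (.mem rU) nop body))))

/-- The `k`-bit tape must hold the characteristic function of the visited list, as `hmem` says. The
two cases `hpos` and `hneg` then follow the recursion of `visit`. The invariant must not depend on
the certificate or on the registers that the scan itself uses. -/
theorem scan_rule {x y : List Bool} {n : ℕ} {cond : List ℕ → ℕ → Prop} {body : Cmd}
    (Inv : List ℕ → Store → Prop) (hw : ∀ i ∈ [rT, rU, rN, zero], i ∉ body.writes)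
    (hkc : body.keepsCert)
    (hassign : ∀ l s i v, i ∈ [rT, rU, rG] → Inv l s → Inv l (s.assign i v))
    (hcert : ∀ l s c, Inv l s → Inv l { s with cert := c })
    (hmem : ∀ l s v, Inv l s → (s.mem v = true ↔ v ∈ l))
    (hpos : ∀ l s v, v < n → s.reg rU = v → s.reg rN = n → s.reg zero = 0 → v ∉ l → cond l v →
      Inv l s → Inv (l ++ [v]) (body.denote x s))
    (hneg : ∀ l s v, v < n → s.reg rU = v → s.reg rN = n → s.reg zero = 0 → v ∉ l → ¬ cond l v →
      Inv l s → Inv l (body.denote x s))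
    {s : Store} (hN : s.reg rN = n) (hz : s.reg zero = 0) (hnx : n ≤ x.length) (hy : s.cert = y)
    (h0 : Inv [] s) : Inv (visit cond n y (n * n)) ((scan body).denote x s) := by
  set inner : Cmd := seq (cert rG) (ite (.le rG zero) nop (ite (.mem rU) nop body)) with hinner
  have hiw : ∀ i ∈ [rT, rU, rN, zero], i ∉ inner.writes := by
    intro i hi
    have h1 := hw i hi
    have h2 : i ≠ rG := by
      rintro rfl
      revert hi
      decide
    simp [hinner, writes, h1, h2]
  have hlw : ∀ i ∈ [rT, rN, zero], i ∉ (loop rU rN inner).writes := by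
    intro i hi
    have h1 := hiw i (by simp only [List.mem_cons, List.not_mem_nil, or_false] at hi ⊢; tauto)
    have h2 : i ≠ rU := by
      rintro rfl
      revert hi
      decide
    simp [writes, h1, h2]
  -- After `t` rounds exactly `n * t` certificate bits have been consumed. The remaining word is
  -- part of the invariant because the certificate can be read only once.
  have outer := loop_rule (x := x) (a := rT) (b := rN) (p := loop rU rN inner) (s := s)
    (fun t s' => Inv (visit cond n y (n * t)) s' ∧ s'.cert = y.drop (n * t))
    (hlw _ (by simp))
    (fun k s' v h => ⟨hassign _ _ _ _ (by simp) h.1, h.2⟩)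
    (by simpa [visit, hy] using h0)
    (fun t s' _ _ _ hs1 hI => by
      have hN' : s'.reg rN = n := by rw [hs1 rN (by decide) (hlw _ (by simp)), hN]
      have hz' : s'.reg zero = 0 := by rw [hs1 zero (by decide) (hlw _ (by simp)), hz]
      have := loop_rule (x := x) (a := rU) (b := rN) (p := inner) (s := s')
        (fun u s'' => Inv (visit cond n y (n * t + u)) s'' ∧ s''.cert = y.drop (n * t + u))
        (hiw _ (by simp))
        (fun k s' v h => ⟨hassign _ _ _ _ (by simp) h.1, h.2⟩) hI
        (fun u s'' hu _ hru hs2 ⟨hI2, hc2⟩ => by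
          have hN2 : s''.reg rN = n := by rw [hs2 rN (by decide) (hiw _ (by simp)), hN']
          have hz2 : s''.reg zero = 0 := by rw [hs2 zero (by decide) (hiw _ (by simp)), hz']
          rw [hN'] at hu
          have hmod : (n * t + u) % n = u := by rw [Nat.mul_add_mod, Nat.mod_eq_of_lt hu]
          have hhead : s''.cert.head? = y[n * t + u]? := by rw [hc2, List.head?_drop]
          have htail : s''.cert.tail = y.drop (n * t + (u + 1)) := by
            rw [hc2, List.tail_drop, Nat.add_assoc]
          set s3 : Store := (cert rG).denote x s'' with hs3
          have e3 : s3 = { s''.assign rG (s''.cert.head? == some true).toNat with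
            cert := s''.cert.tail } := rfl
          have hI3 : Inv (visit cond n y (n * t + u)) s3 := by
            rw [e3]
            exact hcert _ _ _ (hassign _ _ _ _ (by simp) hI2)
          have hc3 : s3.cert = y.drop (n * t + (u + 1)) := htail
          have hr3 : ∀ i, i ≠ rG → s3.reg i = s''.reg i := fun i hi =>
            denote_reg x (cert rG) _ (by simpa [writes] using hi)
          have hg3 : s3.reg rG = (y[n * t + u]? == some true).toNat := by
            rw [← hhead]
            exact Store.assign_reg_self s'' rG _
          have hz3 : s3.reg zero = 0 := by rw [hr3 _ (by decide), hz2]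
          have hN3 : s3.reg rN = n := by rw [hr3 _ (by decide), hN2]
          have hU3 : s3.reg rU = u := by rw [hr3 _ (by decide), hru]
          rw [hinner, denote_seq, ← hs3, denote_ite, denote_ite]
          simp only [Test.eval, hz3, hg3, hU3, denote_nop]
          refine ⟨?_, ?_⟩
          · rw [← Nat.add_assoc, visit, hmod]
            by_cases hb : y[n * t + u]? = some true
            · have hd : decide ((y[n * t + u]? == some true).toNat ≤ 0) = false := by simp [hb]
              simp only [hd, Bool.false_eq_true, if_false]
              by_cases hm : u ∈ visit cond n y (n * t + u)
              · rw [if_pos ((hmem _ _ _ hI3).2 hm), if_neg (fun h => h.2.1 hm)]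
                exact hI3
              · rw [if_neg (fun h => hm ((hmem _ _ _ hI3).1 h))]
                by_cases hcd : cond (visit cond n y (n * t + u)) u
                · rw [if_pos ⟨hb, hm, hcd⟩]
                  exact hpos _ _ _ hu hU3 hN3 hz3 hm hcd hI3
                · rw [if_neg (fun h => hcd h.2.2)]
                  exact hneg _ _ _ hu hU3 hN3 hz3 hm hcd hI3
            · have hd : decide ((y[n * t + u]? == some true).toNat ≤ 0) = true := by simp [hb]
              simp only [hd, if_true]
              rw [if_neg (fun h => hb h.1)]
              exact hI3
          · split_ifs
            · exact hc3
            · exact hc3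
            · rw [denote_cert x hkc, hc3])
      rw [hN', min_eq_left hnx] at this
      exact this)
  rw [hN, min_eq_left hnx] at outer
  exact outer.1

end Cmd

end EPNL

namespace EPNL

theorem getElem?_unaryThen (n k : ℕ) (w : List Bool) : (unaryThen n w)[n + 1 + k]? = w[k]? := by
  rw [← List.getElem?_drop, drop_unaryThen]

theorem eq_unaryThen_drop {x : List Bool} (h : false ∈ x) :
    x = unaryThen (x.takeWhile id).length (x.drop ((x.takeWhile id).length + 1)) := by
  obtain ⟨v, hv⟩ := exists_eq_unaryThen h
  generalize (x.takeWhile id).length = n at hv ⊢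
  rw [hv, drop_unaryThen]

namespace Cmd

/-- Mark the vertex in register `rU` as visited. -/
def visitVertex : Cmd := seq (set rU) (inc rC)

theorem denote_visitVertex (x : List Bool) (s : Store) : visitVertex.denote x s =
    { s.assign rC (s.reg rC + 1) with mem := Function.update s.mem (s.reg rU) true } := rfl

/-! ### Directed Hamiltonicity -/

/-- Decide whether the input is a directed graph. -/
def hamParse : Cmd := seq graphPrefix (guardEnd (inc rV))

/-- Append the vertex in register `rU` to the path. -/
def hamAppend : Cmd := seq visitVertex (copy rP rU)

/-- Append the vertex in register `rU` to the path if possible. -/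
def hamBody : Cmd :=
  ite (.le rC zero) (seq (copy rD rU) hamAppend)
    (seq (pos rP rU) (ite (.inp rR) hamAppend nop))

/-- Close the cycle. -/
def hamClose : Cmd :=
  ite (.le rN rC) (seq (pos rP rD) (ite (.inp rR) (inc rA) nop)) nop

/-- Verify a Hamiltonian cycle. -/
def hamCheck : Cmd := seq (scan hamBody) hamClose

theorem hamParse_reg (x y : List Bool) :
    let s := hamParse.denote x (.initial x y)
    let n := (x.takeWhile id).length
    (s.reg rV ≠ 0 ↔ false ∈ x ∧ n + 1 + n * n = x.length) ∧
      (false ∈ x → s.reg rN = n ∧ s.reg rB = n + 1) := by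
  intro s n
  obtain ⟨hF, h⟩ := graphPrefix_reg x y
  have h0 : ∀ i ∉ graphPrefix.writes, (graphPrefix.denote x (.initial x y)).reg i =
    (Store.initial x y).reg i := fun i hi => denote_reg _ _ _ hi
  have hz : (graphPrefix.denote x (.initial x y)).reg zero = 0 := by
    rw [h0 _ (by decide), Store.initial_reg _ _ (by decide)]
  have hl : (graphPrefix.denote x (.initial x y)).reg len = x.length := by
    rw [h0 _ (by decide), Store.initial_len]
  have hV : (graphPrefix.denote x (.initial x y)).reg rV = 0 := by
    rw [h0 _ (by decide), Store.initial_reg _ _ (by decide)]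
  have hs : s = (guardEnd (inc rV)).denote x (graphPrefix.denote x (.initial x y)) := rfl
  rw [denote_guardEnd _ hz hl] at hs
  simp only [hF] at hs
  refine ⟨?_, fun hf => ?_⟩
  · rw [hs]
    split_ifs with hc
    · rw [denote_inc, Store.assign_reg_self]
      obtain ⟨-, -, h3, -⟩ := h hc.1
      have h4 := hc.2
      rw [h3] at h4
      simp only [ne_eq, Nat.add_eq_zero_iff, one_ne_zero, and_false, not_false_eq_true, true_iff]
      exact ⟨hc.1, h4⟩
    · rw [hV]
      simp only [ne_eq, not_true_eq_false, false_iff]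
      rintro ⟨hf, h4⟩
      obtain ⟨-, -, h3, -⟩ := h hf
      exact hc ⟨hf, h3.trans h4⟩
  · obtain ⟨h1, h2, -, -⟩ := h hf
    have e : ∀ i, i ≠ rV → s.reg i = (graphPrefix.denote x (.initial x y)).reg i := by
      intro i hi
      rw [hs]
      split_ifs
      · rw [denote_inc, Store.assign_reg_of_ne _ _ hi]
      · rfl
    exact ⟨by rw [e _ (by decide), h1], by rw [e _ (by decide), h2]⟩

end Cmd

/-- The store holds the data of the path `l` in a graph with `n` vertices. -/
structure HamInv (n : ℕ) (l : List ℕ) (s : Store) : Prop where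
  lt : ∀ v ∈ l, v < n
  mem : ∀ v, s.mem v = true ↔ v ∈ l
  n_eq : s.reg rN = n
  base : s.reg rB = n + 1
  zero : s.reg zero = 0
  count : s.reg rC = l.length
  first : ∀ a ∈ l.head?, s.reg rD = a
  last : ∀ a ∈ l.getLast?, s.reg rP = a
  acc : s.reg rA = 0

theorem HamInv.congr {n : ℕ} {l : List ℕ} {s s' : Store} (h : HamInv n l s)
    (hm : s'.mem = s.mem) (hr : ∀ i ∈ [rN, rB, EPNL.zero, rC, rD, rP, rA], s'.reg i = s.reg i) :
    HamInv n l s' where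
  lt := h.lt
  mem := by rw [hm]; exact h.mem
  n_eq := by rw [hr _ (by simp)]; exact h.n_eq
  base := by rw [hr _ (by simp)]; exact h.base
  zero := by rw [hr _ (by simp)]; exact h.zero
  count := by rw [hr _ (by simp)]; exact h.count
  first := by rw [hr _ (by simp)]; exact h.first
  last := by rw [hr _ (by simp)]; exact h.last
  acc := by rw [hr _ (by simp)]; exact h.acc

theorem HamInv.append {x : List Bool} {n v : ℕ} {l : List ℕ} {s : Store} (h : HamInv n l s)
    (hv : v < n) (hnx : n ≤ x.length) (hu : s.reg rU = v)
    (hf : ∀ a ∈ (l ++ [v]).head?, s.reg rD = a) :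
    HamInv n (l ++ [v]) (Cmd.hamAppend.denote x s) := by
  have e : Cmd.hamAppend.denote x s = (Cmd.copy rP rU).denote x (Cmd.visitVertex.denote x s) := rfl
  have hr : ∀ i ∉ Cmd.hamAppend.writes, (Cmd.hamAppend.denote x s).reg i = s.reg i :=
    fun i hi => Cmd.denote_reg _ _ _ hi
  have hu' : (Cmd.visitVertex.denote x s).reg rU = v := by
    rw [Cmd.denote_reg _ _ _ (by decide), hu]
  refine ⟨?_, ?_, ?_, ?_, ?_, ?_, ?_, ?_, ?_⟩
  · intro a ha
    rcases List.mem_append.1 ha with ha | ha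
    · exact h.lt a ha
    · rwa [List.mem_singleton.1 ha]
  · intro a
    rw [e, Cmd.denote_mem _ (by decide), Cmd.denote_visitVertex]
    simp only [hu, Function.update_apply, List.mem_append, List.mem_singleton]
    split_ifs with hav
    · simp [hav]
    · simp [hav, h.mem a]
  · rw [hr _ (by decide), h.n_eq]
  · rw [hr _ (by decide), h.base]
  · rw [hr _ (by decide), h.zero]
  · rw [e, Cmd.denote_reg _ _ _ (by decide), Cmd.denote_visitVertex]
    simp [h.count]
  · rw [hr _ (by decide)]
    exact hf
  · rw [e, Cmd.copy_reg (by decide) (by decide) (by rw [hu']; omega), hu']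
    simp
  · rw [hr _ (by decide), h.acc]

/-- The entry of the adjacency matrix in an encoded graph with `n` vertices. -/
def entry (x : List Bool) (n i j : ℕ) : Prop := x[n + 1 + (n * i + j)]? = some true

/-- A vertex is appended if it is a successor of the last vertex of the path, a condition that is
vacuous for the empty path. Then the path is tested for completeness and for an arc from its last to
its first vertex. -/
theorem Cmd.hamCheck_spec {x y : List Bool} {n : ℕ} {s : Store} (hs : s.Start x y)
    (hN : s.reg rN = n) (hB : s.reg rB = n + 1) (hx : x.length = n + 1 + n * n) :
    (hamCheck.denote x s).reg rA ≠ 0 ↔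
      ∃ l, l = visit (fun l v => ∀ a ∈ l.getLast?, entry x n a v) n y (n * n) ∧ n ≤ l.length ∧
        ∃ a ∈ l.getLast?, ∃ b ∈ l.head?, entry x n a b := by
  have hnx : n + 1 ≤ x.length := by omega
  have h0 : HamInv n [] s :=
    ⟨by simp, by simp [hs.mem], hN, hB, hs.reg _ (by simp), by simp [hs.reg rC (by simp)], by simp,
      by simp, hs.reg _ (by simp)⟩
  have hscan := scan_rule (x := x) (y := y) (n := n) (body := hamBody)
    (cond := fun l v => ∀ a ∈ l.getLast?, entry x n a v) (HamInv n) (by decide) (by decide)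
    (fun l s i v hi h => h.congr rfl (fun j hj => Store.assign_reg_of_ne _ _ (by
      rintro rfl
      revert hi hj
      revert j
      decide)))
    (fun l s c h => h.congr rfl (fun _ _ => rfl)) (fun l s v h => h.mem v)
    (by
      intro l s v hv hu _ hz hvl hc h
      rw [hamBody, denote_ite]
      simp only [Test.eval, hz, Nat.le_zero, h.count, List.length_eq_zero_iff, decide_eq_true_eq]
      split_ifs with hl
      · subst hl
        have hr : ∀ i ∉ (copy rD rU).writes, ((copy rD rU).denote x s).reg i = s.reg i :=
          fun i hi => denote_reg _ _ _ hi
        have hm : ((copy rD rU).denote x s).mem = s.mem := denote_mem _ (by decide) _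
        rw [denote_seq]
        refine HamInv.append ?_ hv (by omega) (by rw [hr _ (by decide), hu]) ?_
        · refine ⟨by simp, by rw [hm]; exact h.mem, ?_, ?_, ?_, ?_, by simp, by simp, ?_⟩
          · rw [hr _ (by decide), h.n_eq]
          · rw [hr _ (by decide), h.base]
          · rw [hr _ (by decide), h.zero]
          · rw [hr _ (by decide), h.count]
          · rw [hr _ (by decide), h.acc]
        · rw [copy_reg (by decide) (by decide) (by omega), hu]
          simp
      · obtain ⟨a, ha⟩ : ∃ a, l.getLast? = some a := by
          rw [← Option.isSome_iff_exists]
          simpa using hl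
        have hP := h.last a ha
        have han : a < n := h.lt a (List.mem_of_getLast? ha)
        have hp := pos_reg (x := x) (s := s) (i := rP) (j := rU) (by decide) (by decide)
          (by rw [h.base]; exact hnx) (by rw [h.n_eq]; omega) (by omega) (by omega)
        rw [h.base, h.n_eq, hP, hu] at hp
        have hpf : ∀ i ∉ [rR, rX, rY], ((pos rP rU).denote x s).reg i = s.reg i :=
          fun i hi => pos_frame hi
        have hpm : ((pos rP rU).denote x s).mem = s.mem := denote_mem _ (by decide) _
        rw [denote_seq, denote_ite]
        simp only [Test.eval, hp]
        have hent := hc a ha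
        rw [entry, ← Nat.add_assoc] at hent
        rw [hent, if_pos (by simp)]
        refine HamInv.append (h.congr hpm (fun i hi => hpf i ?_)) hv (by omega)
          (by rw [hpf _ (by decide), hu]) ?_
        · revert i
          decide
        · rw [hpf _ (by decide)]
          cases l with
          | nil => exact absurd rfl hl
          | cons c l => simpa using h.first)
    (by
      intro l s v hv hu _ hz hvl hc h
      rw [hamBody, denote_ite]
      -- On the empty list the condition holds vacuously, so a failure provides a last vertex.
      have hl : l ≠ [] := by
        rintro rfl
        exact hc (by simp)
      simp only [Test.eval, hz, Nat.le_zero, h.count, List.length_eq_zero_iff, decide_eq_true_eq,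
        hl, if_false]
      push Not at hc
      obtain ⟨a, ha, hent⟩ := hc
      have hP := h.last a ha
      have han : a < n := h.lt a (List.mem_of_getLast? ha)
      have hp := pos_reg (x := x) (s := s) (i := rP) (j := rU) (by decide) (by decide)
        (by rw [h.base]; exact hnx) (by rw [h.n_eq]; omega) (by omega) (by omega)
      rw [h.base, h.n_eq, hP, hu] at hp
      have hpf : ∀ i ∉ [rR, rX, rY], ((pos rP rU).denote x s).reg i = s.reg i :=
        fun i hi => pos_frame hi
      have hpm : ((pos rP rU).denote x s).mem = s.mem := denote_mem _ (by decide) _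
      rw [denote_seq, denote_ite]
      simp only [Test.eval, hp]
      rw [entry, ← Nat.add_assoc] at hent
      rw [if_neg (by simpa using hent), denote_nop]
      refine h.congr hpm (fun i hi => hpf i ?_)
      revert i
      decide)
    hN (hs.reg _ (by simp)) (by omega) hs.cert h0
  rw [hamCheck, denote_seq]
  generalize (scan hamBody).denote x s = s' at hscan ⊢
  generalize hl : visit (fun l v => ∀ a ∈ l.getLast?, entry x n a v) n y (n * n) = l at hscan
  have hex : ∀ p : List ℕ → Prop, (∃ m, m = l ∧ p m) ↔ p l := fun p =>
    ⟨fun ⟨_, h1, h2⟩ => h1 ▸ h2, fun h => ⟨l, rfl, h⟩⟩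
  rw [hex, hamClose, denote_ite]
  simp only [Test.eval, hscan.n_eq, hscan.count, decide_eq_true_eq]
  split_ifs with hc
  · simp only [hc, true_and]
    rw [denote_seq, denote_ite]
    have hpf : ∀ i ∉ [rR, rX, rY], ((pos rP rD).denote x s').reg i = s'.reg i :=
      fun i hi => pos_frame hi
    have hA : ((pos rP rD).denote x s').reg rA = 0 := by rw [hpf _ (by decide), hscan.acc]
    cases hlast : l.getLast? with
    | none =>
      have hl0 : l = [] := by simpa using hlast
      have hn0 : n = 0 := by simpa [hl0] using hc
      subst hn0
      simp only [Option.mem_def, reduceCtorEq, false_and, exists_false, iff_false]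
      -- The graph without vertices must be rejected, as the empty cycle does not count. Here the
      -- input has length `1` and the computed position is at least `rB = 1`, so the test reads
      -- behind the input. The invariant says nothing about `rP` and `rD` in this case, and only
      -- this lower bound is used.
      have hq : x[((pos rP rD).denote x s').reg rR]? ≠ some true := by
        intro hq
        have hlt := (List.getElem?_eq_some_iff.1 hq).1
        have hge : 1 ≤ ((pos rP rD).denote x s').reg rR := by
          have h1 : ((copy rR rB).denote x s').reg rR = 1 := by
            rw [copy_reg (by decide) (by decide) (by rw [hscan.base]; omega), hscan.base]
          rw [pos, denote_seq, denote_seq]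
          have h2 := loop_rule (x := x) (a := rY) (b := rP) (p := add rR rN)
            (s := (copy rR rB).denote x s') (fun _ s => s.reg rR = 1 ∧ s.reg rN = 0) (by decide)
            (fun k s v h => by
              rw [Store.assign_reg_of_ne _ _ (by decide), Store.assign_reg_of_ne _ _ (by decide)]
              exact h)
            ⟨h1, by rw [denote_reg _ _ _ (by decide), hscan.n_eq]⟩
            (fun k s _ _ _ _ h => ⟨by
              rw [add_reg (by decide) (by rw [h.2]; omega), h.1, h.2], by
              rw [denote_reg _ _ _ (by decide), h.2]⟩)
          exact loop_rule (x := x) (a := rX) (b := rD) (p := inc rR) (fun _ s => 1 ≤ s.reg rR)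
            (by decide)
            (fun k s v h => by rw [Store.assign_reg_of_ne _ _ (by decide)]; exact h) h2.1.ge
            (fun k s _ _ _ _ h => by rw [denote_inc, Store.assign_reg_self]; omega)
        omega
      have hq' : ¬ Test.eval x ((pos rP rD).denote x s') (.inp rR) = true := by
        simpa [Test.eval] using hq
      rw [if_neg hq', denote_nop, hA]
      simp
    | some a =>
      cases hhead : l.head? with
      | none =>
        have hl0 : l = [] := by simpa using hhead
        simp [hl0] at hlast
      | some b =>
        have hP := hscan.last a hlast
        have hD := hscan.first b hhead
        have han : a < n := hscan.lt a (List.mem_of_getLast? hlast)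
        have hbn : b < n := hscan.lt b (List.mem_of_head? hhead)
        have hp := pos_reg (x := x) (s := s') (i := rP) (j := rD) (by decide) (by decide)
          (by rw [hscan.base]; exact hnx) (by rw [hscan.n_eq]; omega) (by omega) (by omega)
        rw [hscan.base, hscan.n_eq, hP, hD] at hp
        simp only [Test.eval, hp, Option.mem_def, Option.some_inj, exists_eq_left', entry]
        rw [← Nat.add_assoc]
        split_ifs with hq
        · rw [denote_inc, Store.assign_reg_self]
          simpa using hq
        · rw [denote_nop, hA]
          simpa using hq
  · simp [denote_nop, hscan.acc, hc]

theorem DigraphInstance.entry_encode (I : DigraphInstance) (i j : Fin I.n) :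
    entry (DigraphInstance.encode I) I.n i j ↔ I.graph.Adj i j := by
  change (unaryThen I.n (matrixBits I.graph.Adj))[_]? = _ ↔ _
  rw [getElem?_unaryThen, ← getElem?_matrixBits I.graph.Adj i j [], List.append_nil]

theorem exists_map_val_eq {n : ℕ} {l : List ℕ} (h : ∀ v ∈ l, v < n) :
    ∃ m : List (Fin n), m.map Fin.val = l := by
  refine ⟨l.pmap Fin.mk h, ?_⟩
  rw [List.map_pmap]
  simp

/-- Pigeonhole: at least `n` distinct numbers below `n` are all of them. -/
theorem length_eq_of_nodup_of_lt {n : ℕ} {l : List ℕ} (hd : l.Nodup) (h : ∀ v ∈ l, v < n)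
    (hn : n ≤ l.length) : l.length = n ∧ ∀ v < n, v ∈ l := by
  have hsub : l.toFinset ⊆ Finset.range n := fun v hv => by
    simpa using h v (List.mem_toFinset.1 hv)
  have hcard : l.toFinset.card = l.length := List.toFinset_card_of_nodup hd
  have hle := Finset.card_le_card hsub
  rw [Finset.card_range, hcard] at hle
  have heq := Finset.eq_of_subset_of_card_le hsub (by rw [Finset.card_range, hcard]; exact hn)
  exact ⟨le_antisymm hle hn, fun v hv => by
    have : v ∈ Finset.range n := Finset.mem_range.2 hv
    rwa [← heq, List.mem_toFinset] at this⟩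

/-- Cutting the cycle open at any vertex gives a path through all vertices with a closing arc. For a
single vertex the closing arc is a loop. -/
theorem DigraphInstance.hamiltonian_iff (I : DigraphInstance) :
    I.Hamiltonian ↔ ∃ l : List ℕ, l.Nodup ∧ (∀ v ∈ l, v < I.n) ∧ I.n ≤ l.length ∧
      l.IsChain (entry (DigraphInstance.encode I) I.n) ∧
      ∃ a ∈ l.getLast?, ∃ b ∈ l.head?, entry (DigraphInstance.encode I) I.n a b := by
  constructor
  · rintro ⟨c, hc, hd, hm, hch⟩
    induction c using Quotient.inductionOn' with
    | h m =>
    cases m with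
    | nil => exact absurd rfl hc
    | cons a m =>
      have hd' : (a :: m).Nodup := hd
      have hm' : ∀ v, v ∈ a :: m := hm
      -- By definition a cycle is a chain if the list, closed up by its first element, is one.
      have hch' : List.IsChain I.graph.Adj ((a :: m) ++ [a]) := hch
      rw [List.isChain_append] at hch'
      obtain ⟨h1, -, h3⟩ := hch'
      refine ⟨(a :: m).map Fin.val, hd'.map Fin.val_injective, ?_, ?_, ?_, ?_⟩
      · intro v hv
        obtain ⟨w, -, rfl⟩ := List.mem_map.1 hv
        exact w.isLt
      · rw [List.length_map, ← List.toFinset_card_of_nodup hd']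
        have : (a :: m).toFinset = Finset.univ := by
          ext v
          simpa using hm' v
        rw [this, Finset.card_univ, Fintype.card_fin]
      · rw [List.isChain_map]
        exact h1.imp fun i j h => (I.entry_encode i j).2 h
      · obtain ⟨b, hb⟩ : ∃ b, (a :: m).getLast? = some b := by
          rw [← Option.isSome_iff_exists]
          simp
        refine ⟨b, ?_, a, ?_, (I.entry_encode b a).2 (h3 b hb a (by simp))⟩
        · rw [List.getLast?_map, hb]
          rfl
        · simp
  · rintro ⟨l, hd, hlt, hn, hch, a, ha, b, hb, hab⟩
    have hall := (length_eq_of_nodup_of_lt hd hlt hn).2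
    obtain ⟨m, rfl⟩ := exists_map_val_eq hlt
    cases m with
    | nil => simp at ha
    | cons c m =>
      rw [List.isChain_map] at hch
      refine ⟨((c :: m : List (Fin I.n)) : Cycle (Fin I.n)), ?_, ?_, ?_, ?_⟩
      · exact Cycle.coe_nil ▸ fun h => by simp at h
      · exact hd.of_map _
      · intro v
        obtain ⟨w, hw, hwv⟩ := List.mem_map.1 (hall v v.isLt)
        rw [← Fin.val_injective hwv]
        exact hw
      · rw [Cycle.chain_coe_cons, ← List.cons_append, List.isChain_append]
        refine ⟨hch.imp fun i j h => (I.entry_encode i j).1 h, by simp, ?_⟩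
        intro d hd' e he
        obtain rfl : c = e := by simpa using he
        obtain rfl : ↑c = b := by simpa using hb
        rw [List.getLast?_map, hd'] at ha
        obtain rfl : ↑d = a := by simpa using ha
        exact (I.entry_encode d c).1 hab

theorem directedHamiltonicity_inEPNL : InEPNL directedHamiltonicity := by
  have hstart : ∀ x y, (Cmd.hamParse.denote x (.initial x y)).Start x y := fun x y =>
    Cmd.start_denote (by decide) (by decide) (by decide) (by decide)
  have henc : ∀ I : DigraphInstance, DigraphInstance.encode I =
    unaryThen I.n (matrixBits I.graph.Adj) := fun I => rfl
  have hn : ∀ I : DigraphInstance, ((DigraphInstance.encode I).takeWhile id).length = I.n :=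
    fun I => by rw [henc, takeWhile_unaryThen]
  have hlen : ∀ I : DigraphInstance, (DigraphInstance.encode I).length =
    I.n + 1 + I.n * I.n := fun I => by rw [henc, length_unaryThen, matrixBits_length]
  have hreg : ∀ (I : DigraphInstance) (y : List Bool),
      let s := Cmd.hamParse.denote (DigraphInstance.encode I)
        (.initial (DigraphInstance.encode I) y)
      s.reg rV ≠ 0 ∧ s.reg rN = I.n ∧ s.reg rB = I.n + 1 := by
    intro I y
    obtain ⟨h1, h2⟩ := Cmd.hamParse_reg (DigraphInstance.encode I) y
    rw [hn I] at h1 h2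
    have hf : false ∈ DigraphInstance.encode I := by
      rw [henc]
      exact false_mem_unaryThen _ _
    exact ⟨h1.2 ⟨hf, (hlen I).symm⟩, h2 hf⟩
  refine inEPNL_ofEncoding _ _ _ Cmd.hamParse Cmd.hamCheck rV rA rN (by decide) (by decide)
    (fun x y hv => ?_) (fun I y => ⟨(hreg I y).1, (hreg I y).2.1⟩) (fun I => ?_)
  · obtain ⟨hf, hx⟩ := (Cmd.hamParse_reg x y).1.1 hv
    have hu := eq_unaryThen_drop hf
    generalize (x.takeWhile id).length = n at hu hx
    have hm := eq_matrixBits_append (m := n) (n := n) (w := x.drop (n + 1))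
      (by rw [List.length_drop]; omega)
    have he : x.drop (n + 1 + n * n) = [] := List.drop_of_length_le (by omega)
    rw [List.drop_drop, he, List.append_nil] at hm
    exact ⟨⟨n, ⟨fun i j => (x.drop (n + 1))[n * (i : ℕ) + j]? = some true⟩⟩,
      (hu.trans (congrArg (unaryThen n) hm)).symm⟩
  · have hspec := fun y => Cmd.hamCheck_spec (hstart (DigraphInstance.encode I) y) (hreg I y).2.1
      (hreg I y).2.2 (hlen I)
    rw [I.hamiltonian_iff]
    simp only [hspec]
    constructor
    · rintro ⟨l, hd, hlt, hnl, hch, hab⟩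
      obtain ⟨y, hy, hv⟩ := exists_visit_eq (L := (DigraphInstance.encode I).length)
        (cond := fun l v => ∀ a ∈ l.getLast?, entry (DigraphInstance.encode I) I.n a v)
        (by rw [hlen]; omega) (length_eq_of_nodup_of_lt hd hlt hnl).1 hd hlt
        (fun k hk a ha => by
          have h1 := hch.take (k + 1)
          rw [List.take_add_one, List.getElem?_eq_getElem hk, Option.toList_some,
            List.isChain_append] at h1
          exact h1.2.2 a ha _ (by simp))
      exact ⟨y, hy, l, hv.symm, hnl, hab⟩
    · rintro ⟨y, -, l, rfl, hnl, hab⟩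
      obtain ⟨hd, hlt⟩ := visit_props
        (cond := fun l v => ∀ a ∈ l.getLast?, entry (DigraphInstance.encode I) I.n a v)
        (n := I.n) (y := y) le_rfl
      refine ⟨_, hd, hlt, hnl, ?_, hab⟩
      refine visit_induction (fun l => l.IsChain _) (by simp) ?_ le_rfl
      rintro l v - - hc hl
      rw [List.isChain_append]
      refine ⟨hl, by simp, fun a ha b hb => ?_⟩
      obtain rfl : v = b := by simpa using hb
      exact hc a ha

end EPNL

namespace EPNL

/-! ### Inputs that describe a graph and a bound -/

/-- The input consists of a number in unary, a square matrix and a number in binary. -/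
def IsBoundedGraph (x : List Bool) : Prop :=
  false ∈ x ∧ (x.takeWhile id).length + 1 + (x.takeWhile id).length * (x.takeWhile id).length ≤
    x.length ∧ ((x.takeWhile id).length + 1 +
      (x.takeWhile id).length * (x.takeWhile id).length = x.length ∨ x.getLast? = some true)

theorem IsBoundedGraph.exists_eq {x : List Bool} (h : IsBoundedGraph x) :
    ∃ (A : Fin (x.takeWhile id).length → Fin (x.takeWhile id).length → Prop) (b : ℕ),
      x = unaryThen (x.takeWhile id).length (matrixBits A ++ Nat.bits b) := by
  obtain ⟨hf, hle, hb⟩ := h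
  obtain ⟨A, b, hA⟩ := exists_matrixBits_bits hle hb
  exact ⟨A, b, by rw [← hA]; exact eq_unaryThen_drop hf⟩

theorem getLast?_append_bits (w : List Bool) (b : ℕ) :
    Nat.bits b = [] ∨ (w ++ Nat.bits b).getLast? = some true := by
  rcases bits_eq_nil_or b with h | h
  · exact .inl h
  · right
    rw [List.getLast?_append, h]
    rfl

theorem isBoundedGraph_unaryThen {n : ℕ} (A : Fin n → Fin n → Prop) (b : ℕ) :
    IsBoundedGraph (unaryThen n (matrixBits A ++ Nat.bits b)) := by
  refine ⟨false_mem_unaryThen _ _, ?_, ?_⟩ <;>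
    rw [takeWhile_unaryThen, length_unaryThen, List.length_append, matrixBits_length]
  · omega
  · have e : unaryThen n (matrixBits A ++ Nat.bits b) =
        (List.replicate n true ++ false :: matrixBits A) ++ Nat.bits b := by
      simp [unaryThen]
    rcases getLast?_append_bits (List.replicate n true ++ false :: matrixBits A) b with h | h
    · left
      simp [h]
    · right
      rw [e, h]

theorem entry_unaryThen {n : ℕ} (A : Fin n → Fin n → Prop) (w : List Bool) (i j : Fin n) :
    entry (unaryThen n (matrixBits A ++ w)) n i j ↔ A i j := by
  rw [entry, getElem?_unaryThen, getElem?_matrixBits]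

theorem drop_matrix_unaryThen {n : ℕ} (A : Fin n → Fin n → Prop) (w : List Bool) :
    (unaryThen n (matrixBits A ++ w)).drop (n + 1 + n * n) = w := by
  rw [← List.drop_drop, drop_unaryThen, ← matrixBits_length A, List.drop_left]

/-- The situation after parsing a graph and a bound. -/
structure Store.Parsed (x : List Bool) (s : Store) : Prop where
  n_eq : s.reg rN = (x.takeWhile id).length
  base : s.reg rB = (x.takeWhile id).length + 1
  bound : s.reg rQ = (x.takeWhile id).length + 1 +
    (x.takeWhile id).length * (x.takeWhile id).length
  flag : s.reg rF' = 0
  valid : s.reg rV = 0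
  zero : s.reg zero = 0

namespace Cmd

/-- Parse a graph and a bound, then run `c`. -/
def graphParse (c : Cmd) : Cmd := seq graphPrefix (guard (seq (copy rQ rR) c))

/-- The remaining validation `c` runs only on words of the right shape. It is trivial for digraphs
and checks symmetry for simple graphs. -/
theorem graphParse_reg (x y : List Bool) (c : Cmd) :
    (¬ IsBoundedGraph x → ((graphParse c).denote x (.initial x y)).reg rV = 0) ∧
    (IsBoundedGraph x →
      ∃ s, (graphParse c).denote x (.initial x y) = c.denote x s ∧ s.Parsed x) := by
  obtain ⟨hF, h⟩ := graphPrefix_reg x y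
  have h0 : ∀ i ∉ graphPrefix.writes, (graphPrefix.denote x (.initial x y)).reg i =
    (Store.initial x y).reg i := fun i hi => denote_reg _ _ _ hi
  have hz : (graphPrefix.denote x (.initial x y)).reg zero = 0 := by
    rw [h0 _ (by decide), Store.initial_reg _ _ (by decide)]
  have hl : (graphPrefix.denote x (.initial x y)).reg len = x.length := by
    rw [h0 _ (by decide), Store.initial_len]
  have hV : (graphPrefix.denote x (.initial x y)).reg rV = 0 := by
    rw [h0 _ (by decide), Store.initial_reg _ _ (by decide)]
  have hF' : (graphPrefix.denote x (.initial x y)).reg rF' = 0 := by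
    rw [h0 _ (by decide), Store.initial_reg _ _ (by decide)]
  rw [graphParse, denote_seq, denote_guard _ hz hl]
  generalize graphPrefix.denote x (.initial x y) = s at *
  have hcond : (s.reg rF ≠ 0 ∧ s.reg rR ≤ x.length ∧ (s.reg rR = x.length ∨ s.reg rL ≠ 0)) ↔
      IsBoundedGraph x := by
    rw [hF, IsBoundedGraph]
    refine and_congr_right fun hf => ?_
    obtain ⟨-, -, h3, h4⟩ := h hf
    rw [h3, h4]
  refine ⟨fun hb => by rw [if_neg (fun h => hb (hcond.1 h)), hV], fun hb => ?_⟩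
  rw [if_pos (hcond.2 hb)]
  obtain ⟨h1, h2, h3, -⟩ := h hb.1
  have hc : ∀ i ∉ (copy rQ rR).writes, ((copy rQ rR).denote x s).reg i = s.reg i :=
    fun i hi => denote_reg _ _ _ hi
  refine ⟨(copy rQ rR).denote x s, rfl, ?_, ?_, ?_, ?_, ?_, ?_⟩
  · rw [hc _ (by decide), h1]
  · rw [hc _ (by decide), h2]
  · rw [copy_reg (by decide) (by decide) (by rw [h3]; exact hb.2.1), h3]
  · rw [hc _ (by decide), hF']
  · rw [hc _ (by decide), hV]
  · rw [hc _ (by decide), hz]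

end Cmd

/-! ### Linear orders of bounded cost -/

/-- The sum of `f` over the nonempty prefixes of a list. -/
def prefixSum (f : List ℕ → ℕ) (l : List ℕ) : ℕ :=
  ∑ k ∈ Finset.range l.length, f (l.take (k + 1))

theorem prefixSum_append (f : List ℕ → ℕ) (l : List ℕ) (v : ℕ) :
    prefixSum f (l ++ [v]) = prefixSum f l + f (l ++ [v]) := by
  rw [prefixSum, List.length_append, List.length_singleton, Finset.sum_range_succ]
  congr 1
  · refine Finset.sum_congr rfl fun k hk => ?_
    rw [List.take_append_of_le_length]
    simpa [Nat.succ_le_iff] using hk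
  · rw [List.take_of_length_le (by simp)]

/-- The store holds the vertices of the list `l`, which begins a linear order of `n` vertices, and
the cost of this list. -/
structure CostInv (f : List ℕ → ℕ) (n : ℕ) (l : List ℕ) (s : Store) : Prop where
  lt : ∀ v ∈ l, v < n
  mem : ∀ v, s.mem v = true ↔ v ∈ l
  n_eq : s.reg rN = n
  base : s.reg rB = n + 1
  zero : s.reg zero = 0
  count : s.reg rC = l.length
  sum : s.reg rS = prefixSum f l
  bound : s.reg rQ = n + 1 + n * n
  acc : s.reg rA = 0

theorem CostInv.congr {f : List ℕ → ℕ} {n : ℕ} {l : List ℕ} {s s' : Store} (h : CostInv f n l s)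
    (hm : s'.mem = s.mem) (hr : ∀ i ∈ [rN, rB, EPNL.zero, rC, rS, rQ, rA], s'.reg i = s.reg i) :
    CostInv f n l s' where
  lt := h.lt
  mem := by rw [hm]; exact h.mem
  n_eq := by rw [hr _ (by simp)]; exact h.n_eq
  base := by rw [hr _ (by simp)]; exact h.base
  zero := by rw [hr _ (by simp)]; exact h.zero
  count := by rw [hr _ (by simp)]; exact h.count
  sum := by rw [hr _ (by simp)]; exact h.sum
  bound := by rw [hr _ (by simp)]; exact h.bound
  acc := by rw [hr _ (by simp)]; exact h.acc

namespace Cmd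

/-- Accept if all vertices have been visited and the cost is at most the bound. -/
def costEnd : Cmd := ite (.le rN rC) (ite (.cmp rS rQ) (inc rA) nop) nop

/-- Verify a linear order of bounded cost; the program `w` adds the cost of a visit. -/
def costCheck (w : Cmd) : Cmd := seq (scan (seq visitVertex w)) costEnd

/-- The program `w` adds the value of `f` at the current list of vertices to register `rS`. -/
def AddsCost (x : List Bool) (n : ℕ) (f : List ℕ → ℕ) (w : Cmd) : Prop :=
  ∀ (s : Store) (l : List ℕ) (v : ℕ), v < n → (∀ u, s.mem u = true ↔ u ∈ l ++ [v]) →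
    s.reg rN = n → s.reg rB = n + 1 → s.reg rU = v →
      (w.denote x s).reg rS = s.reg rS + f (l ++ [v])

/-- Here every new vertex is accepted, and the cost of each prefix is added when the prefix is
completed. This is possible because `AddsCost` lets `w` see only the set of visited vertices and the
latest vertex. -/
theorem costCheck_spec {x y : List Bool} {n : ℕ} {f : List ℕ → ℕ} {w : Cmd} {s : Store}
    (hm : w.keepsMem) (hc : w.keepsCert)
    (hww : ∀ i ∈ [rT, rU, rN, rB, zero, rC, rQ, rA], i ∉ w.writes)
    (hw : AddsCost x n f w) (hs : s.Start x y)
    (hN : s.reg rN = n) (hB : s.reg rB = n + 1) (hQ : s.reg rQ = n + 1 + n * n)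
    (hx : n ≤ x.length) :
    ((costCheck w).denote x s).reg rA ≠ 0 ↔
      ∃ l, l = visit (fun _ _ => True) n y (n * n) ∧ n ≤ l.length ∧
        cmpBits true (prefixSum f l).bits (x.drop (n + 1 + n * n)) = true := by
  have h0 : CostInv f n [] s :=
    ⟨by simp, by simp [hs.mem], hN, hB, hs.reg _ (by simp), by simp [hs.reg rC (by simp)],
      by simp [hs.reg rS (by simp), prefixSum], hQ, hs.reg _ (by simp)⟩
  have hvw : ∀ i ∈ [rT, rU, rN, zero], i ∉ visitVertex.writes := by decide
  have hscan := scan_rule (x := x) (y := y) (n := n) (body := seq visitVertex w)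
    (cond := fun _ _ => True) (CostInv f n)
    (fun i hi => by
      rw [writes, List.mem_append, not_or]
      refine ⟨hvw i hi, hww i ?_⟩
      simp only [List.mem_cons, List.not_mem_nil, or_false] at hi ⊢
      tauto)
    (by simpa [keepsCert, visitVertex] using hc)
    (fun l s i v hi h => h.congr rfl (fun j hj => Store.assign_reg_of_ne _ _ (by
      rintro rfl
      revert hi hj
      revert j
      decide)))
    (fun l s c h => h.congr rfl (fun _ _ => rfl)) (fun l s v h => h.mem v)
    (by
      intro l s v hv hu _ hz hvl _ h
      have hvr : ∀ i ∉ visitVertex.writes, (visitVertex.denote x s).reg i = s.reg i :=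
        fun i hi => denote_reg _ _ _ hi
      have hmem : ∀ u, (visitVertex.denote x s).mem u = true ↔ u ∈ l ++ [v] := by
        intro u
        rw [denote_visitVertex]
        simp only [hu, Function.update_apply, List.mem_append, List.mem_singleton]
        split_ifs with h1
        · simp [h1]
        · rw [h.mem u]
          simp [h1]
      have hC : (visitVertex.denote x s).reg rC = s.reg rC + 1 := Store.assign_reg_self _ _ _
      have hW := hw (visitVertex.denote x s) l v hv hmem (by rw [hvr _ (by decide), h.n_eq])
        (by rw [hvr _ (by decide), h.base]) (by rw [hvr _ (by decide), hu])
      have hwr : ∀ i ∈ [rT, rU, rN, rB, EPNL.zero, rC, rQ, rA],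
        (w.denote x (visitVertex.denote x s)).reg i = (visitVertex.denote x s).reg i :=
          fun i hi => denote_reg _ _ _ (hww i hi)
      rw [denote_seq]
      refine ⟨?_, ?_, ?_, ?_, ?_, ?_, ?_, ?_, ?_⟩
      · intro u hu
        rcases List.mem_append.1 hu with hu | hu
        · exact h.lt u hu
        · rwa [List.mem_singleton.1 hu]
      · rw [denote_mem _ hm]
        exact hmem
      · rw [hwr _ (by simp), hvr _ (by decide), h.n_eq]
      · rw [hwr _ (by simp), hvr _ (by decide), h.base]
      · rw [hwr _ (by simp), hvr _ (by decide), h.zero]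
      · rw [hwr _ (by simp), hC, h.count, List.length_append, List.length_singleton]
      · rw [hW, hvr _ (by decide), h.sum, prefixSum_append]
      · rw [hwr _ (by simp), hvr _ (by decide), h.bound]
      · rw [hwr _ (by simp), hvr _ (by decide), h.acc])
    (fun _ _ _ _ _ _ _ _ hn => absurd trivial hn) hN (hs.reg _ (by simp)) hx hs.cert h0
  rw [costCheck, denote_seq]
  generalize (scan (seq visitVertex w)).denote x s = s' at hscan ⊢
  generalize visit (fun _ _ => True) n y (n * n) = l at hscan
  rw [exists_eq_left, costEnd, denote_ite, denote_ite]
  simp only [Test.eval, hscan.n_eq, hscan.count, hscan.sum, hscan.bound, decide_eq_true_eq]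
  split_ifs with h1 h2
  · rw [denote_inc, Store.assign_reg_self]
    simp [h1, h2]
  · simp [denote_nop, hscan.acc, h2]
  · simp [denote_nop, hscan.acc, h1]

/-- A loop that adds up the values of a function. -/
theorem loop_add {x : List Bool} {a : Reg} {n : ℕ} {p : Cmd} {s : Store} (I : Store → Prop)
    (g : ℕ → ℕ) (hN : s.reg rN = n) (hx : n ≤ x.length) (ha : a ∉ p.writes) (haS : a ≠ rS)
    (hI : ∀ s' v, I s' → I (s'.assign a v)) (h0 : I s)
    (hstep : ∀ k s', k < n → s'.reg a = k → I s' →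
      I (p.denote x s') ∧ (p.denote x s').reg rS = s'.reg rS + g k) :
    I ((loop a rN p).denote x s) ∧
      ((loop a rN p).denote x s).reg rS = s.reg rS + ∑ k ∈ Finset.range n, g k := by
  have := loop_rule (x := x) (a := a) (b := rN) (p := p) (s := s)
    (fun k s' => I s' ∧ s'.reg rS = s.reg rS + ∑ k ∈ Finset.range k, g k) ha
    (fun k s' v h => ⟨hI _ _ h.1, by rw [Store.assign_reg_of_ne _ _ haS.symm, h.2]⟩)
    (by simpa using h0)
    (fun k s' hk _ hak _ h => by
      obtain ⟨h1, h2⟩ := hstep k s' (by omega) hak h.1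
      exact ⟨h1, by rw [h2, h.2, Finset.sum_range_succ, Nat.add_assoc]⟩)
  rwa [hN, min_eq_left hx] at this

end Cmd

/-- Quantifying over certificates is the same as quantifying over orderings. By pigeonhole, a
visited list with at least `n` entries is an ordering. -/
theorem exists_visit_iff {n L : ℕ} (hL : n * n ≤ L) (P : List ℕ → Prop) :
    (∃ y : List Bool, y.length = L ∧ ∃ l, l = visit (fun _ _ => True) n y (n * n) ∧
      n ≤ l.length ∧ P l) ↔
    ∃ l : List ℕ, l.Nodup ∧ (∀ v ∈ l, v < n) ∧ l.length = n ∧ P l := by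
  constructor
  · rintro ⟨y, -, l, rfl, hn, hP⟩
    obtain ⟨hd, hlt⟩ := visit_props (cond := fun _ _ => True) (n := n) (y := y) le_rfl
    exact ⟨_, hd, hlt, (length_eq_of_nodup_of_lt hd hlt hn).1, hP⟩
  · rintro ⟨l, hd, hlt, hn, hP⟩
    obtain ⟨y, hy, hv⟩ := exists_visit_eq (cond := fun _ _ => True) hL hn hd hlt
      (fun _ _ => trivial)
    exact ⟨y, hy, l, hv.symm, hn.ge, hP⟩

theorem cmpBits_bits_le (a b : ℕ) : cmpBits true a.bits b.bits = true ↔ a ≤ b := by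
  rw [cmpBits_bits]
  split_ifs with h
  · simp [h]
  · simp only [decide_eq_true_eq]
    omega

/-! ### Directed Feedback Arc Set -/

namespace Cmd

/-- Count the arcs from the current vertex to visited vertices. -/
def countBackArcs : Cmd :=
  loop rJ rN (ite (.mem rJ) (seq (pos rU rJ) (ite (.inp rR) (inc rS) nop)) nop)

end Cmd

open Classical in
/-- The number of arcs from the last vertex of the list to vertices in the list. -/
noncomputable def backArcs (x : List Bool) (n : ℕ) (l : List ℕ) : ℕ :=
  ∑ j ∈ Finset.range n, if j ∈ l ∧ entry x n (l.getLastD 0) j then 1 else 0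

theorem Cmd.countBackArcs_addsCost {x : List Bool} {n : ℕ} (hx : n + 1 ≤ x.length) :
    AddsCost x n (backArcs x n) countBackArcs := by
  intro s l v hv hmem hN hB hU
  refine (loop_add (I := fun s' => s'.mem = s.mem ∧ ∀ i ∈ [rN, rB, rU], s'.reg i = s.reg i) _ hN
    (by omega) (by decide) (by decide) ?_ ⟨rfl, fun _ _ => rfl⟩ ?_).2
  · rintro s' u ⟨h1, h2⟩
    refine ⟨h1, fun i hi => ?_⟩
    rw [Store.assign_reg_of_ne, h2 i hi]
    rintro rfl
    revert hi
    decide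
  · rintro k s' hk hJ ⟨h1, h2⟩
    refine ⟨⟨by rw [denote_mem _ (by decide), h1], fun i hi => ?_⟩, ?_⟩
    · rw [denote_reg, h2 i hi]
      revert i
      decide
    · have hN' := h2 rN (by simp)
      have hB' := h2 rB (by simp)
      have hU' := h2 rU (by simp)
      have hp := pos_reg (x := x) (s := s') (i := rU) (j := rJ) (by decide) (by decide)
        (by omega) (by omega) (by omega) (by omega)
      rw [hB', hN', hU', hB, hN, hU, hJ, Nat.add_assoc _ (n * v)] at hp
      have hS : ((pos rU rJ).denote x s').reg rS = s'.reg rS := pos_frame (by decide)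
      rw [List.getLastD_concat, denote_ite]
      simp only [Test.eval, h1, hJ, hmem]
      split_ifs with c1 c2 c2
      · rw [denote_seq, denote_ite, if_pos (by simpa [Test.eval, hp, entry] using c2.2), denote_inc,
          Store.assign_reg_self, hS]
      · have c3 : ¬ entry x n v k := fun h => c2 ⟨c1, h⟩
        rw [denote_seq, denote_ite, if_neg (by simpa [Test.eval, hp, entry] using c3), denote_nop, hS]
        rfl
      · exact absurd c2.1 c1
      · rfl

end EPNL

/-! ### Membership for problems that ask for an ordering of bounded cost -/

namespace EPNL

/-- The common frame for feedback arc sets and linear arrangements. What is left to each problem is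
the validation `c` of the matrix, a program `w` for the cost of a prefix, and the combinatorial
reformulation `hyes`. -/
theorem inEPNL_of_addsCost {ι : Type} {enc : ι ↪ List Bool} {yes : ι → Prop} {size : ι → ℕ}
    (c w : Cmd) (f : List Bool → ℕ → List ℕ → ℕ)
    (hc : (Cmd.graphParse c).ok zero [aux, len, zero] [])
    (hc' : (Cmd.graphParse c).keepsMem ∧ (Cmd.graphParse c).keepsCert)
    (hcw : ∀ i ∈ [zero, rA, rC, rS, rP, rD, rE, len], i ∉ (Cmd.graphParse c).writes)
    (hcw' : ∀ i ∈ [rN, rB, rQ], i ∉ c.writes)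
    (hw : (Cmd.costCheck w).ok rN [aux, len, zero, rN] [])
    (hw' : w.keepsMem ∧ w.keepsCert)
    (hww : ∀ i ∈ [rT, rU, rN, rB, zero, rC, rQ, rA], i ∉ w.writes)
    (hdec : ∀ x s, IsBoundedGraph x → s.Parsed x → (c.denote x s).reg rV ≠ 0 → ∃ I, enc I = x)
    (henc : ∀ I, IsBoundedGraph (enc I) ∧ ((enc I).takeWhile id).length = size I ∧
      ∀ s, s.Parsed (enc I) → (c.denote (enc I) s).reg rV ≠ 0)
    (hadd : ∀ x n, n + 1 ≤ x.length → Cmd.AddsCost x n (f x n) w)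
    (hyes : ∀ I, yes I ↔ ∃ l : List ℕ, l.Nodup ∧ (∀ v ∈ l, v < size I) ∧ l.length = size I ∧
      cmpBits true (prefixSum (f (enc I) (size I)) l).bits
        ((enc I).drop (size I + 1 + size I * size I)) = true) :
    InEPNL (.ofEncoding enc yes size) := by
  have hreg : ∀ I y,
      let s := (Cmd.graphParse c).denote (enc I) (.initial (enc I) y)
      s.reg rV ≠ 0 ∧ s.reg rN = size I ∧ s.reg rB = size I + 1 ∧
        s.reg rQ = size I + 1 + size I * size I := by
    intro I y
    obtain ⟨hb, hn, hv⟩ := henc I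
    obtain ⟨s, hs, hp⟩ := (Cmd.graphParse_reg (enc I) y c).2 hb
    have hr : ∀ i ∈ [rN, rB, rQ], (c.denote (enc I) s).reg i = s.reg i :=
      fun i hi => Cmd.denote_reg _ _ _ (hcw' i hi)
    simp only [hs]
    refine ⟨hv s hp, ?_, ?_, ?_⟩
    · rw [hr _ (by simp), hp.n_eq, hn]
    · rw [hr _ (by simp), hp.base, hn]
    · rw [hr _ (by simp), hp.bound, hn]
  have hlen : ∀ I, size I + 1 + size I * size I ≤ (enc I).length := fun I => by
    obtain ⟨hb, hn, -⟩ := henc I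
    rw [← hn]
    exact hb.2.1
  refine inEPNL_ofEncoding _ _ _ (Cmd.graphParse c) (Cmd.costCheck w) rV rA rN hc hw
    (fun x y hv => ?_) (fun I y => ⟨(hreg I y).1, (hreg I y).2.1⟩) (fun I => ?_)
  · obtain ⟨h1, h2⟩ := Cmd.graphParse_reg x y c
    by_cases hb : IsBoundedGraph x
    · obtain ⟨s, hs, hp⟩ := h2 hb
      rw [hs] at hv
      exact hdec x s hb hp hv
    · exact absurd (h1 hb) hv
  · have hspec := fun y => Cmd.costCheck_spec (x := enc I) (y := y) (f := f (enc I) (size I))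
      hw'.1 hw'.2 hww (hadd _ _ (by have := hlen I; omega))
      (Cmd.start_denote hc'.1 hc'.2 (fun i hi => hcw i (by
        simp only [List.mem_cons, List.not_mem_nil, or_false] at hi ⊢
        tauto)) (hcw _ (by simp)))
      (hreg I y).2.1 (hreg I y).2.2.1 (hreg I y).2.2.2 (by have := hlen I; omega)
    rw [hyes]
    simp only [hspec]
    exact (exists_visit_iff (by have := hlen I; omega) (fun l => cmpBits true
      (prefixSum (f (enc I) (size I)) l).bits
        ((enc I).drop (size I + 1 + size I * size I)) = true)).symm

/-! ### Linear orders as lists -/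

theorem val_mem_of_length_eq {n : ℕ} {l : List ℕ} (hd : l.Nodup) (h : ∀ v ∈ l, v < n)
    (hn : l.length = n) (v : Fin n) : (v : ℕ) ∈ l :=
  (length_eq_of_nodup_of_lt hd h hn.ge).2 v v.isLt

theorem idxOf_map_val {n : ℕ} (m : List (Fin n)) (v : Fin n) :
    (m.map Fin.val).idxOf (v : ℕ) = m.idxOf v := by
  induction m with
  | nil => rfl
  | cons a m ih => simp only [List.map_cons, List.idxOf_cons, ih, beq_iff_eq, Fin.val_inj,
    cond_eq_ite]

/-- The backward arcs are grouped by their tails: the arc `(u, v)` is counted when `u` is appended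
and `v` is already present. The prefix contains `u` itself, so loops are counted, which corresponds
to `≤` between the positions. -/
theorem prefixSum_backArcs {x : List Bool} {n : ℕ} {A : Fin n → Fin n → Prop}
    [DecidablePred fun e : Fin n × Fin n => A e.1 e.2]
    (hA : ∀ i j : Fin n, entry x n i j ↔ A i j) {l : List ℕ} (hd : l.Nodup)
    (hlt : ∀ v ∈ l, v < n) (hn : l.length = n) :
    prefixSum (backArcs x n) l = (Finset.univ.filter fun e : Fin n × Fin n =>
      A e.1 e.2 ∧ l.idxOf (e.2 : ℕ) ≤ l.idxOf (e.1 : ℕ)).card := by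
  have hm := val_mem_of_length_eq hd hlt hn
  rw [Finset.card_filter, Fintype.sum_prod_type, prefixSum, Finset.sum_range]
  -- Positions in the ordering correspond bijectively to vertices, a position to the tail that is
  -- appended there.
  refine Finset.sum_bij (fun k _ => ⟨l[k], hlt _ (List.getElem_mem _)⟩) (fun _ _ => Finset.mem_univ _)
    ?_ ?_ ?_
  · intro a _ b _ h
    exact Fin.ext ((List.Nodup.getElem_inj_iff hd).1 (congrArg Fin.val h))
  · intro v _
    exact ⟨⟨l.idxOf (v : ℕ), List.idxOf_lt_length_iff.2 (hm v)⟩, Finset.mem_univ _,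
      Fin.ext (List.getElem_idxOf _)⟩
  · intro k _
    have hlast : (l.take (k + 1)).getLastD 0 = l[k] := by
      rw [List.take_add_one, List.getElem?_eq_getElem k.isLt, Option.toList_some,
        List.getLastD_concat]
      rfl
    rw [backArcs, Finset.sum_range]
    refine Finset.sum_congr rfl fun j _ => ?_
    have hk : l.idxOf (l[k]) = k := List.Nodup.idxOf_getElem hd _ _
    have key : ((j : ℕ) ∈ l.take (k + 1) ∧ entry x n ((l.take (k + 1)).getLastD 0) j) ↔
        A ⟨l[k], hlt _ (List.getElem_mem _)⟩ j ∧ l.idxOf (j : ℕ) ≤ l.idxOf (l[k]) := by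
      rw [hlast, hk, List.mem_take_iff_idxOf_lt (hm j), Nat.lt_succ_iff, ← hA, and_comm]
    by_cases h : A ⟨l[k], hlt _ (List.getElem_mem _)⟩ j ∧ l.idxOf (j : ℕ) ≤ l.idxOf (l[k])
    · rw [if_pos (key.2 h)]
      exact (if_pos h).symm
    · rw [if_neg (mt key.1 h)]
      exact (if_neg h).symm

/-- If the removal of `F` leaves an acyclic graph, then `F` contains all backward arcs of a
topological ordering of what remains. Conversely, once the backward arcs of an ordering are removed,
positions increase strictly along every arc, so there is no cycle. -/
theorem FeedbackInstance.solvable_iff (I : FeedbackInstance) {x : List Bool}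
    (hx : ∀ i j : Fin I.n, entry x I.n i j ↔ I.graph.Adj i j) :
    I.Solvable ↔ ∃ l : List ℕ, l.Nodup ∧ (∀ v ∈ l, v < I.n) ∧ l.length = I.n ∧
      prefixSum (backArcs x I.n) l ≤ I.bound := by
  classical
  constructor
  · rintro ⟨F, -, hF, hacyc⟩
    let R : Fin I.n → Fin I.n → Prop := fun a b => I.graph.Adj a b ∧ (a, b) ∉ F
    -- Reachability in an acyclic graph is antisymmetric. A linear extension of it, listed in
    -- increasing order, is a topological ordering.
    have : IsPartialOrder (Fin I.n) (Relation.ReflTransGen R) :=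
      { refl := fun _ => .refl
        trans := fun _ _ _ => .trans
        antisymm := fun a b hab hba => by
          rcases Relation.reflTransGen_iff_eq_or_transGen.1 hab with h | h
          · exact h.symm
          · exact absurd (h.trans_left hba) (hacyc a) }
    obtain ⟨r, hr, hle⟩ := extend_partialOrder (Relation.ReflTransGen R)
    let m := Finset.univ.sort (r := r)
    have hmd : m.Nodup := Finset.sort_nodup _ _
    have hmm : ∀ v, v ∈ m := fun v => (Finset.mem_sort _).2 (Finset.mem_univ v)
    have hlen : m.length = I.n := by
      rw [Finset.length_sort, Finset.card_univ, Fintype.card_fin]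
    have hd : (m.map Fin.val).Nodup := hmd.map Fin.val_injective
    have hlt : ∀ v ∈ m.map Fin.val, v < I.n := by
      intro v hv
      obtain ⟨w, -, rfl⟩ := List.mem_map.1 hv
      exact w.isLt
    have hlen' : (m.map Fin.val).length = I.n := by rw [List.length_map, hlen]
    refine ⟨_, hd, hlt, hlen', le_trans ?_ hF⟩
    rw [prefixSum_backArcs hx hd hlt hlen']
    refine Finset.card_le_card fun e he => ?_
    obtain ⟨-, hadj, hidx⟩ := Finset.mem_filter.1 he
    by_contra hne
    have hre : r e.1 e.2 := hle _ _ (.single ⟨hadj, hne⟩)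
    have hidx' : ∀ v : Fin I.n, (m.map Fin.val).idxOf (v : ℕ) = m.idxOf v := idxOf_map_val m
    rw [hidx', hidx'] at hidx
    -- A backward arc outside `F` would join its ends in both directions of the linear order, so it
    -- is a loop. But a loop outside `F` is a cycle.
    have heq : e.1 = e.2 := by
      rcases eq_or_lt_of_le hidx with h | h
      · exact ((List.idxOf_inj (hmm _)).1 h).symm
      · have h3 := List.pairwise_iff_getElem.1 (Finset.pairwise_sort Finset.univ r) _ _
          (List.idxOf_lt_length_iff.2 (hmm e.2)) (List.idxOf_lt_length_iff.2 (hmm e.1)) h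
        rw [List.getElem_idxOf, List.getElem_idxOf] at h3
        exact antisymm hre h3
    refine hacyc e.1 (.single ⟨?_, ?_⟩)
    · rw [← heq] at hadj
      exact hadj
    · have : (e.1, e.1) = e := Prod.ext rfl heq
      rw [this]
      exact hne
  · rintro ⟨l, hd, hlt, hn, hb⟩
    rw [prefixSum_backArcs hx hd hlt hn] at hb
    refine ⟨_, fun e he => (Finset.mem_filter.1 he).2.1, hb, fun v hv => ?_⟩
    have key : ∀ a b, Relation.TransGen (fun a b => I.graph.Adj a b ∧
        (a, b) ∉ Finset.univ.filter fun e : Fin I.n × Fin I.n =>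
          I.graph.Adj e.1 e.2 ∧ l.idxOf (e.2 : ℕ) ≤ l.idxOf (e.1 : ℕ)) a b →
        l.idxOf (a : ℕ) < l.idxOf (b : ℕ) := by
      have step : ∀ a b, (I.graph.Adj a b ∧
          (a, b) ∉ Finset.univ.filter fun e : Fin I.n × Fin I.n =>
            I.graph.Adj e.1 e.2 ∧ l.idxOf (e.2 : ℕ) ≤ l.idxOf (e.1 : ℕ)) →
          l.idxOf (a : ℕ) < l.idxOf (b : ℕ) := by
        rintro a b ⟨h1, h2⟩
        by_contra h3
        exact h2 (Finset.mem_filter.2 ⟨Finset.mem_univ _, h1, not_lt.1 h3⟩)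
      intro a b h
      induction h with
      | single h => exact step _ _ h
      | tail _ h ih => exact ih.trans (step _ _ h)
    exact lt_irrefl _ (key v v hv)

theorem directedFeedbackArcSet_inEPNL : InEPNL directedFeedbackArcSet := by
  have henc : ∀ I : FeedbackInstance, FeedbackInstance.encode I =
    unaryThen I.n (matrixBits I.graph.Adj ++ Nat.bits I.bound) := fun I => rfl
  refine inEPNL_of_addsCost (.inc rV) .countBackArcs backArcs (by decide) (by decide) (by decide)
    (by decide) (by decide) (by decide) (by decide) (fun x s hb _ _ => ?_) (fun I => ?_)
    (fun x n => Cmd.countBackArcs_addsCost) (fun I => ?_)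
  -- Every square matrix is the adjacency matrix of a digraph with loops allowed, so nothing besides
  -- the shape has to be checked.
  · obtain ⟨A, b, h⟩ := hb.exists_eq
    exact ⟨⟨_, ⟨A⟩, b⟩, h.symm⟩
  · rw [henc]
    refine ⟨isBoundedGraph_unaryThen _ _, takeWhile_unaryThen _ _, fun s _ => ?_⟩
    rw [Cmd.denote_inc, Store.assign_reg_self]
    exact Nat.succ_ne_zero _
  · rw [I.solvable_iff (x := FeedbackInstance.encode I) (fun i j => entry_unaryThen _ _ i j), henc,
      drop_matrix_unaryThen]
    simp only [cmpBits_bits_le]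

end EPNL

namespace EPNL

/-! ### Optimal Linear Arrangement -/

namespace Cmd

variable {x : List Bool} {n : ℕ} {s : Store}

/-- A loop that sets register `rF'` if a property fails. -/
theorem loop_flag {a : Reg} {p : Cmd} (I : Store → Prop)
    (g : ℕ → Prop) (hN : s.reg rN = n) (hx : n ≤ x.length) (ha : a ∉ p.writes) (haF : a ≠ rF')
    (hI : ∀ s' v, I s' → I (s'.assign a v)) (h0 : I s)
    (hstep : ∀ k s', k < n → s'.reg a = k → I s' →
      I (p.denote x s') ∧ ((p.denote x s').reg rF' = 0 ↔ s'.reg rF' = 0 ∧ g k)) :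
    I ((loop a rN p).denote x s) ∧
      (((loop a rN p).denote x s).reg rF' = 0 ↔ s.reg rF' = 0 ∧ ∀ k < n, g k) := by
  have := loop_rule (x := x) (a := a) (b := rN) (p := p) (s := s)
    (fun k s' => I s' ∧ (s'.reg rF' = 0 ↔ s.reg rF' = 0 ∧ ∀ j < k, g j)) ha
    (fun k s' v h => ⟨hI _ _ h.1, by rw [Store.assign_reg_of_ne _ _ haF.symm, h.2]⟩)
    (by simpa using h0)
    (fun k s' hk _ hak _ h => by
      obtain ⟨h1, h2⟩ := hstep k s' (by omega) hak h.1
      exact ⟨h1, by rw [h2, h.2, and_assoc, Nat.forall_lt_succ_right]⟩)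
  rwa [hN, min_eq_left hx] at this

/-- Set register `rF'` if the entry in row `rI` and column `rJ` is a loop or not symmetric. -/
def symEntry : Cmd :=
  seq (pos rI rJ) (ite (.inp rR) (seq (pos rJ rI) (ite (.inp rR)
    (ite (.le rI rJ) (ite (.le rJ rI) (inc rF') nop) nop) (inc rF'))) nop)

/-- Set register `rV` if the matrix is symmetric with zeros on the diagonal. -/
def symCheck : Cmd :=
  seq (loop rI rN (loop rJ rN symEntry)) (ite (.le rF' zero) (inc rV) nop)

theorem pos_inp {i j : Reg} (hi : i ∉ [rR, rX, rY]) (hj : j ∉ [rR, rX, rY]) (hN : s.reg rN = n)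
    (hB : s.reg rB = n + 1) (hx : n + 1 ≤ x.length) (hi' : s.reg i < n) (hj' : s.reg j < n) :
    Test.eval x ((pos i j).denote x s) (.inp rR) = true ↔ entry x n (s.reg i) (s.reg j) := by
  have hp := pos_reg (x := x) (s := s) hi hj (by omega) (by omega) (by omega) (by omega)
  rw [hN, hB, Nat.add_assoc _ (n * _)] at hp
  simp only [Test.eval, hp, beq_iff_eq]
  rfl

theorem symEntry_reg {i j : ℕ} (hN : s.reg rN = n) (hB : s.reg rB = n + 1)
    (hx : n + 1 ≤ x.length) (hI : s.reg rI = i) (hJ : s.reg rJ = j) (hi : i < n) (hj : j < n) :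
    (symEntry.denote x s).reg rF' = 0 ↔
      s.reg rF' = 0 ∧ (entry x n i j → entry x n j i ∧ i ≠ j) := by
  have h1 := pos_inp (x := x) (s := s) (i := rI) (j := rJ) (by decide) (by decide) hN hB hx
    (by omega) (by omega)
  have f1 : ∀ k ∉ [rR, rX, rY], ((pos rI rJ).denote x s).reg k = s.reg k :=
    fun k hk => pos_frame hk
  rw [symEntry, denote_seq, denote_ite]
  generalize (pos rI rJ).denote x s = s1 at h1 f1 ⊢
  have h2 := pos_inp (x := x) (s := s1) (n := n) (i := rJ) (j := rI) (by decide) (by decide)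
    (by rw [f1 _ (by decide), hN]) (by rw [f1 _ (by decide), hB]) hx
    (by rw [f1 _ (by decide)]; omega) (by rw [f1 _ (by decide)]; omega)
  have f2 : ∀ k ∉ [rR, rX, rY], ((pos rJ rI).denote x s1).reg k = s1.reg k :=
    fun k hk => pos_frame hk
  rw [f1 _ (by decide), f1 _ (by decide), hI, hJ] at h2
  rw [hI, hJ] at h1
  split_ifs with c1
  · have e1 := h1.1 c1
    rw [denote_seq, denote_ite]
    generalize (pos rJ rI).denote x s1 = s2 at h2 f2 ⊢
    have eI : s2.reg rI = i := by rw [f2 _ (by decide), f1 _ (by decide), hI]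
    have eJ : s2.reg rJ = j := by rw [f2 _ (by decide), f1 _ (by decide), hJ]
    have eF : s2.reg rF' = s.reg rF' := by rw [f2 _ (by decide), f1 _ (by decide)]
    split_ifs with c2
    · have e2 := h2.1 c2
      simp only [denote_ite, Test.eval, eI, eJ, decide_eq_true_eq, denote_nop, denote_inc]
      split_ifs with c3 c4
      · rw [Store.assign_reg_self]
        obtain rfl := le_antisymm c3 c4
        simp [e1]
      · simp [eF, e2, show i ≠ j by omega]
      · simp [eF, e2, show i ≠ j by omega]
    · have e2 : ¬ entry x n j i := fun h => c2 (h2.2 h)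
      rw [denote_inc, Store.assign_reg_self]
      simp [e1, e2]
  · have e1 : ¬ entry x n i j := fun h => c1 (h1.2 h)
    rw [denote_nop, f1 _ (by decide)]
    simp [e1]

/-- The frame condition for loop bodies that change only the registers outside a list. -/
def Frame (R : List Reg) (s s' : Store) : Prop :=
  s'.mem = s.mem ∧ ∀ i ∈ R, s'.reg i = s.reg i

theorem Frame.refl (R : List Reg) (s : Store) : Frame R s s := ⟨rfl, fun _ _ => rfl⟩

theorem Frame.assign {R : List Reg} {s s' : Store} (h : Frame R s s') {a : Reg} (ha : a ∉ R)
    (v : ℕ) : Frame R s (s'.assign a v) := by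
  refine ⟨h.1, fun i hi => ?_⟩
  rw [Store.assign_reg_of_ne, h.2 i hi]
  rintro rfl
  exact ha hi

theorem Frame.denote {R : List Reg} {s s' : Store} (h : Frame R s s') {p : Cmd}
    (hm : p.keepsMem) (hR : ∀ i ∈ R, i ∉ p.writes) : Frame R s (p.denote x s') :=
  ⟨by rw [denote_mem x hm, h.1], fun i hi => by rw [denote_reg _ _ _ (hR i hi), h.2 i hi]⟩

/-- Words whose matrix is not symmetric or has a one on the diagonal encode no simple graph. They
must be rejected by the parser, since their parameter is `0`. -/
theorem symCheck_reg (hx : (x.takeWhile id).length + 1 ≤ x.length) (hs : s.Parsed x) :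
    (symCheck.denote x s).reg rV ≠ 0 ↔ ∀ i < (x.takeWhile id).length,
      ∀ j < (x.takeWhile id).length, entry x (x.takeWhile id).length i j →
        entry x (x.takeWhile id).length j i ∧ i ≠ j := by
  obtain ⟨hN, hB, -, hF, hV, hz⟩ := hs
  generalize (x.takeWhile id).length = n at *
  have outer := loop_flag (x := x) (s := s) (a := rI) (p := loop rJ rN symEntry)
    (Frame [rN, rB, zero, rV] s)
    (fun i => ∀ j < n, entry x n i j → entry x n j i ∧ i ≠ j) hN (by omega) (by decide)
    (by decide) (fun _ _ h => h.assign (by decide) _) (.refl _ _)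
    (fun i s' hi hI h => by
      have inner := loop_flag (x := x) (s := s') (a := rJ) (p := symEntry)
        (Frame [rN, rB, zero, rV, rI] s')
        (fun j => entry x n i j → entry x n j i ∧ i ≠ j)
        (by rw [h.2 _ (by simp), hN]) (by omega) (by decide) (by decide)
        (fun _ _ h => h.assign (by decide) _) (.refl _ _)
        (fun j s'' hj hJ h' => ⟨h'.denote (by decide) (by decide),
          symEntry_reg (by rw [h'.2 _ (by simp), h.2 _ (by simp), hN])
            (by rw [h'.2 _ (by simp), h.2 _ (by simp), hB]) hx
            (by rw [h'.2 _ (by simp), hI]) hJ hi hj⟩)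
      exact ⟨h.denote (by decide) (by decide), inner.2⟩)
  obtain ⟨h1, h2⟩ := outer
  rw [symCheck, denote_seq, denote_ite]
  generalize (loop rI rN (loop rJ rN symEntry)).denote x s = s' at *
  have hz' : s'.reg zero = 0 := by rw [h1.2 _ (by simp), hz]
  have hV' : s'.reg rV = 0 := by rw [h1.2 _ (by simp), hV]
  simp only [Test.eval, hz', Nat.le_zero, decide_eq_true_eq]
  rw [hF] at h2
  simp only [true_and] at h2
  rw [← h2]
  split_ifs with c
  · simp [denote_inc, c]
  · simp [denote_nop, hV', c]

/-- Count the arcs from visited vertices to unvisited vertices. -/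
def countCut : Cmd :=
  loop rI rN (loop rJ rN (ite (.mem rI) (ite (.mem rJ) nop
    (seq (pos rI rJ) (ite (.inp rR) (inc rS) nop))) nop))

end Cmd

open Classical in
/-- The number of arcs from vertices in the list to other vertices. -/
noncomputable def cutArcs (x : List Bool) (n : ℕ) (l : List ℕ) : ℕ :=
  ∑ i ∈ Finset.range n, ∑ j ∈ Finset.range n, if i ∈ l ∧ j ∉ l ∧ entry x n i j then 1 else 0

theorem Cmd.countCut_addsCost {x : List Bool} {n : ℕ} (hx : n + 1 ≤ x.length) :
    AddsCost x n (cutArcs x n) countCut := by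
  intro s l v hv hmem hN hB hU
  refine (loop_add (I := Frame [rN, rB] s) _ hN (by omega) (by decide) (by decide)
    (fun _ _ h => h.assign (by decide) _) (.refl _ _) fun i s' hi hI h =>
      ⟨h.denote (by decide) (by decide), ?_⟩).2
  refine (loop_add (I := Frame [rN, rB, rI] s') _ (by rw [h.2 _ (by simp), hN]) (by omega)
    (by decide) (by decide) (fun _ _ h => h.assign (by decide) _) (.refl _ _)
    fun j s'' hj hJ h' => ⟨h'.denote (by decide) (by decide), ?_⟩).2
  have hI' : s''.reg rI = i := by rw [h'.2 _ (by simp), hI]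
  have hp := pos_inp (x := x) (s := s'') (n := n) (i := rI) (j := rJ) (by decide) (by decide)
    (by rw [h'.2 _ (by simp), h.2 _ (by simp), hN]) (by rw [h'.2 _ (by simp), h.2 _ (by simp), hB])
    hx (by omega) (by omega)
  rw [hI', hJ] at hp
  have hS : ((pos rI rJ).denote x s'').reg rS = s''.reg rS := pos_frame (by decide)
  have hmI : Test.eval x s'' (.mem rI) = true ↔ i ∈ l ++ [v] := by
    simp only [Test.eval, hI', h'.1, h.1, hmem]
  have hmJ : Test.eval x s'' (.mem rJ) = true ↔ j ∈ l ++ [v] := by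
    simp only [Test.eval, hJ, h'.1, h.1, hmem]
  simp only [denote_ite, denote_seq, denote_nop, denote_inc]
  by_cases c1 : i ∈ l ++ [v]
  · rw [if_pos (hmI.2 c1)]
    by_cases c2 : j ∈ l ++ [v]
    · rw [if_pos (hmJ.2 c2), if_neg (fun h => h.2.1 c2)]
      rfl
    · rw [if_neg (mt hmJ.1 c2)]
      by_cases c3 : entry x n i j
      · rw [if_pos (hp.2 c3), if_pos ⟨c1, c2, c3⟩, Store.assign_reg_self, hS]
      · rw [if_neg (mt hp.1 c3), if_neg (fun h => c3 h.2.2), hS]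
        rfl
  · rw [if_neg (mt hmI.1 c1), if_neg (fun h => c1 h.1)]
    rfl

/-- The prefixes that contain position `a` but not position `b` end at the positions `k` with `a ≤ k
< b`. For `b ≤ a` there are none, as in the truncated difference. -/
theorem sum_range_cut {n a b : ℕ} (hb : b ≤ n) :
    (∑ k ∈ Finset.range n, if a < k + 1 ∧ ¬ b < k + 1 then 1 else 0) = b - a := by
  rw [← Finset.card_filter, ← Nat.card_Ico]
  congr 1
  ext k
  simp only [Finset.mem_filter, Finset.mem_range, Finset.mem_Ico]
  omega

/-- Double counting: an arc from `i` to `j` is cut by `π j - π i` prefixes, with truncated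
subtraction. An edge is present as two opposite arcs, and the two truncated differences add up to
the absolute value. -/
theorem prefixSum_cutArcs {x : List Bool} {n : ℕ} {G : SimpleGraph (Fin n)}
    (hG : ∀ i j : Fin n, entry x n i j ↔ G.Adj i j) {l : List ℕ} (hd : l.Nodup)
    (hlt : ∀ v ∈ l, v < n) (hn : l.length = n) (π : Fin n ≃ Fin n)
    (hπ : ∀ v, (π v : ℕ) = l.idxOf (v : ℕ)) :
    prefixSum (cutArcs x n) l = arrangementCost G π := by
  classical
  have hm := val_mem_of_length_eq hd hlt hn
  have h1 : prefixSum (cutArcs x n) l =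
      ∑ i : Fin n, ∑ j : Fin n, if G.Adj i j then (π j : ℕ) - π i else 0 := by
    simp only [prefixSum, cutArcs, hn, Finset.sum_range (n := n)]
    rw [Finset.sum_comm]
    refine Finset.sum_congr rfl fun i _ => ?_
    rw [Finset.sum_comm]
    refine Finset.sum_congr rfl fun j _ => ?_
    have key : ∀ k, ((i : ℕ) ∈ l.take (k + 1) ∧ (j : ℕ) ∉ l.take (k + 1) ∧ entry x n i j) ↔
        ((π i : ℕ) < k + 1 ∧ ¬ (π j : ℕ) < k + 1) ∧ G.Adj i j := by
      intro k
      rw [List.mem_take_iff_idxOf_lt (hm i), List.mem_take_iff_idxOf_lt (hm j), hG, hπ, hπ,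
        and_assoc]
    simp only [key]
    split_ifs with h
    · simp only [h, and_true]
      rw [← sum_range_cut (π j).isLt.le, Finset.sum_range]
    · simp [h]
  -- The ordered pairs are split by the order of `i` and `j`. Exchanging the names in the second
  -- part lets the two orientations of each edge meet at the pair with `i < j`.
  have h2 : ∀ i j : Fin n, (if G.Adj i j then (π j : ℕ) - π i else 0) =
      (if i < j ∧ G.Adj i j then (π j : ℕ) - π i else 0) +
        if j < i ∧ G.Adj j i then (π j : ℕ) - π i else 0 := by
    intro i j
    rw [G.adj_comm j i]
    rcases lt_trichotomy i j with h | h | h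
    · simp [h, h.not_gt]
    · simp [h]
    · simp [h, h.not_gt]
  simp only [h1, h2, Finset.sum_add_distrib]
  rw [Finset.sum_comm (f := fun i j => if j < i ∧ G.Adj j i then (π j : ℕ) - π i else 0),
    ← Finset.sum_add_distrib, arrangementCost]
  refine Finset.sum_congr rfl fun i _ => ?_
  rw [← Finset.sum_add_distrib]
  refine Finset.sum_congr rfl fun j _ => ?_
  split_ifs
  · omega
  · rfl

theorem ArrangementInstance.solvable_iff (I : ArrangementInstance) {x : List Bool}
    (hx : ∀ i j : Fin I.n, entry x I.n i j ↔ I.graph.Adj i j) :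
    I.Solvable ↔ ∃ l : List ℕ, l.Nodup ∧ (∀ v ∈ l, v < I.n) ∧ l.length = I.n ∧
      prefixSum (cutArcs x I.n) l ≤ I.bound := by
  constructor
  · rintro ⟨π, hπ⟩
    have hinj : Function.Injective fun k => (π.symm k : ℕ) :=
      Fin.val_injective.comp π.symm.injective
    have hd := List.nodup_ofFn.2 hinj
    have hlt : ∀ v ∈ List.ofFn fun k => (π.symm k : ℕ), v < I.n := by
      intro v hv
      obtain ⟨k, rfl⟩ := List.mem_ofFn.1 hv
      exact (π.symm k).isLt
    refine ⟨_, hd, hlt, List.length_ofFn, ?_⟩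
    rw [prefixSum_cutArcs hx hd hlt List.length_ofFn π]
    · exact hπ
    · intro v
      have h := List.Nodup.idxOf_getElem hd (π v) (by rw [List.length_ofFn]; exact (π v).isLt)
      rw [List.getElem_ofFn] at h
      simpa using h.symm
  · rintro ⟨l, hd, hlt, hn, hb⟩
    have hm := val_mem_of_length_eq hd hlt hn
    -- A vertex is arranged at its position in the list. An injective self-map of a finite set is a
    -- bijection.
    let g : Fin I.n → Fin I.n := fun v =>
      ⟨l.idxOf (v : ℕ), (List.idxOf_lt_length_iff.2 (hm v)).trans_eq hn⟩
    have hg : Function.Bijective g := Finite.injective_iff_bijective.1 fun u v h =>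
      Fin.ext ((List.idxOf_inj (hm u)).1 (congrArg Fin.val h))
    refine ⟨Equiv.ofBijective g hg, ?_⟩
    rw [← prefixSum_cutArcs hx hd hlt hn (Equiv.ofBijective g hg) (fun _ => rfl)]
    exact hb

theorem optimalLinearArrangement_inEPNL : InEPNL optimalLinearArrangement := by
  have henc : ∀ I : ArrangementInstance, ArrangementInstance.encode I =
    unaryThen I.n (matrixBits I.graph.Adj ++ Nat.bits I.bound) := fun I => rfl
  refine inEPNL_of_addsCost .symCheck .countCut cutArcs (by decide) (by decide) (by decide)
    (by decide) (by decide) (by decide) (by decide) (fun x s hb hs hv => ?_) (fun I => ?_)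
    (fun x n => Cmd.countCut_addsCost) (fun I => ?_)
  · have hle := hb.2.1
    rw [Cmd.symCheck_reg (by omega) hs] at hv
    obtain ⟨A, b, h⟩ := hb.exists_eq
    have hA : ∀ i j : Fin (x.takeWhile id).length,
        entry x (x.takeWhile id).length i j ↔ A i j := fun i j => by
      have := entry_unaryThen A (Nat.bits b) i j
      rwa [← h] at this
    refine ⟨⟨_, ⟨A, ⟨fun i j hij => ?_⟩, ⟨fun i hi => ?_⟩⟩, b⟩, h.symm⟩
    · exact (hA j i).1 (hv i i.isLt j j.isLt ((hA i j).2 hij)).1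
    · exact (hv i i.isLt i i.isLt ((hA i i).2 hi)).2 rfl
  · have hb := isBoundedGraph_unaryThen I.graph.Adj I.bound
    have hn := takeWhile_unaryThen I.n (matrixBits I.graph.Adj ++ Nat.bits I.bound)
    rw [henc]
    refine ⟨hb, hn, fun s hs => ?_⟩
    have hle := hb.2.1
    rw [Cmd.symCheck_reg (by omega) hs, hn]
    intro i hi j hj hij
    have hadj := (entry_unaryThen I.graph.Adj (Nat.bits I.bound) ⟨i, hi⟩ ⟨j, hj⟩).1 hij
    exact ⟨(entry_unaryThen I.graph.Adj (Nat.bits I.bound) ⟨j, hj⟩ ⟨i, hi⟩).2 hadj.symm,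
      fun h => hadj.ne (Fin.ext h)⟩
  · rw [I.solvable_iff (x := ArrangementInstance.encode I) (fun i j => entry_unaryThen _ _ i j),
      henc, drop_matrix_unaryThen]
    simp only [cmpBits_bits_le]

end EPNL

namespace EPNL

/-! ### Set Cover -/

/-- The input consists of numbers `n` and `m` in unary, a matrix and a number in binary. -/
def IsBoundedFamily (x : List Bool) (n m : ℕ) : Prop :=
  false ∈ x ∧ n = (x.takeWhile id).length ∧ false ∈ x.drop (n + 1) ∧
    m = ((x.drop (n + 1)).takeWhile id).length ∧ n + 1 + m + 1 + n * m ≤ x.length ∧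
    (n + 1 + m + 1 + n * m = x.length ∨ x.getLast? = some true)

theorem IsBoundedFamily.exists_eq {x : List Bool} {n m : ℕ} (h : IsBoundedFamily x n m) :
    ∃ (A : Fin m → Fin n → Prop) (b : ℕ),
      x = unaryThen n (unaryThen m (matrixBits A ++ Nat.bits b)) := by
  obtain ⟨hf, hn, hf', hm, hle, hb⟩ := h
  obtain ⟨A, b, hA⟩ := exists_matrixBits_bits hle hb
  refine ⟨A, b, ?_⟩
  have h1 := eq_unaryThen_drop hf
  have h2 := eq_unaryThen_drop hf'
  rw [← hm, List.drop_drop, ← Nat.add_assoc, hA] at h2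
  rw [← hn, h2] at h1
  exact h1

theorem isBoundedFamily_unaryThen {n m : ℕ} (A : Fin m → Fin n → Prop) (b : ℕ) :
    IsBoundedFamily (unaryThen n (unaryThen m (matrixBits A ++ Nat.bits b))) n m := by
  refine ⟨false_mem_unaryThen _ _, (takeWhile_unaryThen _ _).symm, ?_⟩
  rw [drop_unaryThen]
  refine ⟨false_mem_unaryThen _ _, (takeWhile_unaryThen _ _).symm, ?_⟩
  rw [length_unaryThen, length_unaryThen, List.length_append, matrixBits_length,
    Nat.mul_comm m n]
  refine ⟨by omega, ?_⟩
  have e : unaryThen n (unaryThen m (matrixBits A ++ Nat.bits b)) =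
      (unaryThen n (List.replicate m true ++ false :: matrixBits A)) ++ Nat.bits b := by
    simp [unaryThen]
  rcases getLast?_append_bits
    (unaryThen n (List.replicate m true ++ false :: matrixBits A)) b with h | h
  · left
    simp [h]
    omega
  · right
    rw [e, h]

/-- The matrix entry in row `i` and column `j`. -/
def incidence (x : List Bool) (n m i j : ℕ) : Prop :=
  x[n + 1 + m + 1 + (n * i + j)]? = some true

theorem incidence_unaryThen {n m : ℕ} (A : Fin m → Fin n → Prop) (w : List Bool) (i : Fin m)
    (j : Fin n) :
    incidence (unaryThen n (unaryThen m (matrixBits A ++ w))) n m i j ↔ A i j := by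
  rw [incidence, Nat.add_assoc _ m 1, Nat.add_assoc, getElem?_unaryThen, getElem?_unaryThen,
    getElem?_matrixBits]

theorem drop_family_unaryThen {n m : ℕ} (A : Fin m → Fin n → Prop) (w : List Bool) :
    (unaryThen n (unaryThen m (matrixBits A ++ w))).drop (n + 1 + m + 1 + n * m) = w := by
  rw [← List.drop_drop, Nat.add_assoc _ m 1, ← List.drop_drop, drop_unaryThen, drop_unaryThen,
    Nat.mul_comm, ← matrixBits_length A, List.drop_left]

namespace Cmd

/-- Decide whether the input is a family of sets and a bound. -/
def setParse : Cmd :=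
  seq (unary zero rN rF) (seq (copy rB rN) (seq (inc rB) (seq (unary rB rM rF')
    (seq (add rB rM) (seq (inc rB) (seq measure
      (ite (.le rF' zero) nop (guard (seq (copy rQ rR) (inc rV))))))))))

/-- The parser may go astray if one of the two delimiting zeros is missing. Then one of the flags
`rF` and `rF'` is zero and prevents acceptance, so register values are claimed only if both zeros
exist. -/
theorem setParse_reg (x y : List Bool) :
    let s := setParse.denote x (.initial x y)
    (s.reg rV ≠ 0 → ∃ n m, IsBoundedFamily x n m) ∧
      ∀ n m, IsBoundedFamily x n m → s.reg rV ≠ 0 ∧ s.reg rN = n ∧ s.reg rM = m ∧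
        s.reg rB = n + 1 + m + 1 ∧ s.reg rQ = n + 1 + m + 1 + n * m := by
  intro s
  have i0 : ∀ i, i ≠ len → (Store.initial x y).reg i = 0 := fun i hi => Store.initial_reg x y hi
  obtain ⟨hn, hF⟩ := unary_reg (x := x) (s := .initial x y) (p := zero) (c := rN) (f := rF)
    (by decide) (by decide) (by decide) (by decide) (by decide) (by decide) (by decide) (by decide)
    (i0 _ (by decide)) (i0 _ (by decide)) (i0 _ (by decide)) (Store.initial_len x y)
  rw [i0 zero (by decide), List.drop_zero] at hn hF
  have hs : s = setParse.denote x (.initial x y) := rfl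
  rw [setParse, denote_seq, denote_seq, denote_seq, denote_seq, denote_seq, denote_seq,
    denote_seq] at hs
  clear_value s
  have f1 : ∀ i ∉ (unary zero rN rF).writes, ((unary zero rN rF).denote x (.initial x y)).reg i =
    (Store.initial x y).reg i := fun i hi => denote_reg _ _ _ hi
  generalize (unary zero rN rF).denote x (.initial x y) = s1 at *
  have f2 : ∀ i ∉ (copy rB rN).writes, ((copy rB rN).denote x s1).reg i = s1.reg i :=
    fun i hi => denote_reg _ _ _ hi
  have c2 := copy_reg (x := x) (s := s1) (a := rB) (b := rN) (by decide) (by decide)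
  generalize (copy rB rN).denote x s1 = s2 at *
  have f3 : ∀ i ∉ (inc rB).writes, ((inc rB).denote x s2).reg i = s2.reg i :=
    fun i hi => denote_reg _ _ _ hi
  have c3 : ((inc rB).denote x s2).reg rB = s2.reg rB + 1 := Store.assign_reg_self _ _ _
  generalize (inc rB).denote x s2 = s3 at *
  have r3 : ∀ i ∈ [rM, rF', zero, len, rL, rV], s3.reg i = (Store.initial x y).reg i := by
    intro i hi
    rw [f3, f2, f1]
    all_goals
      revert i
      decide
  obtain ⟨hm, hF'⟩ := unary_reg (x := x) (s := s3) (p := rB) (c := rM) (f := rF')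
    (by decide) (by decide) (by decide) (by decide) (by decide) (by decide) (by decide) (by decide)
    (by rw [r3 _ (by simp), i0 _ (by decide)]) (by rw [r3 _ (by simp), i0 _ (by decide)])
    (by rw [r3 _ (by simp), i0 _ (by decide)]) (by rw [r3 _ (by simp), Store.initial_len x y])
  have f4 : ∀ i ∉ (unary rB rM rF').writes, ((unary rB rM rF').denote x s3).reg i = s3.reg i :=
    fun i hi => denote_reg _ _ _ hi
  generalize (unary rB rM rF').denote x s3 = s4 at *
  have f5 : ∀ i ∉ (add rB rM).writes, ((add rB rM).denote x s4).reg i = s4.reg i :=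
    fun i hi => denote_reg _ _ _ hi
  have c5 := add_reg (x := x) (s := s4) (a := rB) (b := rM) (by decide)
  generalize (add rB rM).denote x s4 = s5 at *
  have f6 : ∀ i ∉ (inc rB).writes, ((inc rB).denote x s5).reg i = s5.reg i :=
    fun i hi => denote_reg _ _ _ hi
  have c6 : ((inc rB).denote x s5).reg rB = s5.reg rB + 1 := Store.assign_reg_self _ _ _
  generalize (inc rB).denote x s5 = s6 at *
  have f7 : ∀ i ∉ measure.writes, (measure.denote x s6).reg i = s6.reg i :=
    fun i hi => denote_reg _ _ _ hi
  have r6 : ∀ i ∈ [zero, len, rL, rV], s6.reg i = (Store.initial x y).reg i := by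
    intro i hi
    rw [f6, f5, f4, r3]
    all_goals
      revert i
      decide
  have c7 := measure_reg (x := x) (s := s6) (by rw [r6 _ (by simp), i0 _ (by decide)])
    (by rw [r6 _ (by simp), i0 _ (by decide)]) (by rw [r6 _ (by simp), Store.initial_len x y])
  generalize measure.denote x s6 = s7 at *
  have z7 : s7.reg zero = 0 := by rw [f7 _ (by decide), r6 _ (by simp), i0 _ (by decide)]
  have l7 : s7.reg len = x.length := by
    rw [f7 _ (by decide), r6 _ (by simp), Store.initial_len x y]
  have v7 : s7.reg rV = 0 := by rw [f7 _ (by decide), r6 _ (by simp), i0 _ (by decide)]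
  have F7 : s7.reg rF ≠ 0 ↔ false ∈ x := by
    rw [f7 _ (by decide), f6 _ (by decide), f5 _ (by decide), f4 _ (by decide), f3 _ (by decide),
      f2 _ (by decide), hF]
  have F7' : s7.reg rF' ≠ 0 ↔ false ∈ x.drop (s3.reg rB) := by
    rw [f7 _ (by decide), f6 _ (by decide), f5 _ (by decide), hF']
  have key : false ∈ x → false ∈ x.drop ((x.takeWhile id).length + 1) →
      s7.reg rN = (x.takeWhile id).length ∧
      s7.reg rM = ((x.drop ((x.takeWhile id).length + 1)).takeWhile id).length ∧
      s7.reg rB = s7.reg rN + 1 + s7.reg rM + 1 ∧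
      s7.reg rR = s7.reg rB + s7.reg rN * s7.reg rM ∧ s3.reg rB = (x.takeWhile id).length + 1 ∧
      (s7.reg rL ≠ 0 ↔ x.getLast? = some true) := by
    intro hf hf'
    have e1 := congrArg List.length (eq_unaryThen_drop hf)
    have e2 := congrArg List.length (eq_unaryThen_drop hf')
    rw [length_unaryThen] at e1 e2
    rw [hn] at c2
    have b3 : s3.reg rB = (x.takeWhile id).length + 1 := by rw [c3, c2 (by omega)]
    rw [b3] at hm
    rw [hm, f4 _ (by decide), b3] at c5
    have n6 : s6.reg rN = (x.takeWhile id).length := by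
      rw [f6 _ (by decide), f5 _ (by decide), f4 _ (by decide), f3 _ (by decide),
        f2 _ (by decide), hn]
    have m6 : s6.reg rM = ((x.drop ((x.takeWhile id).length + 1)).takeWhile id).length := by
      rw [f6 _ (by decide), f5 _ (by decide), hm]
    have b6 : s6.reg rB = s6.reg rN + 1 + s6.reg rM + 1 := by
      rw [c6, c5 (by omega), n6, m6]
    obtain ⟨k1, k2⟩ := c7 (by omega) (by omega) (by omega)
    rw [f7 rN (by decide), f7 rM (by decide), f7 rB (by decide)]
    exact ⟨n6, m6, b6, k1, b3, k2⟩
  -- Without a first zero the position where the second number begins is meaningless, and so is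
  -- `rF'`. The guard therefore rejects on account of `rF` alone.
  have hbad : ∀ p : Cmd, s7.reg rF = 0 → (guard p).denote x s7 = s7 := fun p h => by
    rw [denote_guard p z7 l7, if_neg (fun h' => h'.1 h)]
  rw [denote_ite] at hs
  simp only [Test.eval, z7, Nat.le_zero, decide_eq_true_eq] at hs
  have f8 : ∀ i ∉ (copy rQ rR).writes, ((copy rQ rR).denote x s7).reg i = s7.reg i :=
    fun i hi => denote_reg _ _ _ hi
  constructor
  · intro hV
    have hf : false ∈ x := by
      rw [← F7]
      intro h
      rw [hbad _ h, denote_nop, ite_self] at hs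
      exact hV (hs ▸ v7)
    split_ifs at hs with h0
    · exact absurd (hs ▸ v7) hV
    · rw [denote_guard _ z7 l7] at hs
      split_ifs at hs with h1
      · have hf3 := F7'.1 h0
        have b3 : s3.reg rB = (x.takeWhile id).length + 1 := by
          have e1 := congrArg List.length (eq_unaryThen_drop hf)
          rw [length_unaryThen] at e1
          rw [c3, c2 (by omega), hn]
        rw [b3] at hf3
        obtain ⟨k1, k2, k3, k4, -, k6⟩ := key hf hf3
        refine ⟨_, _, hf, rfl, hf3, rfl, ?_⟩
        rw [← k2, ← k1, ← k3, ← k4, ← k6]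
        exact h1.2
      · exact absurd (hs ▸ v7) hV
  · rintro n m ⟨hf, hnn, hf', hmm, hle, hb⟩
    rw [hnn] at hf'
    obtain ⟨k1, k2, k3, k4, k5, k6⟩ := key hf hf'
    rw [← hnn] at k1 k2 k5 hf'
    rw [← hmm] at k2
    rw [k1, k2] at k3 k4
    rw [k3] at k4
    rw [k5] at F7'
    rw [if_neg (F7'.2 hf'), denote_guard _ z7 l7,
      if_pos ⟨F7.2 hf, by rw [k4]; exact hle, by rw [k4, k6]; exact hb⟩, denote_seq] at hs
    have hr : ∀ i, i ≠ rV → s.reg i = ((copy rQ rR).denote x s7).reg i := fun i hi => by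
      rw [hs, denote_inc, Store.assign_reg_of_ne _ _ hi]
    refine ⟨?_, ?_, ?_, ?_, ?_⟩
    · rw [hs, denote_inc, Store.assign_reg_self]
      exact Nat.succ_ne_zero _
    · rw [hr _ (by decide), f8 _ (by decide), k1]
    · rw [hr _ (by decide), f8 _ (by decide), k2]
    · rw [hr _ (by decide), f8 _ (by decide), k3]
    · rw [hr _ (by decide), copy_reg (by decide) (by decide) (by rw [k4]; exact hle), k4]

/-- Mark the elements of the set in row `rI`. -/
def markSet : Cmd := loop rJ rN (seq (pos rI rJ) (ite (.inp rR) (set rJ) nop))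

/-- Guess a subfamily, count its sets and mark the covered elements. -/
def guessSets : Cmd :=
  loop rI rM (seq (cert rG) (ite (.le rG zero) nop (seq (inc rS) markSet)))

/-- Count the elements that are not covered. -/
def countUncovered : Cmd := loop rJ rN (ite (.mem rJ) nop (inc rE))

/-- Verify a cover of bounded size. -/
def setCheck : Cmd :=
  seq guessSets (seq countUncovered (ite (.le rE zero) (ite (.cmp rS rQ) (inc rA) nop) nop))

variable {x : List Bool} {n m : ℕ} {s : Store}

theorem markSet_mem {i : ℕ} (hN : s.reg rN = n) (hB : s.reg rB = n + 1 + m + 1)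
    (hx : n + 1 + m + 1 ≤ x.length) (hI : s.reg rI = i) (hi : i < m) (u : ℕ) :
    (markSet.denote x s).mem u = true ↔ s.mem u = true ∨ u < n ∧ incidence x n m i u := by
  have := loop_rule (x := x) (a := rJ) (b := rN) (s := s)
    (p := seq (pos rI rJ) (ite (.inp rR) (set rJ) nop))
    (fun k s' => ∀ u, s'.mem u = true ↔ s.mem u = true ∨ u < k ∧ incidence x n m i u) (by decide)
    (fun _ _ _ h => h) (by simp)
    (fun k s' hk _ hJ hs h u => by
      have hN' := hs rN (by decide) (by decide)
      have hB' := hs rB (by decide) (by decide)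
      have hI' := hs rI (by decide) (by decide)
      have hp := pos_reg (x := x) (s := s') (i := rI) (j := rJ) (by decide) (by decide)
        (by omega) (by omega) (by omega) (by omega)
      rw [hB', hN', hI', hB, hN, hI, hJ, Nat.add_assoc _ (n * i)] at hp
      have hJ' : ((pos rI rJ).denote x s').reg rJ = k := by rw [pos_frame (by decide), hJ]
      have hm : ((pos rI rJ).denote x s').mem = s'.mem := denote_mem _ (by decide) _
      have ht : Test.eval x ((pos rI rJ).denote x s') (.inp rR) = true ↔ incidence x n m i k := by
        simp only [Test.eval, hp, beq_iff_eq]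
        rfl
      rw [denote_seq, denote_ite]
      by_cases hc : incidence x n m i k
      · rw [if_pos (ht.2 hc)]
        change Function.update ((pos rI rJ).denote x s').mem _ true u = true ↔ _
        rw [hm, hJ', Function.update_apply]
        split_ifs with huk
        · subst huk
          simp [hc]
        · rw [h u, Nat.lt_succ_iff_lt_or_eq]
          simp [huk]
      · rw [if_neg (mt ht.1 hc), denote_nop, hm, h u, Nat.lt_succ_iff_lt_or_eq]
        by_cases huk : u = k
        · subst huk
          simp [hc]
        · simp [huk])
  rw [hN, min_eq_left (by omega)] at this
  exact this u

/-- The bit for set `i` is read when row `i` is about to be scanned, so a chosen set is marked at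
once and the certificate is needed only once. -/
theorem guessSets_spec (hN : s.reg rN = n) (hM : s.reg rM = m) (hB : s.reg rB = n + 1 + m + 1)
    (hz : s.reg zero = 0) (hS : s.reg rS = 0) (hmem : s.mem = fun _ => false)
    (hx : n + 1 + m + 1 ≤ x.length) :
    (∀ u, (guessSets.denote x s).mem u = true ↔
      u < n ∧ ∃ i < m, s.cert[i]? = some true ∧ incidence x n m i u) ∧
    (guessSets.denote x s).reg rS =
      ∑ i ∈ Finset.range m, if s.cert[i]? = some true then 1 else 0 := by
  have := loop_rule (x := x) (a := rI) (b := rM) (s := s)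
    (p := seq (cert rG) (ite (.le rG zero) nop (seq (inc rS) markSet)))
    (fun k s' => ((∀ u, s'.mem u = true ↔
      u < n ∧ ∃ i < k, s.cert[i]? = some true ∧ incidence x n m i u) ∧
      s'.reg rS = ∑ i ∈ Finset.range k, if s.cert[i]? = some true then 1 else 0) ∧
      s'.cert = s.cert.drop k) (by decide)
    (fun k s' v h => ⟨⟨h.1.1, by rw [Store.assign_reg_of_ne _ _ (by decide)]; exact h.1.2⟩, h.2⟩)
    (by simp [hmem, hS])
    (fun k s' hk _ hI hs ⟨⟨h1, h2⟩, h3⟩ => by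
      have hf : ∀ i, i ≠ rG → ((cert rG).denote x s').reg i = s'.reg i := fun i hi =>
        denote_reg x (cert rG) _ (by simpa [writes] using hi)
      have hc : ((cert rG).denote x s').cert = s.cert.drop (k + 1) := by
        change s'.cert.tail = _
        rw [h3, List.tail_drop]
      have hg : ((cert rG).denote x s').reg rG = (s.cert[k]? == some true).toNat := by
        rw [← List.head?_drop, ← h3]
        exact Store.assign_reg_self s' rG _
      have hm : ((cert rG).denote x s').mem = s'.mem := rfl
      rw [denote_seq]
      generalize (cert rG).denote x s' = t at *
      have hz' : t.reg zero = 0 := by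
        rw [hf _ (by decide), hs _ (by decide) (by decide), hz]
      rw [denote_ite]
      simp only [Test.eval, hz', hg, denote_nop, Finset.sum_range_succ]
      by_cases hb : s.cert[k]? = some true
      · rw [if_neg (by simp [hb]), if_pos hb, denote_seq]
        have e : ∀ i, i ≠ rS → ((inc rS).denote x t).reg i = t.reg i := fun i hi =>
          Store.assign_reg_of_ne _ _ hi
        have hmark := markSet_mem (x := x) (n := n) (m := m) (i := k) (s := (inc rS).denote x t)
          (by rw [e _ (by decide), hf _ (by decide), hs _ (by decide) (by decide), hN])
          (by rw [e _ (by decide), hf _ (by decide), hs _ (by decide) (by decide), hB]) hx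
          (by rw [e _ (by decide), hf _ (by decide), hI]) (by omega)
        refine ⟨⟨fun u => ?_, ?_⟩, ?_⟩
        · rw [hmark]
          change t.mem u = true ∨ _ ↔ _
          rw [hm, h1 u, ← and_or_left]
          refine and_congr_right fun _ => ?_
          constructor
          · rintro (⟨i, hi, h⟩ | h)
            · exact ⟨i, by omega, h⟩
            · exact ⟨k, by omega, hb, h⟩
          · rintro ⟨i, hi, h⟩
            rcases Nat.lt_succ_iff_lt_or_eq.1 hi with hi | rfl
            · exact .inl ⟨i, hi, h⟩
            · exact .inr h.2
        · rw [denote_reg _ _ _ (by decide), denote_inc, Store.assign_reg_self, hf _ (by decide), h2]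
        · rw [denote_cert x (by decide)]
          exact hc
      · rw [if_pos (by simp [hb]), if_neg hb]
        refine ⟨⟨fun u => ?_, ?_⟩, hc⟩
        · rw [hm, h1 u]
          refine and_congr_right fun _ => ⟨fun ⟨i, hi, h⟩ => ⟨i, by omega, h⟩, ?_⟩
          rintro ⟨i, hi, h⟩
          rcases Nat.lt_succ_iff_lt_or_eq.1 hi with hi | rfl
          · exact ⟨i, hi, h⟩
          · exact absurd h.1 hb
        · rw [hf _ (by decide), h2, Nat.add_zero])
  rw [hM, min_eq_left (by omega)] at this
  exact this.1

theorem countUncovered_reg (hN : s.reg rN = n) (hE : s.reg rE = 0) (hx : n ≤ x.length) :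
    (countUncovered.denote x s).reg rE = 0 ↔ ∀ u < n, s.mem u = true := by
  have := loop_rule (x := x) (a := rJ) (b := rN) (s := s) (p := ite (.mem rJ) nop (inc rE))
    (fun k s' => s'.mem = s.mem ∧ (s'.reg rE = 0 ↔ ∀ u < k, s.mem u = true)) (by decide)
    (fun k s' v h => by rw [Store.assign_reg_of_ne _ _ (by decide)]; exact h) (by simp [hE])
    (fun k s' _ _ hJ _ ⟨h1, h2⟩ => by
      rw [denote_ite]
      simp only [Test.eval, h1, hJ]
      rw [Nat.forall_lt_succ_right, ← h2]
      split_ifs with h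
      · simp [denote_nop, h1, h]
      · simp [denote_inc, h1, h])
  rw [hN, min_eq_left hx] at this
  exact this.2

theorem setCheck_spec {y : List Bool} (hs : s.Start x y) (hN : s.reg rN = n) (hM : s.reg rM = m)
    (hB : s.reg rB = n + 1 + m + 1) (hQ : s.reg rQ = n + 1 + m + 1 + n * m)
    (hx : n + 1 + m + 1 ≤ x.length) :
    (setCheck.denote x s).reg rA ≠ 0 ↔
      (∀ u < n, ∃ i < m, y[i]? = some true ∧ incidence x n m i u) ∧
      cmpBits true (∑ i ∈ Finset.range m, if y[i]? = some true then 1 else 0).bits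
        (x.drop (n + 1 + m + 1 + n * m)) = true := by
  obtain ⟨h1, h2⟩ := guessSets_spec (x := x) hN hM hB (hs.reg _ (by simp)) (hs.reg _ (by simp))
    hs.mem hx
  rw [hs.cert] at h1 h2
  have f1 : ∀ i ∉ guessSets.writes, (guessSets.denote x s).reg i = s.reg i :=
    fun i hi => denote_reg _ _ _ hi
  rw [setCheck, denote_seq, denote_seq]
  generalize guessSets.denote x s = t at *
  have h3 := countUncovered_reg (x := x) (s := t) (n := n) (by rw [f1 _ (by decide), hN])
    (by rw [f1 _ (by decide), hs.reg _ (by simp)]) (by omega)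
  have f2 : ∀ i ∉ countUncovered.writes, (countUncovered.denote x t).reg i = t.reg i :=
    fun i hi => denote_reg _ _ _ hi
  generalize countUncovered.denote x t = t' at *
  have hz : t'.reg zero = 0 := by rw [f2 _ (by decide), f1 _ (by decide), hs.reg _ (by simp)]
  have hA : t'.reg rA = 0 := by rw [f2 _ (by decide), f1 _ (by decide), hs.reg _ (by simp)]
  have hS := (f2 rS (by decide)).trans h2
  have hQ' : t'.reg rQ = n + 1 + m + 1 + n * m := by
    rw [f2 _ (by decide), f1 _ (by decide), hQ]
  have hcov : t'.reg rE = 0 ↔ ∀ u < n, ∃ i < m, y[i]? = some true ∧ incidence x n m i u := by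
    rw [h3]
    exact forall₂_congr fun u hu => by rw [h1 u, and_iff_right hu]
  rw [← hcov, denote_ite, denote_ite]
  simp only [Test.eval, hz, hS, hQ', Nat.le_zero, decide_eq_true_eq]
  generalize (∑ i ∈ Finset.range m, if y[i]? = some true then 1 else 0) = c
  split_ifs with c1 c2
  · simp [denote_inc, c1, c2]
  · simp [denote_nop, hA, c2]
  · simp [denote_nop, hA, c1]

end Cmd

/-- Subfamilies correspond to the first `m` certificate bits. The unary number `m` is part of the
input, so certificates of the length of the input are long enough. -/
theorem SetCoverInstance.solvable_iff (I : SetCoverInstance) {x : List Bool} {L : ℕ}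
    (hL : I.m ≤ L)
    (hx : ∀ (i : Fin I.m) (j : Fin I.n), incidence x I.n I.m i j ↔ j ∈ I.sets i) :
    I.Solvable ↔ ∃ y : List Bool, y.length = L ∧
      (∀ u < I.n, ∃ i < I.m, y[i]? = some true ∧ incidence x I.n I.m i u) ∧
      (∑ i ∈ Finset.range I.m, if y[i]? = some true then 1 else 0) ≤ I.bound := by
  have hsum : ∀ y : List Bool,
      (∑ i ∈ Finset.range I.m, if y[i]? = some true then 1 else 0) =
        (Finset.univ.filter fun i : Fin I.m => y[(i : ℕ)]? = some true).card := fun y => by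
    rw [Finset.card_filter, Finset.sum_range]
  simp only [hsum]
  constructor
  · rintro ⟨C, hC, hcov⟩
    -- The certificate is the characteristic word of `C`, padded with zeros to length `L`.
    have hy : ∀ i : Fin I.m, ((List.range L).map fun k =>
        decide (∃ h : k < I.m, (⟨k, h⟩ : Fin I.m) ∈ C))[(i : ℕ)]? = some true ↔ i ∈ C := by
      intro i
      rw [List.getElem?_map, List.getElem?_range (i.isLt.trans_le hL)]
      simp
    refine ⟨(List.range L).map fun k => decide (∃ h : k < I.m, (⟨k, h⟩ : Fin I.m) ∈ C),
      by rw [List.length_map, List.length_range], fun u hu => ?_, ?_⟩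
    · obtain ⟨i, hi, hu'⟩ := hcov ⟨u, hu⟩
      exact ⟨i, i.isLt, (hy i).2 hi, (hx i ⟨u, hu⟩).2 hu'⟩
    · simpa only [hy, Finset.filter_univ_mem] using hC
  · rintro ⟨y, -, hcov, hC⟩
    refine ⟨_, hC, fun e => ?_⟩
    obtain ⟨i, hi, hy, he⟩ := hcov e e.isLt
    exact ⟨⟨i, hi⟩, Finset.mem_filter.2 ⟨Finset.mem_univ _, hy⟩, (hx ⟨i, hi⟩ e).1 he⟩

theorem setCover_inEPNL : InEPNL setCover := by
  have henc : ∀ I : SetCoverInstance, SetCoverInstance.encode I = unaryThen I.n (unaryThen I.m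
    (matrixBits (fun i e => e ∈ I.sets i) ++ Nat.bits I.bound)) := fun I => rfl
  have hfam : ∀ I : SetCoverInstance, IsBoundedFamily (SetCoverInstance.encode I) I.n I.m :=
    fun I => isBoundedFamily_unaryThen _ _
  have hreg := fun (I : SetCoverInstance) (y : List Bool) =>
    (Cmd.setParse_reg (SetCoverInstance.encode I) y).2 I.n I.m (hfam I)
  refine inEPNL_ofEncoding _ _ _ Cmd.setParse Cmd.setCheck rV rA rN (by decide) (by decide)
    (fun x y hv => ?_) (fun I y => ⟨(hreg I y).1, (hreg I y).2.1⟩) (fun I => ?_)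
  · classical
    obtain ⟨n, m, h⟩ := (Cmd.setParse_reg x y).1 hv
    obtain ⟨A, b, rfl⟩ := h.exists_eq
    refine ⟨⟨n, m, fun i => Finset.univ.filter (A i), b⟩, ?_⟩
    rw [henc]
    simp
  · obtain ⟨-, -, -, -, hle, -⟩ := hfam I
    have hspec := fun y => Cmd.setCheck_spec (x := SetCoverInstance.encode I) (y := y)
      (Cmd.start_denote (p := Cmd.setParse) (by decide) (by decide) (by decide) (by decide))
      (hreg I y).2.1 (hreg I y).2.2.1 (hreg I y).2.2.2.1 (hreg I y).2.2.2.2 (by omega)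
    simp only [hspec]
    rw [I.solvable_iff (x := SetCoverInstance.encode I) (L := (SetCoverInstance.encode I).length)
      (by omega) (fun i j => incidence_unaryThen _ _ i j)]
    rw [henc, drop_family_unaryThen]
    simp only [cmpBits_bits_le]

end EPNL

theorem mainTheorem4 :
    EPNL.InEPNL EPNL.directedHamiltonicity ∧
    EPNL.InEPNL EPNL.optimalLinearArrangement ∧
    EPNL.InEPNL EPNL.directedFeedbackArcSet ∧
    EPNL.InEPNL EPNL.setCover :=
  ⟨EPNL.directedHamiltonicity_inEPNL, EPNL.optimalLinearArrangement_inEPNL,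
    EPNL.directedFeedbackArcSet_inEPNL, EPNL.setCover_inEPNL⟩
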